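/- Let $\mathcal M=(M,\mathcal O_{\mathcal M})$ be a real smooth supermanifold of dimension $n|m$ whose underlying manifold $M$ is connected (and non-empty), let $\mathcal E$ be a locally free sheaf of $\mathcal O_{\mathcal M}$-supermodules of rank $p|q$ on $\mathcal M$, and let $\nabla$ be a connection on $\mathcal E$, i.e. an even morphism of sheaves $\mathcal T_{\mathcal M}\otimes_{\mathbb R}\mathcal E\to\mathcal E$, where $\mathcal T_{\mathcal M}$ is the sheaf of superderivations of $\mathcal O_{\mathcal M}$, with $\nabla_{fY}X=f\nabla_YX$ and $\nabla_Y(fX)=(Yf)X+(-1)^{|Y||f|}f\nabla_YX$. For $x\in M$ let $\mathcal E_x$ be the fibre of $\mathcal E$ at $x$ (germs at $x$ of sections modulo the products of sections with superfunctions vanishing at $x$), and let $X_x\in\mathcal E_x$ denote the value at $x$ of a section $X$. Let $\tilde\nabla$ be the connection on the vector bundle $E=\bigcup_{x\in M}\mathcal E_x$ over $M$ induced by $\nabla$, so that $\tilde\nabla_{\tilde Y}\tilde X=(\nabla_YX)^{\sim}$ for even vector fields $Y$ and sections $X$; let $\tau_\gamma:\mathcal E_x\to\mathcal E_y$ be its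 parallel displacement along a piecewise smooth curve $\gamma$ in $M$ from $x$ to $y$, and $\mathrm{Hol}(\tilde\nabla)_x\subset \mathrm{GL}(\mathcal E_x)$ its holonomy group at $x$, consisting of the $\tau_\gamma$ for all piecewise smooth loops $\gamma$ at $x$. Let $\mathfrak{hol}(\nabla)_x$ be the supersubalgebra of the Lie superalgebra $\mathfrak{gl}(\mathcal E_x)$ generated by all operators $$\tau_\gamma^{-1}\circ\bar\nabla^r_{Y_r,\dots,Y_1}R_y(Y,Z)\circ\tau_\gamma,$$ where $\gamma$ is a curve in $M$ from $x$ to a point $y$, $r\ge 0$, $Y,Z,Y_1,\dots,Y_r\in T_y\mathcal M$, $R(Y,Z)=[\nabla_Y,\nabla_Z]-\nabla_{[Y,Z]}$ is the curvature of $\nabla$, $\bar\nabla$ is a connection on $\mathcal T_{\mathcal M}|_U$ for an open neighbourhood $U$ of $y$, and $\bar\nabla^rR$ is the $r$-th covariant derivative of $R$ formed with $\nabla$ and $\bar\nabla$. Then the following conditions are equivalent: (i) there exists a non-zero parallel section $X\in\mathcal E(M)$ (that is, $\nabla X=0$); (ii) for every point $x\in M$ there exists a non-zero vector of $\mathcal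 E_x$ that is annihilated by $\mathfrak{hol}(\nabla)_x$ and fixed by $\mathrm{Hol}(\tilde\nabla)_x$; (iii) for some point $x\in M$ there exists such a vector. Moreover, for every $x\in M$ the map $X\mapsto X_x$ is a bijection from the set of parallel sections $X\in\mathcal E(M)$ onto the set of vectors of $\mathcal E_x$ that are annihilated by $\mathfrak{hol}(\nabla)_x$ and fixed by $\mathrm{Hol}(\tilde\nabla)_x$. -/

import Mathlib

open TopologicalSpace Set
open scoped Manifold ContDiff TensorProduct

universe u v w

noncomputable section

/-! ### Superalgebras and sheaves of superalgebras -/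

/-- The Koszul sign `(-1)^{ij}` of two parities `i, j ∈ ℤ/2`. -/
def koszul (i j : ZMod 2) : ℤ := if i = 1 ∧ j = 1 then -1 else 1

theorem koszul_add_left (i j k : ZMod 2) : koszul (i + j) k = koszul i k * koszul j k := by
  revert i j k; decide

theorem koszul_add_right (i j k : ZMod 2) : koszul i (j + k) = koszul i j * koszul i k := by
  revert i j k; decide

theorem koszul_comm (i j : ZMod 2) : koszul i j = koszul j i := by
  revert i j; decide

theorem koszul_mul_self (i j : ZMod 2) : koszul i j * koszul i j = 1 := by
  revert i j; decide

/-- A sheaf of (unital, associative, supercommutative) real superalgebras on a topological space.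
`par U 0` and `par U 1` are the even and the odd part of the superalgebra `sec U`. -/
structure SuperalgebraSheaf (M : Type u) [TopologicalSpace M] where
  sec : Opens M → Type v
  [ring : ∀ U, Ring (sec U)]
  [algebra : ∀ U, Algebra ℝ (sec U)]
  par : ∀ U, ZMod 2 → Submodule ℝ (sec U)
  par_isInternal : ∀ U, DirectSum.IsInternal (par U)
  one_mem : ∀ U, (1 : sec U) ∈ par U 0
  mul_mem : ∀ {U i j} {f g : sec U}, f ∈ par U i → g ∈ par U j → f * g ∈ par U (i + j)
  supercomm : ∀ {U i j} {f g : sec U}, f ∈ par U i → g ∈ par U j → f * g = koszul i j • (g * f)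
  res : ∀ {U V : Opens M}, V ≤ U → sec U →ₐ[ℝ] sec V
  res_mem : ∀ {U V i} (h : V ≤ U) {f : sec U}, f ∈ par U i → res h f ∈ par V i
  res_refl : ∀ {U} (f : sec U), res le_rfl f = f
  res_res : ∀ {U V W} (h : V ≤ U) (h' : W ≤ V) (f : sec U),
    res h' (res h f) = res (h'.trans h) f
  glue : ∀ (𝒰 : Set (Opens M)) (s : ∀ U : 𝒰, sec U.1),
    (∀ U V : 𝒰, res (inf_le_left : U.1 ⊓ V.1 ≤ U.1) (s U) = res inf_le_right (s V)) →
    ∃! t : sec (sSup 𝒰), ∀ U : 𝒰, res (le_sSup U.2) t = s U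

attribute [instance] SuperalgebraSheaf.ring SuperalgebraSheaf.algebra

/-! ### Supermanifolds -/

section Supermanifold

variable {M : Type u} [TopologicalSpace M]

/-- Restriction of smooth functions from an open set to a smaller one. -/
def smoothRestrict (n : ℕ) [ChartedSpace (EuclideanSpace ℝ (Fin n)) M] {U V : Opens M}
    (h : V ≤ U) : C^∞⟮𝓡 n, U; 𝓘(ℝ, ℝ), ℝ⟯ →ₐ[ℝ] C^∞⟮𝓡 n, V; 𝓘(ℝ, ℝ), ℝ⟯ :=
  { ContMDiffMap.restrictRingHom (𝓡 n) 𝓘(ℝ, ℝ) ℝ h with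
    commutes' := fun _ => rfl }

/-- Evaluation of smooth functions on an open set at one of its points. -/
def smoothEval (n : ℕ) [ChartedSpace (EuclideanSpace ℝ (Fin n)) M] {U : Opens M} (x : U) :
    C^∞⟮𝓡 n, U; 𝓘(ℝ, ℝ), ℝ⟯ →ₐ[ℝ] ℝ :=
  (Pi.evalAlgHom ℝ (fun _ : U => ℝ) x).comp ContMDiffMap.coeFnAlgHom

/-- The Grassmann algebra with `m` odd generators. -/
abbrev Grassmann (m : ℕ) : Type := ExteriorAlgebra ℝ (Fin m → ℝ)

/-- The even (`i = 0`) and the odd (`i = 1`) part of the Grassmann algebra. -/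
def Grassmann.par (m : ℕ) (i : ZMod 2) : Submodule ℝ (Grassmann m) :=
  CliffordAlgebra.evenOdd (0 : QuadraticForm ℝ (Fin m → ℝ)) i

/-- The superalgebra `C^∞(U) ⊗ Λ_m`. -/
abbrev LocalModel (n m : ℕ) [ChartedSpace (EuclideanSpace ℝ (Fin n)) M] (U : Opens M) : Type u :=
  C^∞⟮𝓡 n, U; 𝓘(ℝ, ℝ), ℝ⟯ ⊗[ℝ] Grassmann m

/-- The even and the odd part of `C^∞(U) ⊗ Λ_m`: smooth functions are even. -/
def LocalModel.par (n m : ℕ) [ChartedSpace (EuclideanSpace ℝ (Fin n)) M] (U : Opens M)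
    (i : ZMod 2) : Submodule ℝ (LocalModel n m U) :=
  LinearMap.range (TensorProduct.map
    (LinearMap.id : C^∞⟮𝓡 n, U; 𝓘(ℝ, ℝ), ℝ⟯ →ₗ[ℝ] _) (Grassmann.par m i).subtype)

/-- The restriction `C^∞(U) ⊗ Λ_m → C^∞(V) ⊗ Λ_m`. -/
def LocalModel.res (n m : ℕ) [ChartedSpace (EuclideanSpace ℝ (Fin n)) M] {U V : Opens M}
    (h : V ≤ U) : LocalModel n m U →ₐ[ℝ] LocalModel n m V :=
  Algebra.TensorProduct.map (smoothRestrict n h) (AlgHom.id ℝ _)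

/-- The map `∑ f_α ξ^α ↦ f_∅(x)` on `C^∞(U) ⊗ Λ_m`. -/
def LocalModel.value (n m : ℕ) [ChartedSpace (EuclideanSpace ℝ (Fin n)) M] {U : Opens M} (x : U) :
    LocalModel n m U →ₐ[ℝ] ℝ :=
  Algebra.TensorProduct.lift (smoothEval n x)
    (ExteriorAlgebra.algebraMapInv : Grassmann m →ₐ[ℝ] ℝ) fun _ _ => Commute.all _ _

/-- An isomorphism of sheaves of superalgebras over `W` between a sheaf of superalgebras and
`C^∞ ⊗ Λ_m`. -/
structure Splitting (n m : ℕ) [ChartedSpace (EuclideanSpace ℝ (Fin n)) M]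
    (𝒪 : SuperalgebraSheaf.{u, v} M) (W : Opens M) where
  iso : ∀ V : Opens M, V ≤ W → (𝒪.sec V ≃ₐ[ℝ] LocalModel n m V)
  iso_mem_iff : ∀ (V : Opens M) (hV : V ≤ W) (i : ZMod 2) (f : 𝒪.sec V),
    iso V hV f ∈ LocalModel.par n m V i ↔ f ∈ 𝒪.par V i
  iso_res : ∀ (U V : Opens M) (hU : U ≤ W) (h : V ≤ U) (f : 𝒪.sec U),
    iso V (h.trans hU) (𝒪.res h f) = LocalModel.res n m h (iso U hU f)

/-- A real smooth supermanifold of dimension `n|m` with underlying smooth manifold `M`. -/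
structure Supermanifold (n m : ℕ) (M : Type u) [TopologicalSpace M]
    [ChartedSpace (EuclideanSpace ℝ (Fin n)) M] extends SuperalgebraSheaf.{u, v} M where
  locally_split : ∀ x : M, ∃ W : Opens M, x ∈ W ∧ Nonempty (Splitting n m toSuperalgebraSheaf W)

end Supermanifold

namespace Supermanifold

variable {n m : ℕ} {M : Type u} [TopologicalSpace M] [ChartedSpace (EuclideanSpace ℝ (Fin n)) M]
  (𝒮 : Supermanifold.{u, v} n m M)

/-- An open neighbourhood of `x` over which the structure sheaf splits. -/
def splitNhd (x : M) : Opens M := (𝒮.locally_split x).choose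

theorem mem_splitNhd (x : M) : x ∈ 𝒮.splitNhd x := (𝒮.locally_split x).choose_spec.1

/-- A splitting of the structure sheaf near `x`. -/
def splitting (x : M) : Splitting n m 𝒮.toSuperalgebraSheaf (𝒮.splitNhd x) :=
  (𝒮.locally_split x).choose_spec.2.some

/-- The value `f̃(x)` of a superfunction `f` at a point `x` (it is the same for all splittings of
the structure sheaf near `x`). -/
def value {U : Opens M} (x : M) (hx : x ∈ U) : 𝒮.sec U →ₐ[ℝ] ℝ :=
  (LocalModel.value n m (⟨x, hx, 𝒮.mem_splitNhd x⟩ : (U ⊓ 𝒮.splitNhd x : Opens M))).comp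
    (((𝒮.splitting x).iso (U ⊓ 𝒮.splitNhd x) inf_le_right).toAlgHom.comp (𝒮.res inf_le_left))

open Classical in
/-- The function `f̃` underlying a superfunction `f` over `U`, extended by zero outside `U`. -/
def body {U : Opens M} (f : 𝒮.sec U) (x : M) : ℝ := if hx : x ∈ U then 𝒮.value x hx f else 0

end Supermanifold

/-! ### Sheaves of supermodules -/

/-- A presheaf of (left) supermodules over a sheaf of superalgebras. -/
structure SupermodulePresheaf {M : Type u} [TopologicalSpace M]
    (𝒪 : SuperalgebraSheaf.{u, v} M) where
  sec : Opens M → Type w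
  [addCommGroup : ∀ U, AddCommGroup (sec U)]
  [moduleReal : ∀ U, Module ℝ (sec U)]
  [module : ∀ U, Module (𝒪.sec U) (sec U)]
  [isScalarTower : ∀ U, IsScalarTower ℝ (𝒪.sec U) (sec U)]
  par : ∀ U, ZMod 2 → Submodule ℝ (sec U)
  par_isInternal : ∀ U, DirectSum.IsInternal (par U)
  smul_mem : ∀ {U i j} {f : 𝒪.sec U} {s : sec U},
    f ∈ 𝒪.par U i → s ∈ par U j → f • s ∈ par U (i + j)
  res : ∀ {U V : Opens M}, V ≤ U → sec U →ₗ[ℝ] sec V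
  res_smul : ∀ {U V} (h : V ≤ U) (f : 𝒪.sec U) (s : sec U), res h (f • s) = 𝒪.res h f • res h s
  res_mem : ∀ {U V i} (h : V ≤ U) {s : sec U}, s ∈ par U i → res h s ∈ par V i
  res_refl : ∀ {U} (s : sec U), res le_rfl s = s
  res_res : ∀ {U V W} (h : V ≤ U) (h' : W ≤ V) (s : sec U),
    res h' (res h s) = res (h'.trans h) s

attribute [instance] SupermodulePresheaf.addCommGroup SupermodulePresheaf.moduleReal
  SupermodulePresheaf.module SupermodulePresheaf.isScalarTower

namespace SupermodulePresheaf

variable {M : Type u} [TopologicalSpace M] {𝒪 : SuperalgebraSheaf.{u, v} M}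
  (E : SupermodulePresheaf.{u, v, w} 𝒪)

/-- The sheaf condition. -/
def IsSheaf : Prop :=
  ∀ (𝒰 : Set (Opens M)) (s : ∀ U : 𝒰, E.sec U.1),
    (∀ U V : 𝒰, E.res (inf_le_left : U.1 ⊓ V.1 ≤ U.1) (s U) = E.res inf_le_right (s V)) →
    ∃! t : E.sec (sSup 𝒰), ∀ U : 𝒰, E.res (le_sSup U.2) t = s U

/-- `e` is a basis of the restriction of `E` to `W`, with `p` even and `q` odd elements. -/
structure IsFrame {p q : ℕ} (W : Opens M) (e : Fin p ⊕ Fin q → E.sec W) : Prop where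
  even : ∀ I, e (Sum.inl I) ∈ E.par W 0
  odd : ∀ Φ, e (Sum.inr Φ) ∈ E.par W 1
  linearIndependent : ∀ (V : Opens M) (h : V ≤ W),
    LinearIndependent (𝒪.sec V) fun A => E.res h (e A)
  span_eq_top : ∀ (V : Opens M) (h : V ≤ W),
    Submodule.span (𝒪.sec V) (Set.range fun A => E.res h (e A)) = ⊤

/-- `E` is locally free of rank `p|q`. -/
def IsLocallyFree (p q : ℕ) : Prop :=
  ∀ x : M, ∃ W : Opens M, x ∈ W ∧ ∃ e : Fin p ⊕ Fin q → E.sec W, E.IsFrame W e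

end SupermodulePresheaf

/-! ### The tangent sheaf -/

namespace SuperalgebraSheaf

variable {M : Type u} [TopologicalSpace M] (𝒪 : SuperalgebraSheaf.{u, v} M)

theorem exists_add (U : Opens M) (f : 𝒪.sec U) :
    ∃ f₀ ∈ 𝒪.par U 0, ∃ f₁ ∈ 𝒪.par U 1, f₀ + f₁ = f := by
  have h := (DirectSum.isInternal_submodule_iff_isCompl (𝒪.par U) (i := 0) (j := 1)
    (by decide) (by ext i; revert i; decide)).1 (𝒪.par_isInternal U)
  exact Submodule.mem_sup.1 (h.sup_eq_top ▸ Submodule.mem_top : f ∈ 𝒪.par U 0 ⊔ 𝒪.par U 1)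

theorem eq_zero_of_mem {U : Opens M} {f : 𝒪.sec U} {i : ZMod 2}
    (h₀ : f ∈ 𝒪.par U i) (h₁ : f ∈ 𝒪.par U (1 + i)) : f = 0 := by
  have hi : ∀ k : ZMod 2, k = 0 ∨ k = 1 := by decide
  have h := (DirectSum.isInternal_submodule_iff_isCompl (𝒪.par U) (i := 0) (j := 1)
    (by decide) (by ext i; revert i; decide)).1 (𝒪.par_isInternal U)
  obtain rfl | rfl := hi i
  · exact Submodule.disjoint_def.1 h.disjoint f h₀ h₁
  · exact Submodule.disjoint_def.1 h.disjoint f h₁ h₀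

/-- Families of real linear endomorphisms of the superalgebras `𝒪(V)`, `V ⊆ U`. -/
abbrev EndFamily (U : Opens M) : Type (max u v) := 
  ∀ V : {V : Opens M // V ≤ U}, 𝒪.sec V.1 →ₗ[ℝ] 𝒪.sec V.1

/-- The superderivations of parity `i` of the sheaf `𝒪|_U`. -/
def superDer (U : Opens M) (i : ZMod 2) : Submodule ℝ (𝒪.EndFamily U) where
  carrier := {D |
    (∀ (V W : {V : Opens M // V ≤ U}) (h : W.1 ≤ V.1) (f : 𝒪.sec V.1),
      𝒪.res h (D V f) = D W (𝒪.res h f)) ∧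
    (∀ (V : {V : Opens M // V ≤ U}) (j : ZMod 2), ∀ f ∈ 𝒪.par V.1 j, D V f ∈ 𝒪.par V.1 (i + j)) ∧
    (∀ (V : {V : Opens M // V ≤ U}) (j : ZMod 2), ∀ f ∈ 𝒪.par V.1 j, ∀ g,
      D V (f * g) = D V f * g + koszul i j • (f * D V g))}
  zero_mem' := by
    refine ⟨fun V W h f => ?_, fun V j f _ => ?_, fun V j f _ g => ?_⟩ <;> simp
  add_mem' := by
    rintro D D' ⟨h₁, h₂, h₃⟩ ⟨h₁', h₂', h₃'⟩
    refine ⟨fun V W h f => ?_, fun V j f hf => ?_, fun V j f hf g => ?_⟩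
    · simp [h₁ V W h, h₁' V W h]
    · exact add_mem (h₂ V j f hf) (h₂' V j f hf)
    · simp only [Pi.add_apply, LinearMap.add_apply, h₃ V j f hf, h₃' V j f hf, add_mul, mul_add,
        smul_add]
      abel
  smul_mem' := by
    rintro c D ⟨h₁, h₂, h₃⟩
    refine ⟨fun V W h f => ?_, fun V j f hf => ?_, fun V j f hf g => ?_⟩
    · simp [h₁ V W h]
    · exact Submodule.smul_mem _ c (h₂ V j f hf)
    · simp only [Pi.smul_apply, LinearMap.smul_apply, h₃ V j f hf, smul_add, smul_mul_assoc,
        mul_smul_comm, smul_comm c (koszul i j)]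

/-- The vector fields over `U`: sums of an even and an odd superderivation of `𝒪|_U`. -/
def vectorFields (U : Opens M) : Submodule ℝ (𝒪.EndFamily U) := 𝒪.superDer U 0 ⊔ 𝒪.superDer U 1

theorem superDer_le (U : Opens M) (i : ZMod 2) : 𝒪.superDer U i ≤ 𝒪.vectorFields U := by
  obtain rfl | rfl : i = 0 ∨ i = 1 := by revert i; decide
  · exact le_sup_left
  · exact le_sup_right

/-- The product of a superfunction with a family of endomorphisms. -/
def mulFamily {U : Opens M} (f : 𝒪.sec U) : 𝒪.EndFamily U →ₗ[ℝ] 𝒪.EndFamily U where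
  toFun D V := (LinearMap.mulLeft ℝ (𝒪.res V.2 f)).comp (D V)
  map_add' D D' := by funext V; ext g; simp [mul_add]
  map_smul' c D := by funext V; ext g; simp

theorem mulFamily_mem {U : Opens M} {i j : ZMod 2} {f : 𝒪.sec U} (hf : f ∈ 𝒪.par U i)
    {D : 𝒪.EndFamily U} (hD : D ∈ 𝒪.superDer U j) : 𝒪.mulFamily f D ∈ 𝒪.superDer U (i + j) := by
  obtain ⟨h₁, h₂, h₃⟩ := hD
  refine ⟨fun V W h g => ?_, fun V k g hg => ?_, fun V k g hg g' => ?_⟩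
  · change 𝒪.res h (𝒪.res V.2 f * D V g) = 𝒪.res W.2 f * D W (𝒪.res h g)
    rw [map_mul, 𝒪.res_res, h₁ V W h]
  · rw [add_assoc]
    exact 𝒪.mul_mem (𝒪.res_mem V.2 hf) (h₂ V k g hg)
  · have hc := 𝒪.supercomm (𝒪.res_mem V.2 hf) hg
    simp only [mulFamily, LinearMap.coe_mk, AddHom.coe_mk, LinearMap.comp_apply,
      LinearMap.mulLeft_apply, h₃ V k g hg, mul_add, mul_smul_comm, ← mul_assoc, hc,
      koszul_add_left, smul_mul_assoc, smul_smul]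
    rw [mul_comm (koszul j k)]

theorem mulFamily_mem_vectorFields {U : Opens M} (f : 𝒪.sec U) {D : 𝒪.EndFamily U}
    (hD : D ∈ 𝒪.vectorFields U) : 𝒪.mulFamily f D ∈ 𝒪.vectorFields U := by
  obtain ⟨D₀, h₀, D₁, h₁, rfl⟩ := Submodule.mem_sup.1 hD
  obtain ⟨f₀, hf₀, f₁, hf₁, rfl⟩ := 𝒪.exists_add U f
  have key : 𝒪.mulFamily (f₀ + f₁) = 𝒪.mulFamily f₀ + 𝒪.mulFamily f₁ := by
    ext D; simp [mulFamily, add_mul]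
  rw [key, LinearMap.add_apply, map_add, map_add]
  exact add_mem
    (add_mem (𝒪.superDer_le _ _ (𝒪.mulFamily_mem hf₀ h₀))
      (𝒪.superDer_le _ _ (𝒪.mulFamily_mem hf₀ h₁)))
    (add_mem (𝒪.superDer_le _ _ (𝒪.mulFamily_mem hf₁ h₀))
      (𝒪.superDer_le _ _ (𝒪.mulFamily_mem hf₁ h₁)))

theorem superDer_isCompl (U : Opens M) : IsCompl
    ((𝒪.superDer U 0).submoduleOf (𝒪.vectorFields U))
    ((𝒪.superDer U 1).submoduleOf (𝒪.vectorFields U)) := by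
  constructor
  · rw [Submodule.disjoint_def]
    rintro ⟨D, hD⟩ ⟨-, h₀, -⟩ ⟨-, h₁, -⟩
    ext V f
    have hom : ∀ j, ∀ g ∈ 𝒪.par V.1 j, D V g = 0 := fun j g hg =>
      𝒪.eq_zero_of_mem (i := j) (by simpa using h₀ V j g hg) (h₁ V j g hg)
    obtain ⟨f₀, hf₀, f₁, hf₁, rfl⟩ := 𝒪.exists_add V.1 f
    simp [hom 0 f₀ hf₀, hom 1 f₁ hf₁]
  · rw [codisjoint_iff, eq_top_iff]
    rintro ⟨D, hD⟩ -
    obtain ⟨D₀, h₀, D₁, h₁, rfl⟩ := Submodule.mem_sup.1 hD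
    exact Submodule.mem_sup.2 ⟨⟨D₀, 𝒪.superDer_le U 0 h₀⟩, h₀, ⟨D₁, 𝒪.superDer_le U 1 h₁⟩, h₁, rfl⟩

instance vectorFieldsModule (U : Opens M) : Module (𝒪.sec U) (𝒪.vectorFields U) where
  smul f D := ⟨𝒪.mulFamily f D.1, 𝒪.mulFamily_mem_vectorFields f D.2⟩
  one_smul D := by
    apply Subtype.ext; funext V; ext g; change 𝒪.res _ 1 * _ = _; simp
  mul_smul f g D := by
    apply Subtype.ext; funext V; ext k
    change 𝒪.res _ (f * g) * _ = 𝒪.res _ f * (𝒪.res _ g * _)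
    rw [map_mul, mul_assoc]
  smul_zero f := by
    apply Subtype.ext; funext V; ext g; change 𝒪.res _ f * 0 = 0; simp
  smul_add f D D' := by
    apply Subtype.ext; funext V; ext g
    change 𝒪.res _ f * (_ + _) = 𝒪.res _ f * _ + 𝒪.res _ f * _
    rw [mul_add]
  add_smul f f' D := by
    apply Subtype.ext; funext V; ext g
    change 𝒪.res _ (f + f') * _ = 𝒪.res _ f * _ + 𝒪.res _ f' * _
    rw [map_add, add_mul]
  zero_smul D := by
    apply Subtype.ext; funext V; ext g; change 𝒪.res _ 0 * _ = 0; simp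

theorem restrict_mem {U V : Opens M} (h : V ≤ U) {i : ZMod 2} {D : 𝒪.EndFamily U}
    (hD : D ∈ 𝒪.superDer U i) :
    (fun W => D ⟨W.1, le_trans W.2 h⟩ : 𝒪.EndFamily V) ∈ 𝒪.superDer V i :=
  ⟨fun V' W hW f => hD.1 ⟨V'.1, V'.2.trans h⟩ ⟨W.1, W.2.trans h⟩ hW f,
    fun V' j f hf => hD.2.1 ⟨V'.1, V'.2.trans h⟩ j f hf,
    fun V' j f hf g => hD.2.2 ⟨V'.1, V'.2.trans h⟩ j f hf g⟩

/-- The tangent sheaf: the sheaf of superderivations of the structure sheaf. -/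
def tangent : SupermodulePresheaf.{u, v, max u v} 𝒪 where
  sec U := 𝒪.vectorFields U
  isScalarTower U := ⟨fun c f D => by
    apply Subtype.ext; funext V; ext g
    change 𝒪.res _ (c • f) * _ = c • (𝒪.res _ f * _)
    rw [map_smul, smul_mul_assoc]⟩
  par U i := (𝒪.superDer U i).submoduleOf (𝒪.vectorFields U)
  par_isInternal U := (DirectSum.isInternal_submodule_iff_isCompl _ (i := 0) (j := 1)
    (by decide) (by ext i; revert i; decide)).2 (𝒪.superDer_isCompl U)
  smul_mem hf hD := 𝒪.mulFamily_mem hf hD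
  res {U V} h :=
    { toFun := fun D => ⟨fun W => D.1 ⟨W.1, le_trans W.2 h⟩, by
        obtain ⟨D₀, h₀, D₁, h₁, hD⟩ := Submodule.mem_sup.1 D.2
        rw [← hD]
        exact Submodule.add_mem_sup (𝒪.restrict_mem h h₀) (𝒪.restrict_mem h h₁)⟩
      map_add' := fun _ _ => rfl
      map_smul' := fun _ _ => rfl }
  res_smul {U V} h f D := by
    apply Subtype.ext; funext W; ext g
    change 𝒪.res _ f * _ = 𝒪.res W.2 (𝒪.res h f) * _
    rw [𝒪.res_res]
    rfl
  res_mem h _ hD := 𝒪.restrict_mem h hD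
  res_refl _ := rfl
  res_res _ _ _ := rfl

variable {𝒪}

/-- The action `Y f` of a vector field over `U` on a superfunction over `V ⊆ U`. -/
def applyField {U V : Opens M} (Y : 𝒪.tangent.sec U) (h : V ≤ U) : 𝒪.sec V →ₗ[ℝ] 𝒪.sec V :=
  (show 𝒪.vectorFields U from Y).1 ⟨V, h⟩

variable (𝒪) in
/-- A homogeneous vector field over `U`, with its parity. -/
structure HomField (U : Opens M) where
  deg : ZMod 2
  field : 𝒪.tangent.sec U
  mem : field ∈ 𝒪.tangent.par U deg

theorem superDer_bracket {U : Opens M} {i j : ZMod 2} {D D' : 𝒪.EndFamily U}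
    (hD : D ∈ 𝒪.superDer U i) (hD' : D' ∈ 𝒪.superDer U j) :
    (fun V => D V ∘ₗ D' V - koszul i j • (D' V ∘ₗ D V) : 𝒪.EndFamily U) ∈
      𝒪.superDer U (i + j) := by
  refine ⟨fun V W h f => ?_, fun V k f hf => ?_, fun V k f hf g => ?_⟩
  · simp [hD.1 V W h, hD'.1 V W h]
  · refine sub_mem ?_ (zsmul_mem ?_ _)
    · rw [add_assoc]
      exact hD.2.1 V _ _ (hD'.2.1 V _ _ hf)
    · rw [add_comm i j, add_assoc]
      exact hD'.2.1 V _ _ (hD.2.1 V _ _ hf)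
  · have a := hD.2.2 V
    have b := hD'.2.2 V
    simp only [LinearMap.sub_apply, LinearMap.smul_apply, LinearMap.comp_apply, b k f hf, a k f hf,
      map_add, map_zsmul, a _ _ (hD'.2.1 V _ _ hf), b _ _ (hD.2.1 V _ _ hf),
      koszul_add_left, koszul_add_right, smul_add, mul_sub, sub_mul, smul_sub, smul_smul,
      mul_smul_comm, smul_mul_assoc]
    have e : koszul i j * (koszul j i * koszul j k) = koszul j k := by
      rw [koszul_comm j i, ← mul_assoc, koszul_mul_self, one_mul]
    rw [e, mul_comm (koszul j k) (koszul i k), mul_comm (koszul i k * koszul j k) (koszul i j),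
      mul_comm (koszul i k) (koszul j k)]
    abel

/-- The superbracket `[Y, Z] = Y Z - (-1)^{|Y||Z|} Z Y` of homogeneous vector fields. -/
def HomField.bracket {U : Opens M} (Y Z : 𝒪.HomField U) : 𝒪.tangent.sec U :=
  show 𝒪.vectorFields U from
  ⟨fun V => applyField Y.field V.2 ∘ₗ applyField Z.field V.2 -
      koszul Y.deg Z.deg • (applyField Z.field V.2 ∘ₗ applyField Y.field V.2),
    𝒪.superDer_le _ _ (superDer_bracket Y.mem Z.mem)⟩

end SuperalgebraSheaf

/-! ### Connections, curvature and its covariant derivatives -/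

section Connections

variable {M : Type u} [TopologicalSpace M] {𝒪 : SuperalgebraSheaf.{u, v} M}

/-- A connection on the restriction `E|_W` of a (pre)sheaf of supermodules to an open set `W`. -/
structure SuperConnection (E : SupermodulePresheaf.{u, v, w} 𝒪) (W : Opens M) where
  nabla : ∀ V : Opens M, V ≤ W → (𝒪.tangent.sec V →ₗ[ℝ] E.sec V →ₗ[ℝ] E.sec V)
  nabla_res : ∀ (U V : Opens M) (hU : U ≤ W) (h : V ≤ U) (Y : 𝒪.tangent.sec U) (X : E.sec U),
    E.res h (nabla U hU Y X) = nabla V (h.trans hU) (𝒪.tangent.res h Y) (E.res h X)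
  nabla_mem : ∀ (V : Opens M) (hV : V ≤ W) (i j : ZMod 2),
    ∀ Y ∈ 𝒪.tangent.par V i, ∀ X ∈ E.par V j, nabla V hV Y X ∈ E.par V (i + j)
  nabla_smul_left : ∀ (V : Opens M) (hV : V ≤ W) (f : 𝒪.sec V) (Y : 𝒪.tangent.sec V)
    (X : E.sec V), nabla V hV (f • Y) X = f • nabla V hV Y X
  nabla_smul_right : ∀ (V : Opens M) (hV : V ≤ W) (i j : ZMod 2),
    ∀ Y ∈ 𝒪.tangent.par V i, ∀ f ∈ 𝒪.par V j, ∀ X : E.sec V,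
    nabla V hV Y (f • X) =
      SuperalgebraSheaf.applyField Y le_rfl f • X + koszul i j • (f • nabla V hV Y X)

namespace SuperConnection

variable {E : SupermodulePresheaf.{u, v, w} 𝒪} (D : SuperConnection E ⊤)

/-- A global section is parallel if all its covariant derivatives vanish. -/
def IsParallel (X : E.sec ⊤) : Prop :=
  ∀ (U : Opens M) (Y : 𝒪.tangent.sec U), D.nabla U le_top Y (E.res le_top X) = 0

variable {U : Opens M}

/-- The curvature `R(Y,Z)X = ∇_Y ∇_Z X - (-1)^{|Y||Z|} ∇_Z ∇_Y X - ∇_{[Y,Z]} X`. -/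
def curvature (Y Z : 𝒪.HomField U) (X : E.sec U) : E.sec U :=
  D.nabla U le_top Y.field (D.nabla U le_top Z.field X)
    - koszul Y.deg Z.deg • D.nabla U le_top Z.field (D.nabla U le_top Y.field X)
    - D.nabla U le_top (Y.bracket Z) X

/-- The covariant derivative `∇̄_Y Z` of homogeneous vector fields over `U`. -/
def homNabla (D' : SuperConnection 𝒪.tangent U) (Y Z : 𝒪.HomField U) : 𝒪.HomField U where
  deg := Y.deg + Z.deg
  field := D'.nabla U le_rfl Y.field Z.field
  mem := D'.nabla_mem U le_rfl _ _ _ Y.mem _ Z.mem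

/-- The covariant derivatives `∇̄^r_{Y_r,…,Y_1} R(Y,Z)X` of the curvature with respect to a
connection `∇̄` on the tangent sheaf over `U`; here `Ys 0 = Y_r`, …, `Ys (r-1) = Y_1`. -/
def curvatureDeriv (D' : SuperConnection 𝒪.tangent U) :
    (r : ℕ) → (Fin r → 𝒪.HomField U) → 𝒪.HomField U → 𝒪.HomField U → E.sec U → E.sec U
  | 0, _, Y, Z, X => D.curvature Y Z X
  | r + 1, Ys, Y, Z, X =>
    let Yr := Ys 0
    let T : Fin r → 𝒪.HomField U := Fin.tail Ys
    D.nabla U le_top Yr.field (curvatureDeriv D' r T Y Z X)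
      - ∑ l : Fin r, koszul Yr.deg (∑ k ∈ Finset.univ.filter (· < l), (T k).deg) •
          curvatureDeriv D' r (Function.update T l (homNabla D' Yr (T l))) Y Z X
      - koszul Yr.deg (∑ k, (T k).deg) • curvatureDeriv D' r T (homNabla D' Yr Y) Z X
      - koszul Yr.deg (∑ k, (T k).deg + Y.deg) • curvatureDeriv D' r T Y (homNabla D' Yr Z) X
      - koszul Yr.deg (∑ k, (T k).deg + Y.deg + Z.deg) •
          curvatureDeriv D' r T Y Z (D.nabla U le_top Yr.field X)

end SuperConnection

end Connections

/-! ### Fibres -/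

section Fibres

variable {n m : ℕ} {M : Type u} [TopologicalSpace M] [ChartedSpace (EuclideanSpace ℝ (Fin n)) M]
  {𝒮 : Supermanifold.{u, v} n m M}

namespace SupermodulePresheaf

variable (E : SupermodulePresheaf.{u, v, w} 𝒮.toSuperalgebraSheaf)

/-- The open neighbourhoods of a point, ordered by reverse inclusion. -/
abbrev OpenNhd (x : M) : Type u := {V : Opens M // x ∈ V}ᵒᵈ

open Classical in
/-- The stalk of `E` at `x`, as a real vector space. -/
abbrev Stalk (x : M) : Type (max u w) :=
  Module.DirectLimit (R := ℝ) (fun V : OpenNhd x => E.sec (OrderDual.ofDual V).1)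
    (fun _ _ h => E.res h)

open Classical in
/-- The germ at `x` of a section over an open neighbourhood of `x`. -/
def germ {V : Opens M} (x : M) (hx : x ∈ V) : E.sec V →ₗ[ℝ] E.Stalk x :=
  Module.DirectLimit.of ℝ (OpenNhd x) (fun V : OpenNhd x => E.sec (OrderDual.ofDual V).1)
    (fun _ _ h => E.res h) (OrderDual.toDual ⟨V, hx⟩)

/-- The germs at `x` of products `f s` with `f` a superfunction vanishing at `x`. -/
def vanishing (x : M) : Submodule ℝ (E.Stalk x) :=
  Submodule.span ℝ {g | ∃ (V : Opens M) (hx : x ∈ V) (f : 𝒮.sec V) (s : E.sec V),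
    𝒮.value x hx f = 0 ∧ g = E.germ x hx (f • s)}

/-- The fibre `E_x` at a point `x`. -/
abbrev Fibre (x : M) : Type (max u w) := E.Stalk x ⧸ E.vanishing x

/-- The value `X_x ∈ E_x` at `x` of a section `X` over an open neighbourhood of `x`. -/
def eval {V : Opens M} (x : M) (hx : x ∈ V) : E.sec V →ₗ[ℝ] E.Fibre x :=
  (E.vanishing x).mkQ.comp (E.germ x hx)

/-- The even and the odd part of the fibre. -/
def fibrePar (x : M) (i : ZMod 2) : Submodule ℝ (E.Fibre x) :=
  Submodule.span ℝ {a | ∃ (V : Opens M) (hx : x ∈ V), ∃ s ∈ E.par V i, a = E.eval x hx s}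

/-- The even and the odd part of the Lie superalgebra `gl(E_x)`. -/
def glPar (x : M) (i : ZMod 2) : Submodule ℝ (Module.End ℝ (E.Fibre x)) where
  carrier := {A | ∀ j, ∀ a ∈ E.fibrePar x j, A a ∈ E.fibrePar x (i + j)}
  zero_mem' := fun _ _ _ => zero_mem _
  add_mem' := fun hA hB j a ha => add_mem (hA j a ha) (hB j a ha)
  smul_mem' := fun c _ hA j a ha => Submodule.smul_mem _ c (hA j a ha)

/-- A Lie supersubalgebra of `gl(E_x)`: a graded subspace closed under the superbracket
`[A, B] = A B - (-1)^{|A||B|} B A` of homogeneous elements. -/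
structure IsLieSupersubalgebra (x : M) (L : Submodule ℝ (Module.End ℝ (E.Fibre x))) : Prop where
  graded : L ⊓ E.glPar x 0 ⊔ L ⊓ E.glPar x 1 = L
  bracket_mem : ∀ i j, ∀ A ∈ L ⊓ E.glPar x i, ∀ B ∈ L ⊓ E.glPar x j,
    A * B - koszul i j • (B * A) ∈ L

/-- The Lie supersubalgebra of `gl(E_x)` generated by a set of endomorphisms. -/
def lieSuperClosure (x : M) (S : Set (Module.End ℝ (E.Fibre x))) :
    Submodule ℝ (Module.End ℝ (E.Fibre x)) :=
  sInf {L | E.IsLieSupersubalgebra x L ∧ S ⊆ L}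

end SupermodulePresheaf

end Fibres

/-! ### Parallel displacement and holonomy -/

namespace SuperConnection

variable {n m : ℕ} {M : Type u} [TopologicalSpace M] [ChartedSpace (EuclideanSpace ℝ (Fin n)) M]
  {𝒮 : Supermanifold.{u, v} n m M} {E : SupermodulePresheaf.{u, v, w} 𝒮.toSuperalgebraSheaf}
  (D : SuperConnection E ⊤)

variable (𝒮) in
/-- The even vector field `Y` on `V` extends the velocity `γ'(t)` of the curve `γ : [a,b] → M`:
the tangent vector to `M` underlying `Y` at `γ(t)`, viewed as a derivation, is `γ'(t)`. -/
def ExtendsVelocity (γ : ℝ → M) (a b t : ℝ) (V : Opens M)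
    (Y : 𝒮.tangent.sec V) : Prop :=
  Y ∈ 𝒮.tangent.par V 0 ∧
  ∀ (W : Opens M) (hW : W ≤ V) (hx : γ t ∈ W) (f : 𝒮.sec W),
    HasDerivWithinAt (fun s => 𝒮.body f (γ s))
      (𝒮.value (γ t) hx (SuperalgebraSheaf.applyField Y hW f)) (Icc a b) t

/-- `c = ∇̃_{γ'(t)} s̃`, where `∇̃` is the connection induced by `∇` on the vector bundle
`⋃_x E_x` over `M`: it is `∇̃_{Ỹ} s̃ = (∇_Y s)~` for even vector fields `Y`. -/
def IsReducedDeriv (γ : ℝ → M) (a b t : ℝ) {W : Opens M} (s : E.sec W)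
    (c : E.Fibre (γ t)) : Prop :=
  ∃ (V : Opens M) (h : V ≤ W) (ht : γ t ∈ V) (Y : 𝒮.tangent.sec V),
    ExtendsVelocity 𝒮 γ a b t V Y ∧ c = E.eval (γ t) ht (D.nabla V le_top Y (E.res h s))

/-- `X` is a section of `⋃_x E_x` along the curve `γ : [a,b] → M` with `∇̃_{γ'(t)} X = 0`:
in local frames `e_A` one has `X(t) = ∑ c_A(t) e_A(γ(t))` with differentiable functions `c_A` and
`∑ c_A'(t) e_A(γ(t)) + c_A(t) ∇̃_{γ'(t)} e_A = 0`. -/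
def IsParallelAlong (p q : ℕ) (γ : ℝ → M) (a b : ℝ) (X : ∀ t, E.Fibre (γ t)) : Prop :=
  ∀ t₀ ∈ Icc a b, ∃ (W : Opens M) (e : Fin p ⊕ Fin q → E.sec W) (c c' : Fin p ⊕ Fin q → ℝ → ℝ),
    γ t₀ ∈ W ∧ E.IsFrame W e ∧ ∀ t ∈ Icc a b, ∀ ht : γ t ∈ W,
      X t = ∑ A, c A t • E.eval (γ t) ht (e A) ∧
      (∀ A, HasDerivWithinAt (c A) (c' A t) (Icc a b) t) ∧
      ∃ d : Fin p ⊕ Fin q → E.Fibre (γ t), (∀ A, D.IsReducedDeriv γ a b t (e A) (d A)) ∧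
        ∑ A, (c' A t • E.eval (γ t) ht (e A) + c A t • d A) = 0

/-- `τ : E_x → E_y` is the parallel displacement along some piecewise smooth curve in `M` from `x`
to `y`, that is, a composition of parallel displacements along finitely many smooth curves. -/
inductive IsParallelDisplacement (p q : ℕ) :
    ∀ x y : M, (E.Fibre x ≃ₗ[ℝ] E.Fibre y) → Prop
  | smooth (γ : ℝ → M) (a b : ℝ) (hab : a < b)
      (hγ : ContMDiffOn 𝓘(ℝ, ℝ) (𝓡 n) ∞ γ (Icc a b))
      (τ : E.Fibre (γ a) ≃ₗ[ℝ] E.Fibre (γ b))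
      (hτ : ∀ X₀ : E.Fibre (γ a), ∃ X : ∀ t, E.Fibre (γ t),
        D.IsParallelAlong p q γ a b X ∧ X a = X₀ ∧ X b = τ X₀) :
      IsParallelDisplacement p q (γ a) (γ b) τ
  | trans {x y z : M} (τ : E.Fibre x ≃ₗ[ℝ] E.Fibre y) (σ : E.Fibre y ≃ₗ[ℝ] E.Fibre z) :
      IsParallelDisplacement p q x y τ → IsParallelDisplacement p q y z σ →
      IsParallelDisplacement p q x z (τ.trans σ)

/-- The holonomy group at `x` of the induced connection on the vector bundle `⋃_x E_x`: the
parallel displacements along piecewise smooth loops at `x` (these are closed under composition, and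
under inverses by reversing the loops, so that the closure adds nothing). -/
def holonomyGroup (p q : ℕ) (x : M) : Subgroup (E.Fibre x ≃ₗ[ℝ] E.Fibre x) :=
  Subgroup.closure {g | D.IsParallelDisplacement p q x x g}

/-- `B` is the endomorphism `∇̄^r_{Y_r,…,Y_1} R_y(Y,Z)` of `E_y`, for some connection `∇̄` on the
tangent sheaf over a neighbourhood `U` of `y` and homogeneous vector fields over `U`. (The operators
for arbitrary tangent vectors at `y` are linear combinations of these, by multilinearity.) -/
def IsCurvatureOperator (y : M) (B : Module.End ℝ (E.Fibre y)) : Prop :=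
  ∃ (U : Opens M) (hy : y ∈ U) (D' : SuperConnection 𝒮.tangent U) (r : ℕ)
    (Ys : Fin r → 𝒮.HomField U) (Y Z : 𝒮.HomField U),
    ∀ X : E.sec U, B (E.eval y hy X) = E.eval y hy (D.curvatureDeriv D' r Ys Y Z X)

/-- The holonomy superalgebra at `x`: the Lie supersubalgebra of `gl(E_x)` generated by the
operators `τ⁻¹ ∘ ∇̄^r_{Y_r,…,Y_1} R_y(Y,Z) ∘ τ`, with `τ` the parallel displacement along a curve
from `x` to `y`. -/
def holonomyAlgebra (p q : ℕ) (x : M) : Submodule ℝ (Module.End ℝ (E.Fibre x)) :=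
  E.lieSuperClosure x {A | ∃ (y : M) (τ : E.Fibre x ≃ₗ[ℝ] E.Fibre y)
    (B : Module.End ℝ (E.Fibre y)), D.IsParallelDisplacement p q x y τ ∧
    D.IsCurvatureOperator y B ∧ A = τ.symm.toLinearMap ∘ₗ B ∘ₗ τ.toLinearMap}

/-- The vectors of `E_x` annihilated by the holonomy superalgebra and fixed by the holonomy group
of the induced connection. -/
def holonomyInvariants (p q : ℕ) (x : M) : Set (E.Fibre x) :=
  {a | (∀ A ∈ D.holonomyAlgebra p q x, A a = 0) ∧ ∀ g ∈ D.holonomyGroup p q x, g a = a}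

end SuperConnection

end

/-! ### Real analysis: Hadamard's lemma, linear differential equations and regularity of their
solutions. -/

noncomputable section

/-! ### Calculus -/

section Calculus

open MeasureTheory intervalIntegral Metric Filter
open scoped Topology NNReal

/-! A parallel section is determined by its value at one point, and holonomy invariance is exactly
what allows it to be rebuilt from that value.

From sections to invariants: if ∇X = 0, the frame coordinates of X along a curve solve the linear
equation of parallel transport, so parallel displacements carry values of X to values of X
(`IsParallelDisplacement.apply_eval`). Every covariant derivative of the curvature kills X, being
built from X and ∇X (`curvatureDeriv_of_parallel`). The homogeneous components of X are parallel
too, and the common annihilator of two homogeneous vectors is a Lie supersubalgebra, so the whole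
holonomy algebra kills X_x.

From invariants to sections: displacement spreads an invariant vector to a field s of vectors over
M, independent of the curves chosen and killed by all operators ∇̄^r R (`exists_invariant_field`).
In a convex chart the coordinates c of s satisfy a linear equation dc = -Γc, hence are smooth, and
lift to a section with values s. The remaining freedom lies in the odd directions. Let ξ^α be the
odd coordinates, J the ideal they generate and N = ∑ ξ^α ∇_{∂/∂ξ^α}. On J^k E / J^{k+1} E the
operator N is multiplication by k (`euler_sub_mem`), and J^{m+1} = 0. So the lift can be corrected,
without changing its values, to some X with N X = 0 (`exists_euler_eq_zero`).

This X is parallel (`nabla_eq_zero`). From N X = 0 one gets N(∇^r R X) = ∑ ξ^α (∇_α ∇^r R) X. All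
the sections ∇^r R X lie in J E, because s is killed by curvature operators, and this recursion
pushes them into every J^k E, so they vanish. Then R(∂_α, ∂_a) X = 0, and ∇_a X becomes an
eigenvector of N with eigenvalue -1 (a odd) or 0 (a even). The first is impossible for non-zero
sections; the second is impossible inside J E, where ∇_a X lies because s is parallel on M
(`IsConvex.exists_parallel`).

A parallel section with zero values lies in J E and is killed by N, so it is zero. Hence the local
solutions agree on overlaps and glue, and connectedness of M gives injectivity of evaluation at a
single point. -/

theorem contDiff_integral_comp_smul {E : Type} [NormedAddCommGroup E] [NormedSpace ℝ E]
    [ProperSpace E] (k : ℕ) : ∀ {G : Type} [NormedAddCommGroup G] [NormedSpace ℝ G]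
    [CompleteSpace G] {F : E → G} {ψ : ℝ → ℝ}, Continuous ψ → ContDiff ℝ k F →
    ContDiff ℝ k fun u => ∫ t in (0 : ℝ)..1, ψ t • F (t • u) := by
  induction k with
  | zero =>
    intro G _ _ _ F ψ hψ hF
    have hF := hF.continuous
    refine contDiff_zero.2 ?_
    apply continuous_parametric_intervalIntegral_of_continuous'
    fun_prop
  | succ k ih =>
    intro G _ _ _ F ψ hψ hF
    obtain ⟨F', hF', hd⟩ := contDiff_succ_iff_hasFDerivAt.1
      (by exact_mod_cast hF : ContDiff ℝ ((k : WithTop ℕ∞) + 1) F)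
    have hFc := hF.continuous
    have hFc' := hF'.continuous
    rw [Nat.cast_succ]
    -- Differentiating `F (t • u)` in `u` brings out a factor `t` and replaces `G` by `E →L[ℝ] G`;
    -- this is why `ψ` and `G` vary in the induction.
    refine contDiff_succ_iff_hasFDerivAt.2
      ⟨_, ih (ψ := fun t => ψ t * t) (by fun_prop) hF', fun u => ?_⟩
    have hcont : Continuous fun z : E × ℝ => (ψ z.2 * z.2) • F' (z.2 • z.1) := by fun_prop
    obtain ⟨C, hC⟩ := ((isCompact_closedBall u 1).prod (isCompact_Icc (a := (0 : ℝ)) (b := 1))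
      ).exists_bound_of_continuousOn hcont.continuousOn
    refine (hasFDerivAt_integral_of_dominated_of_fderiv_le (𝕜 := ℝ) (bound := fun _ => C)
      (F' := fun u t => (ψ t * t) • F' (t • u))
      (closedBall_mem_nhds u one_pos) ?_ ?_ ?_ ?_ ?_ ?_)
    · exact Eventually.of_forall fun x => Continuous.aestronglyMeasurable (by fun_prop)
    · exact Continuous.intervalIntegrable (by fun_prop) _ _
    · exact Continuous.aestronglyMeasurable (by fun_prop)
    · refine Eventually.of_forall fun t ht x hx => hC (x, t) ⟨hx, ?_⟩
      rw [uIoc_of_le zero_le_one] at ht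
      exact ⟨ht.1.le, ht.2⟩
    · exact intervalIntegrable_const
    · refine Eventually.of_forall fun t _ x _ => ?_
      have h1 : HasFDerivAt (fun x : E => t • x) (t • ContinuousLinearMap.id ℝ E) x :=
        (hasFDerivAt_id x).const_smul t
      have := ((hd (t • x)).comp x h1).const_smul (ψ t)
      have e : (ψ t * t) • F' (t • x) =
          ψ t • (F' (t • x)).comp (t • ContinuousLinearMap.id ℝ E) := by
        ext v
        simp [mul_smul]
      rw [e]
      exact this

/-- **Hadamard's lemma** for globally defined functions. -/
theorem hadamard_of_contDiff {n : ℕ} {h : EuclideanSpace ℝ (Fin n) → ℝ} (hh : ContDiff ℝ ∞ h)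
    (a : EuclideanSpace ℝ (Fin n)) :
    ∃ g : Fin n → EuclideanSpace ℝ (Fin n) → ℝ, (∀ i, ContDiff ℝ ∞ (g i)) ∧
      ∀ u, h u = h a + ∑ i, (u i - a i) * g i u := by
  have hd : ContDiff ℝ ∞ (fderiv ℝ h) := hh.fderiv_right (by simp)
  have hdc := hd.continuous
  refine ⟨fun i u => ∫ t in (0 : ℝ)..1,
    (1 : ℝ) • fderiv ℝ h (a + t • (u - a)) (EuclideanSpace.single i 1), fun i => ?_, fun u => ?_⟩
  · have key : ContDiff ℝ ∞ fun w => ∫ t in (0 : ℝ)..1,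
        (1 : ℝ) • (fun z => fderiv ℝ h (a + z) (EuclideanSpace.single i 1)) (t • w) := by
      refine contDiff_infty.2 fun k => contDiff_integral_comp_smul (ψ := fun _ => 1)
        (F := fun z => fderiv ℝ h (a + z) (EuclideanSpace.single i 1)) k continuous_const ?_
      have : ContDiff ℝ ∞ fun z => fderiv ℝ h (a + z) (EuclideanSpace.single i 1) :=
        (hd.comp (contDiff_const.add contDiff_id)).clm_apply contDiff_const
      exact this.of_le (by exact_mod_cast le_top)
    exact key.comp (contDiff_id.sub contDiff_const)
  · have hder : ∀ t ∈ uIcc (0 : ℝ) 1, HasDerivAt (fun t : ℝ => h (a + t • (u - a)))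
        (fderiv ℝ h (a + t • (u - a)) (u - a)) t := fun t _ => by
      have h1 : HasDerivAt (fun t : ℝ => a + t • (u - a)) (u - a) t := by
        simpa using ((hasDerivAt_id t).smul_const (u - a)).const_add a
      exact ((hh.differentiable (by simp)).differentiableAt.hasFDerivAt).comp_hasDerivAt t h1
    have := integral_eq_sub_of_hasDerivAt hder
      (Continuous.intervalIntegrable (by fun_prop) _ _)
    simp only [one_smul, add_sub_cancel, zero_smul, add_zero] at this
    have e : h u - h a = ∑ i, (u i - a i) * ∫ t in (0 : ℝ)..1,
        (1 : ℝ) • fderiv ℝ h (a + t • (u - a)) (EuclideanSpace.single i 1) := by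
      rw [← this]
      simp_rw [← intervalIntegral.integral_const_mul]
      rw [← integral_finsetSum fun i _ => Continuous.intervalIntegrable (by fun_prop) _ _]
      refine integral_congr fun t _ => ?_
      have hu : u - a = ∑ i, (u i - a i) • EuclideanSpace.single i (1 : ℝ) := by
        ext j
        simp [Finset.sum_apply, Pi.single_apply]
      simp only [one_smul]
      conv_lhs => rw [show fderiv ℝ h (a + t • (u - a)) (u - a) = fderiv ℝ h (a + t • (u - a))
        (∑ i, (u i - a i) • EuclideanSpace.single i (1 : ℝ)) by rw [← hu]]
      simp [map_sum]
    linarith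

/-- Multiplication by a bump function. It makes Hadamard's lemma, proved for functions on the whole
space, available for germs. -/
theorem exists_contDiff_eventuallyEq {n : ℕ} {h : EuclideanSpace ℝ (Fin n) → ℝ}
    {O : Set (EuclideanSpace ℝ (Fin n))} (hO : IsOpen O) (hh : ContDiffOn ℝ ∞ h O)
    {a : EuclideanSpace ℝ (Fin n)} (ha : a ∈ O) :
    ∃ h' : EuclideanSpace ℝ (Fin n) → ℝ, ContDiff ℝ ∞ h' ∧ h' =ᶠ[𝓝 a] h := by
  obtain ⟨r, hr, hrO⟩ := Metric.isOpen_iff.1 hO a ha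
  let χ : ContDiffBump a := ⟨r / 4, r / 2, by positivity, by linarith⟩
  refine ⟨fun u => χ u * h u, ?_, ?_⟩
  · refine contMDiff_iff_contDiff.1 (contMDiff_of_tsupport fun x hx => ?_)
    have hx' : x ∈ tsupport χ := closure_mono (Function.support_mul_subset_left _ _) hx
    rw [χ.tsupport_eq] at hx'
    have : x ∈ O := hrO (closedBall_subset_ball (by change r / 2 < r; linarith) hx')
    exact (χ.contDiff.contDiffAt.mul (hh.contDiffAt (hO.mem_nhds this))).contMDiffAt
  · filter_upwards [χ.eventuallyEq_one] with u hu
    simp [hu]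

/-- A solution of a linear differential inequality that vanishes somewhere vanishes. -/
theorem eq_zero_of_norm_deriv_le {F : Type*} [NormedAddCommGroup F] [NormedSpace ℝ F]
    {f f' : ℝ → F} {K a b t₀ : ℝ} (hf : ∀ t ∈ Icc a b, HasDerivWithinAt f (f' t) (Icc a b) t)
    (ht₀ : t₀ ∈ Icc a b) (h0 : f t₀ = 0) (bound : ∀ t ∈ Icc a b, ‖f' t‖ ≤ K * ‖f t‖) :
    ∀ t ∈ Icc a b, f t = 0 := by
  have hc : ContinuousOn f (Icc a b) := fun t ht => (hf t ht).continuousWithinAt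
  have right : ∀ t ∈ Icc t₀ b, f t = 0 := by
    refine eq_zero_of_abs_deriv_le_mul_abs_self_of_eq_zero_right (f' := f') (K := K)
      (hc.mono (Icc_subset_Icc_left ht₀.1)) (fun x hx => ?_) h0
      fun x hx => bound x ⟨ht₀.1.trans hx.1, hx.2.le⟩
    exact (hf x ⟨ht₀.1.trans hx.1, hx.2.le⟩).mono_of_mem_nhdsWithin
      (Filter.mem_of_superset (Icc_mem_nhdsGE hx.2) (Icc_subset_Icc_left (ht₀.1.trans hx.1)))
  -- The uniqueness theorem works forward in time; times before `t₀` are reached by the reflection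
  -- `t ↦ -t`.
  have left : ∀ t ∈ Icc (-t₀) (-a), f (-t) = 0 := by
    refine eq_zero_of_abs_deriv_le_mul_abs_self_of_eq_zero_right (f' := fun t => -f' (-t)) (K := K)
      ?_ (fun x hx => ?_) (by simpa using h0) fun x hx => ?_
    · exact hc.comp continuous_neg.continuousOn fun x hx =>
        ⟨by linarith [hx.2], by linarith [hx.1, ht₀.2]⟩
    · have hx' : -x ∈ Icc a b := ⟨by linarith [hx.2], by linarith [hx.1, ht₀.2]⟩
      have h1 : HasDerivWithinAt f (f' (-x)) (Iic (-x)) (-x) :=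
        (hf _ hx').mono_of_mem_nhdsWithin (Filter.mem_of_superset
          (Icc_mem_nhdsLE (by linarith [hx.2])) (Icc_subset_Icc_right hx'.2))
      have h2 : HasDerivWithinAt (fun x : ℝ => -x) (-1) (Ici x) x :=
        (hasDerivAt_neg x).hasDerivWithinAt
      have := h1.scomp x h2 fun y hy => by simpa using hy
      simpa [Function.comp_def] using this
    · rw [norm_neg]
      exact bound _ ⟨by linarith [hx.2], by linarith [hx.1, ht₀.2]⟩
  intro t ht
  rcases le_total t₀ t with h | h
  · exact right t ⟨h, ht.2⟩
  · simpa using left (-t) ⟨by linarith, by linarith [ht.1]⟩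

/-- Solutions of a linear differential equation exist over short intervals. -/
theorem exists_linear_ode_solution {F : Type*} [NormedAddCommGroup F] [NormedSpace ℝ F]
    [CompleteSpace F] {A : ℝ → F →L[ℝ] F} {a b C : ℝ} (hab : a ≤ b)
    (hA : ContinuousOn A (Icc a b)) (hC : ∀ t ∈ Icc a b, ‖A t‖ ≤ C) (hC' : 2 * C * (b - a) ≤ 1)
    (x₀ : F) :
    ∃ f : ℝ → F, f a = x₀ ∧ ∀ t ∈ Icc a b, HasDerivWithinAt f (A t (f t)) (Icc a b) t := by
  have hC0 : 0 ≤ C := (norm_nonneg _).trans (hC a ⟨le_rfl, hab⟩)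
  -- On the ball of radius `‖x₀‖` about `x₀` one has `‖x‖ ≤ 2‖x₀‖`, so the speed is at most
  -- `2C‖x₀‖`, and `2C(b - a) ≤ 1` prevents solutions from leaving the ball.
  have hP : IsPicardLindelof (fun t x => A t x) (⟨a, le_rfl, hab⟩ : Icc a b) x₀ ‖x₀‖₊ 0
      (⟨C, hC0⟩ * (2 * ‖x₀‖₊)) ⟨C, hC0⟩ := by
    refine ⟨fun t ht => ?_, fun x _ => ?_, fun t ht x hx => ?_, ?_⟩
    · refine ((A t).lipschitz.weaken ?_).lipschitzOnWith
      exact hC t ht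
    · exact hA.clm_apply continuousOn_const
    · refine ((A t).le_opNorm x).trans ?_
      have : ‖x‖ ≤ 2 * ‖x₀‖ := by
        have h1 : dist x x₀ ≤ ‖x₀‖ := hx
        have h2 := norm_sub_norm_le x x₀
        rw [dist_eq_norm] at h1
        linarith
      exact mul_le_mul (hC t ht) this (norm_nonneg _) hC0
    · change C * (2 * ‖x₀‖) * max (b - a) (a - a) ≤ ‖x₀‖ - 0
      rw [sub_self, sub_zero, max_eq_left (sub_nonneg.2 hab)]
      nlinarith [norm_nonneg x₀]
  exact hP.exists_eq_forall_mem_Icc_hasDerivWithinAt₀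

section Regularity

variable {V F : Type*} [NormedAddCommGroup V] [NormedSpace ℝ V] [NormedAddCommGroup F]
  [NormedSpace ℝ F] {B : Set V} {A : V → V →L[ℝ] F →L[ℝ] F} {c : V → F}

theorem hasDerivAt_segment {c' : V → V → F}
    (hc : ∀ w ∈ B, ∀ v, HasDerivAt (fun t : ℝ => c (w + t • v)) (c' w v) 0)
    {w v : V} {t : ℝ} (h : w + t • v ∈ B) :
    HasDerivAt (fun t : ℝ => c (w + t • v)) (c' (w + t • v) v) t := by
  have h1 := hc _ h v
  have h2 : HasDerivAt (fun s : ℝ => s - t) 1 t := by simpa using (hasDerivAt_id t).sub_const t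
  rw [← sub_self t] at h1
  have := HasDerivAt.scomp (h := fun s : ℝ => s - t) t h1 h2
  rw [one_smul] at this
  refine this.congr_of_eventuallyEq (Filter.Eventually.of_forall fun s => ?_)
  simp only [Function.comp_apply, add_assoc, ← add_smul]
  congr 3
  ring

/-- Grönwall's inequality on the segment from `u` to `w` bounds `c` there, and the mean value
inequality then bounds `c w - c u` by a quantity tending to 0 with `w - u`. -/
theorem continuousOn_of_linear_directional_deriv (hB : IsOpen B) (hconv : Convex ℝ B) {C : ℝ}
    (hA : ∀ w ∈ B, ‖A w‖ ≤ C)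
    (hc : ∀ w ∈ B, ∀ v, HasDerivAt (fun t : ℝ => c (w + t • v)) (-A w v (c w)) 0) :
    ContinuousOn c B := by
  intro u hu
  have hC0 : 0 ≤ C := (norm_nonneg (A u)).trans (hA u hu)
  refine ContinuousAt.continuousWithinAt ?_
  have key : ∀ w ∈ B, ‖c w - c u‖ ≤ C * ‖w - u‖ * (‖c u‖ * Real.exp (C * ‖w - u‖)) := by
    intro w hw
    have hmem : ∀ t ∈ Icc (0 : ℝ) 1, u + t • (w - u) ∈ B := fun t ht =>
      hconv.add_smul_sub_mem hu hw ht
    have hder : ∀ t ∈ Icc (0 : ℝ) 1, HasDerivAt (fun t : ℝ => c (u + t • (w - u)))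
        (-A (u + t • (w - u)) (w - u) (c (u + t • (w - u)))) t := fun t ht =>
      hasDerivAt_segment (c' := fun w v => -A w v (c w)) hc (hmem t ht)
    have hbound : ∀ t ∈ Icc (0 : ℝ) 1, ‖-A (u + t • (w - u)) (w - u) (c (u + t • (w - u)))‖ ≤
        C * ‖w - u‖ * ‖c (u + t • (w - u))‖ := fun t ht => by
      rw [norm_neg]
      exact (ContinuousLinearMap.le_opNorm₂ _ _ _).trans
        (by gcongr; exact hA _ (hmem t ht))
    have hg := norm_le_gronwallBound_of_norm_deriv_right_le (K := C * ‖w - u‖) (ε := 0)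
      (fun t ht => (hder t ht).continuousAt.continuousWithinAt)
      (fun t ht => (hder t ⟨ht.1, ht.2.le⟩).hasDerivWithinAt) le_rfl
      (fun t ht => by simpa using hbound t ⟨ht.1, ht.2.le⟩)
    have hn : ∀ t ∈ Icc (0 : ℝ) 1, ‖c (u + t • (w - u))‖ ≤ ‖c u‖ * Real.exp (C * ‖w - u‖) := by
      intro t ht
      have := hg t ht
      rw [gronwallBound_ε0] at this
      simp only [zero_smul, add_zero, sub_zero] at this
      refine this.trans ?_
      have : C * ‖w - u‖ * t ≤ C * ‖w - u‖ := mul_le_of_le_one_right (by positivity) ht.2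
      gcongr
    have := norm_image_sub_le_of_norm_deriv_le_segment_01'
      (fun t ht => (hder t ht).hasDerivWithinAt)
      (fun t ht => (hbound t ⟨ht.1, ht.2.le⟩).trans
        (mul_le_mul_of_nonneg_left (hn t ⟨ht.1, ht.2.le⟩) (by positivity)))
    simpa using this
  have hlim : Tendsto (fun w => C * ‖w - u‖ * (‖c u‖ * Real.exp (C * ‖w - u‖))) (𝓝 u) (𝓝 0) := by
    have : Continuous fun w => C * ‖w - u‖ * (‖c u‖ * Real.exp (C * ‖w - u‖)) := by fun_prop
    simpa using this.tendsto u
  refine tendsto_iff_norm_sub_tendsto_zero.2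
    (squeeze_zero' (Filter.Eventually.of_forall fun _ => norm_nonneg _) ?_ hlim)
  filter_upwards [hB.mem_nhds hu] with w hw using key w hw

/-- The candidate derivative is linear in the direction and, since `c` is continuous, continuous in
the point. The mean value inequality for `c (u + t • v) - t • L u v` then upgrades directional
derivatives to a Fréchet derivative. -/
theorem hasFDerivAt_of_linear_directional_deriv (hB : IsOpen B) (hconv : Convex ℝ B) {C : ℝ}
    (hA : ∀ w ∈ B, ‖A w‖ ≤ C) (hAc : ContinuousOn A B)
    (hc : ∀ w ∈ B, ∀ v, HasDerivAt (fun t : ℝ => c (w + t • v)) (-A w v (c w)) 0) :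
    ∀ w ∈ B, HasFDerivAt c (-(A w).flip (c w)) w := by
  have hcc := continuousOn_of_linear_directional_deriv hB hconv hA hc
  intro u hu
  set L : V → V →L[ℝ] F := fun w => -(A w).flip (c w) with hL
  have hLc : ContinuousOn L B := by
    have h1 : ContinuousOn (fun w => (A w).flip) B :=
      (ContinuousLinearMap.flipₗᵢ ℝ V F F).continuous.comp_continuousOn hAc
    exact (h1.clm_apply hcc).neg
  rw [hasFDerivAt_iff_isLittleO_nhds_zero, Asymptotics.isLittleO_iff]
  intro ε hε
  have hnear : ∀ᶠ w in 𝓝 u, w ∈ B ∧ ‖L w - L u‖ < ε := by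
    filter_upwards [hB.mem_nhds hu, (hLc.continuousAt (hB.mem_nhds hu)).eventually
      (Metric.ball_mem_nhds _ hε)] with w h1 h2
    exact ⟨h1, by simpa [dist_eq_norm] using h2⟩
  obtain ⟨δ, hδ, hball⟩ := Metric.eventually_nhds_iff_ball.1 hnear
  filter_upwards [Metric.ball_mem_nhds (0 : V) hδ] with v hv
  have hmem : ∀ t ∈ Icc (0 : ℝ) 1, u + t • v ∈ Metric.ball u δ := fun t ht => by
    rw [mem_ball_zero_iff] at hv
    rw [mem_ball, dist_eq_norm, add_sub_cancel_left, norm_smul, Real.norm_of_nonneg ht.1]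
    nlinarith [ht.2, norm_nonneg v, ht.1]
  have hder : ∀ t ∈ Icc (0 : ℝ) 1, HasDerivWithinAt (fun t : ℝ => c (u + t • v) - t • L u v)
      (L (u + t • v) v - L u v) (Icc 0 1) t := fun t ht => by
    have h1 := hasDerivAt_segment (c' := fun w v => L w v) (v := v)
      (fun w hw v => by simpa [hL] using hc w hw v) (hball _ (hmem t ht)).1
    have h2 : HasDerivAt (fun t : ℝ => t • L u v) (L u v) t := by
      simpa using (hasDerivAt_id t).smul_const (L u v)
    exact (h1.sub h2).hasDerivWithinAt
  have := norm_image_sub_le_of_norm_deriv_le_segment_01' hder (C := ε * ‖v‖) fun t ht => by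
    rw [← sub_apply]
    exact (ContinuousLinearMap.le_opNorm _ _).trans
      (by gcongr; exact (hball _ (hmem t ⟨ht.1, ht.2.le⟩)).2.le)
  refine le_trans (le_of_eq ?_) this
  simp only [one_smul, zero_smul, add_zero, sub_zero]
  congr 1
  abel

/-- A vector valued function whose directional derivatives solve a linear equation with smooth
coefficients is smooth. -/
theorem contDiffOn_of_linear_directional_deriv (hB : IsOpen B) (hconv : Convex ℝ B) {C : ℝ}
    (hA : ∀ w ∈ B, ‖A w‖ ≤ C) (hAs : ContDiffOn ℝ ∞ A B)
    (hc : ∀ w ∈ B, ∀ v, HasDerivAt (fun t : ℝ => c (w + t • v)) (-A w v (c w)) 0) :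
    ContDiffOn ℝ ∞ c B := by
  have hd := hasFDerivAt_of_linear_directional_deriv hB hconv hA hAs.continuousOn hc
  refine contDiffOn_infty.2 fun k => ?_
  -- Bootstrapping: the derivative `-(A w).flip (c w)` is bilinear in `A` and `c`, so it is as
  -- regular as `c` itself.
  induction k with
  | zero => exact contDiffOn_zero.2 (continuousOn_of_linear_directional_deriv hB hconv hA hc)
  | succ k ih =>
    rw [Nat.cast_succ, contDiffOn_succ_iff_fderiv_of_isOpen hB]
    refine ⟨fun w hw => (hd w hw).differentiableAt.differentiableWithinAt, by simp, ?_⟩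
    have h0 : ContDiff ℝ k fun T : V →L[ℝ] F →L[ℝ] F => T.flip :=
      IsBoundedLinearMap.contDiff ⟨(ContinuousLinearMap.flipₗᵢ ℝ V F F).toLinearEquiv.isLinear, 1,
        one_pos, fun T => by rw [one_mul, ContinuousLinearMap.opNorm_flip]⟩
    have h1 : ContDiffOn ℝ k (fun w => (A w).flip) B :=
      h0.comp_contDiffOn (contDiffOn_infty.1 hAs k)
    exact (h1.clm_apply ih).neg.congr fun w hw => (hd w hw).fderiv

end Regularity

end Calculus

end

/-! ### The Grassmann algebra and the local model C^∞ ⊗ Λ_m, with their partial derivatives. -/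

noncomputable section

theorem ZMod.two_cases : ∀ k : ZMod 2, k = 0 ∨ k = 1 := by decide

/-! ### Derivations of the Grassmann algebra -/

namespace Grassmann

variable {m : ℕ}

/-- The `α`-th generator of the Grassmann algebra. -/
def gen (α : Fin m) : Grassmann m := ExteriorAlgebra.ι ℝ (Pi.single α 1)

theorem ι_mem_par (v : Fin m → ℝ) : ExteriorAlgebra.ι ℝ v ∈ par m 1 :=
  CliffordAlgebra.ι_mem_evenOdd_one _ v

theorem gen_mem (α : Fin m) : gen α ∈ par m 1 := ι_mem_par _

theorem ι_eq_sum (v : Fin m → ℝ) : ExteriorAlgebra.ι ℝ v = ∑ α, v α • gen α := by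
  conv_lhs => rw [← Finset.univ_sum_single v]
  rw [map_sum]
  refine Finset.sum_congr rfl fun α _ => ?_
  rw [gen, ← map_smul, ← Pi.single_smul, smul_eq_mul, mul_one]

theorem one_mem_par : (1 : Grassmann m) ∈ par m 0 :=
  SetLike.GradedOne.one_mem (A := CliffordAlgebra.evenOdd (0 : QuadraticForm ℝ (Fin m → ℝ)))

theorem mul_mem_par {i j : ZMod 2} {a b : Grassmann m} (ha : a ∈ par m i) (hb : b ∈ par m j) :
    a * b ∈ par m (i + j) :=
  SetLike.GradedMul.mul_mem (A := CliffordAlgebra.evenOdd (0 : QuadraticForm ℝ (Fin m → ℝ))) ha hb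

/-- Multiplication by two vectors preserves parity, so each parity has its own induction, with all
signs fixed. -/
theorem par_induction (j : ZMod 2) {P : Grassmann m → Prop}
    (scalar : j = 0 → ∀ r : ℝ, P (algebraMap ℝ _ r))
    (vector : j = 1 → ∀ v, P (ExteriorAlgebra.ι ℝ v))
    (hadd : ∀ a ∈ par m j, ∀ b ∈ par m j, P a → P b → P (a + b))
    (mul : ∀ v w, ∀ a ∈ par m j, P a →
      P (ExteriorAlgebra.ι ℝ v * (ExteriorAlgebra.ι ℝ w * a)))
    {a : Grassmann m} (ha : a ∈ par m j) : P a := by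
  refine CliffordAlgebra.evenOdd_induction (0 : QuadraticForm ℝ (Fin m → ℝ)) j
    (motive := fun a _ => P a) ?_ (fun a b ha hb => hadd a ha b hb) ?_ a ha
  · intro a h
    obtain rfl | rfl := ZMod.two_cases j
    · obtain ⟨r, rfl⟩ := Submodule.mem_one.1 (by simpa using h)
      exact scalar rfl r
    · rw [show (1 : ZMod 2).val = 1 from rfl, pow_one] at h
      obtain ⟨v, rfl⟩ := h
      exact vector rfl v
  · intro v w a ha h
    rw [mul_assoc]
    exact mul v w a ha h

/-- The partial derivative along the `α`-th generator. -/
def deriv (α : Fin m) : Grassmann m →ₗ[ℝ] Grassmann m :=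
  CliffordAlgebra.contractLeft (Q := (0 : QuadraticForm ℝ (Fin m → ℝ))) (LinearMap.proj α)

theorem deriv_ι_mul (α : Fin m) (v : Fin m → ℝ) (a : Grassmann m) :
    deriv α (ExteriorAlgebra.ι ℝ v * a) = v α • a - ExteriorAlgebra.ι ℝ v * deriv α a :=
  CliffordAlgebra.contractLeft_ι_mul (Q := (0 : QuadraticForm ℝ (Fin m → ℝ))) _ _ _

theorem deriv_algebraMap (α : Fin m) (r : ℝ) : deriv α (algebraMap ℝ _ r) = 0 :=
  CliffordAlgebra.contractLeft_algebraMap (Q := (0 : QuadraticForm ℝ (Fin m → ℝ))) _ _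

theorem deriv_ι (α : Fin m) (v : Fin m → ℝ) :
    deriv α (ExteriorAlgebra.ι ℝ v) = algebraMap ℝ _ (v α) :=
  CliffordAlgebra.contractLeft_ι (Q := (0 : QuadraticForm ℝ (Fin m → ℝ))) _ _

theorem deriv_one (α : Fin m) : deriv α 1 = 0 := by
  rw [← map_one (algebraMap ℝ (Grassmann m)), deriv_algebraMap]

theorem deriv_gen (α β : Fin m) : deriv α (gen β) = if α = β then 1 else 0 := by
  rw [gen, deriv_ι, Pi.single_apply]
  split_ifs <;> simp

theorem deriv_mem (α : Fin m) {j : ZMod 2} {a : Grassmann m} (ha : a ∈ par m j) :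
    deriv α a ∈ par m (1 + j) := by
  refine par_induction j (P := fun a => deriv α a ∈ par m (1 + j)) (fun _ r => ?_) (fun hj v => ?_)
    (fun a _ b _ ha hb => ?_) (fun v w a ha h => ?_) ha
  · rw [deriv_algebraMap]; exact zero_mem _
  · subst hj
    rw [deriv_ι, Algebra.algebraMap_eq_smul_one]
    exact Submodule.smul_mem _ _ one_mem_par
  · rw [map_add]; exact add_mem ha hb
  · have h1 : ∀ k : ZMod 2, 1 + (1 + k) = k := by decide
    rw [deriv_ι_mul, deriv_ι_mul]
    refine sub_mem (Submodule.smul_mem _ _ (mul_mem_par (ι_mem_par w) ha))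
      (mul_mem_par (ι_mem_par v) ?_)
    have := mul_mem_par (ι_mem_par w) h
    rw [h1] at this
    exact sub_mem (Submodule.smul_mem _ _ ha) this

theorem deriv_mul (α : Fin m) {j : ZMod 2} {a : Grassmann m} (ha : a ∈ par m j)
    (b : Grassmann m) : deriv α (a * b) = deriv α a * b + koszul 1 j • (a * deriv α b) := by
  refine par_induction j
    (P := fun a => deriv α (a * b) = deriv α a * b + koszul 1 j • (a * deriv α b))
    (fun hj r => ?_) (fun hj v => ?_) (fun a _ a' _ ha ha' => ?_) (fun v w a ha h => ?_) ha
  · subst hj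
    rw [deriv_algebraMap, Algebra.algebraMap_eq_smul_one]
    simp [koszul]
  · subst hj
    rw [deriv_ι_mul, deriv_ι, Algebra.algebraMap_eq_smul_one]
    simp [koszul, sub_eq_add_neg]
  · rw [add_mul, map_add, ha, ha', map_add, add_mul, add_mul, smul_add]; abel
  · rw [mul_assoc, mul_assoc, deriv_ι_mul, deriv_ι_mul, h, deriv_ι_mul, deriv_ι_mul]
    simp only [mul_add, mul_sub, sub_mul, smul_mul_assoc, mul_smul_comm, mul_assoc]
    abel

/-- The augmentation of the Grassmann algebra. -/
def aug (m : ℕ) : Grassmann m →ₐ[ℝ] ℝ := ExteriorAlgebra.algebraMapInv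

/-- For products: ab - ε(a)ε(b) = (a - ε(a)) b + ε(a)(b - ε(b)), where ε is the augmentation. -/
theorem sub_aug_eq_sum (a : Grassmann m) :
    ∃ b : Fin m → Grassmann m, a - algebraMap ℝ _ (aug m a) = ∑ α, gen α * b α := by
  induction a using ExteriorAlgebra.induction with
  | algebraMap r => exact ⟨0, by simp [aug]⟩
  | ι v =>
    refine ⟨fun α => algebraMap ℝ _ (v α), ?_⟩
    have : aug m (ExteriorAlgebra.ι ℝ v) = 0 := by simp [aug, ExteriorAlgebra.algebraMapInv]
    rw [this, map_zero, sub_zero, ι_eq_sum]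
    refine Finset.sum_congr rfl fun α _ => ?_
    simp only [Algebra.algebraMap_eq_smul_one, mul_smul_comm, mul_one]
  | mul a b ha hb =>
    obtain ⟨a', ha⟩ := ha
    obtain ⟨b', hb⟩ := hb
    refine ⟨fun α => a' α * b + aug m a • b' α, ?_⟩
    have : a * b - algebraMap ℝ _ (aug m (a * b)) = (a - algebraMap ℝ _ (aug m a)) * b +
        aug m a • (b - algebraMap ℝ _ (aug m b)) := by
      rw [map_mul, map_mul, Algebra.smul_def, mul_sub, sub_mul]
      abel
    rw [this, ha, hb, Finset.sum_mul, Finset.smul_sum, ← Finset.sum_add_distrib]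
    refine Finset.sum_congr rfl fun α _ => ?_
    rw [mul_add, mul_assoc, mul_smul_comm]
  | add a b ha hb =>
    obtain ⟨a', ha⟩ := ha
    obtain ⟨b', hb⟩ := hb
    refine ⟨fun α => a' α + b' α, ?_⟩
    rw [map_add, map_add, add_sub_add_comm, ha, hb, ← Finset.sum_add_distrib]
    simp [mul_add]

/-- A character kills every vector v, because v² = 0 and ℝ has no nilpotents. -/
theorem algHom_eq_aug (ψ : Grassmann m →ₐ[ℝ] ℝ) : ψ = aug m := by
  refine ExteriorAlgebra.hom_ext (LinearMap.ext fun v => ?_)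
  have h : ∀ χ : Grassmann m →ₐ[ℝ] ℝ, χ (ExteriorAlgebra.ι ℝ v) = 0 := fun χ =>
    mul_self_eq_zero.1 (by rw [← map_mul, ExteriorAlgebra.ι_sq_zero, map_zero])
  exact (h ψ).trans (h (aug m)).symm

end Grassmann

/-! ### The local model -/

namespace LocalModel

variable {n m : ℕ} {M : Type u} [TopologicalSpace M] [ChartedSpace (EuclideanSpace ℝ (Fin n)) M]

@[simp]
theorem smoothRestrict_apply {U V : Opens M} (h : V ≤ U) (f : C^∞⟮𝓡 n, U; 𝓘(ℝ, ℝ), ℝ⟯) (x : V) :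
    smoothRestrict n h f x = f ⟨x, h x.2⟩ := rfl

@[simp]
theorem res_tmul {U V : Opens M} (h : V ≤ U) (f : C^∞⟮𝓡 n, U; 𝓘(ℝ, ℝ), ℝ⟯) (a : Grassmann m) :
    res n m h (f ⊗ₜ a) = smoothRestrict n h f ⊗ₜ a := rfl

theorem value_tmul {U : Opens M} (x : U) (f : C^∞⟮𝓡 n, U; 𝓘(ℝ, ℝ), ℝ⟯) (a : Grassmann m) :
    value n m x (f ⊗ₜ a) = f x * Grassmann.aug m a :=
  Algebra.TensorProduct.lift_tmul _ _ _ _ _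

theorem tmul_mem_par {U : Opens M} (f : C^∞⟮𝓡 n, U; 𝓘(ℝ, ℝ), ℝ⟯) {i : ZMod 2} {a : Grassmann m}
    (ha : a ∈ Grassmann.par m i) : (f ⊗ₜ a : LocalModel n m U) ∈ par n m U i :=
  ⟨f ⊗ₜ ⟨a, ha⟩, rfl⟩

theorem par_induction {U : Opens M} {i : ZMod 2} {P : LocalModel n m U → Prop} (h0 : P 0)
    (tmul : ∀ f, ∀ a ∈ Grassmann.par m i, P (f ⊗ₜ a))
    (hadd : ∀ x y, P x → P y → P (x + y)) {x : LocalModel n m U} (hx : x ∈ par n m U i) : P x := by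
  obtain ⟨y, rfl⟩ := hx
  induction y with
  | zero => simpa using h0
  | tmul f a => exact tmul f a a.2
  | add y z hy hz => rw [map_add]; exact hadd _ _ hy hz

/-- All coefficients of `∑ f_α ξ^α` at a point. -/
def coeffAt {U : Opens M} (x : U) : LocalModel n m U →ₐ[ℝ] Grassmann m :=
  Algebra.TensorProduct.lift ((Algebra.ofId ℝ (Grassmann m)).comp (smoothEval n x))
    (AlgHom.id ℝ _) fun r a => Algebra.commutes (A := Grassmann m) (r x) a

theorem coeffAt_tmul {U : Opens M} (x : U) (f : C^∞⟮𝓡 n, U; 𝓘(ℝ, ℝ), ℝ⟯) (a : Grassmann m) :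
    coeffAt x (f ⊗ₜ a : LocalModel n m U) = f x • a := by
  refine (Algebra.TensorProduct.lift_tmul _ _ _ _ _).trans ?_
  rw [Algebra.smul_def]
  rfl

theorem coeffAt_res {U V : Opens M} (h : V ≤ U) (x : V) (f : LocalModel n m U) :
    coeffAt x (res n m h f) = coeffAt (⟨x, h x.2⟩ : U) f := by
  induction f using TensorProduct.induction_on with
  | zero => simp
  | tmul f a => rw [res_tmul, coeffAt_tmul, coeffAt_tmul]; rfl
  | add f g hf hg => rw [map_add, map_add, hf, hg, map_add]

/-- In a basis of the Grassmann algebra an element is a finite family of smooth functions, whose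
values at x are the coordinates of `coeffAt x`. -/
theorem eq_zero_of_coeffAt {U : Opens M} {f : LocalModel n m U} (h : ∀ x : U, coeffAt x f = 0) :
    f = 0 := by
  let b := Module.Free.chooseBasis ℝ (Grassmann m)
  apply (TensorProduct.equivFinsuppOfBasisRight b).injective
  rw [map_zero]
  ext k x
  have key : ∀ g : LocalModel n m U,
      (TensorProduct.equivFinsuppOfBasisRight b g) k x = b.repr (coeffAt x g) k := fun g => by
    induction g using TensorProduct.induction_on with
    | zero => simp
    | tmul g a =>
      rw [coeffAt_tmul, TensorProduct.equivFinsuppOfBasisRight_apply_tmul_apply, map_smul,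
        Finsupp.smul_apply, smul_eq_mul, mul_comm]
      rfl
    | add g g' hg hg' =>
      rw [map_add, Finsupp.add_apply, map_add, map_add, Finsupp.add_apply, ← hg, ← hg']
      rfl
  rw [key, h, map_zero]
  rfl

/-- The odd coordinates of the local model. -/
def gen (U : Opens M) (α : Fin m) : LocalModel n m U := 1 ⊗ₜ Grassmann.gen α

/-- Up to its underlying function, every element lies in the ideal of the odd coordinates, by
`Grassmann.sub_aug_eq_sum` applied to the Grassmann factor; here the underlying function is zero. -/
theorem exists_eq_sum_gen_mul {U : Opens M} {f : LocalModel n m U}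
    (h : ∀ x : U, value n m x f = 0) :
    ∃ g : Fin m → LocalModel n m U, f = ∑ α, gen U α * g α := by
  let body : LocalModel n m U →ₗ[ℝ] C^∞⟮𝓡 n, U; 𝓘(ℝ, ℝ), ℝ⟯ :=
    (TensorProduct.rid ℝ _).toLinearMap ∘ₗ LinearMap.lTensor _ (Grassmann.aug m).toLinearMap
  have hbody : ∀ (x : U) (g : LocalModel n m U), body g x = value n m x g := fun x g => by
    induction g using TensorProduct.induction_on with
    | zero => simp [body]
    | tmul g a =>
      rw [value_tmul, mul_comm]
      simp [body]
    | add g g' hg hg' => rw [map_add, map_add, ← hg, ← hg']; rfl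
  have key : ∀ f : LocalModel n m U, ∃ g : Fin m → LocalModel n m U,
      f - body f ⊗ₜ 1 = ∑ α, gen U α * g α := fun f => by
    induction f using TensorProduct.induction_on with
    | zero => exact ⟨0, by simp⟩
    | tmul f a =>
      obtain ⟨b, hb⟩ := Grassmann.sub_aug_eq_sum a
      refine ⟨fun α => f ⊗ₜ b α, ?_⟩
      have : body (f ⊗ₜ a) = Grassmann.aug m a • f := by simp [body]
      rw [this, TensorProduct.smul_tmul, ← Algebra.algebraMap_eq_smul_one, ← TensorProduct.tmul_sub,
        hb, TensorProduct.tmul_sum]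
      refine Finset.sum_congr rfl fun α _ => ?_
      rw [gen, Algebra.TensorProduct.tmul_mul_tmul, one_mul]
    | add f f' hf hf' =>
      obtain ⟨g, hg⟩ := hf
      obtain ⟨g', hg'⟩ := hf'
      refine ⟨g + g', ?_⟩
      rw [map_add, TensorProduct.add_tmul, add_sub_add_comm, hg, hg', ← Finset.sum_add_distrib]
      simp [mul_add]
  obtain ⟨g, hg⟩ := key f
  refine ⟨g, ?_⟩
  have : body f = 0 := by
    ext x
    rw [hbody, h]
    rfl
  rw [← hg, this, TensorProduct.zero_tmul, sub_zero]

/-- A smooth function that does not vanish at a point is invertible near it. -/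
theorem exists_isUnit_smoothRestrict {U : Opens M} {x : M} (hx : x ∈ U)
    (f : C^∞⟮𝓡 n, U; 𝓘(ℝ, ℝ), ℝ⟯) (hf : f ⟨x, hx⟩ ≠ 0) :
    ∃ (V : Opens M) (h : V ≤ U), x ∈ V ∧ IsUnit (smoothRestrict n h f) := by
  have hopen : IsOpen {y : U | f y ≠ 0} := f.contMDiff.continuous.isOpen_preimage _ isOpen_ne
  let V : Opens M := ⟨(↑) '' {y : U | f y ≠ 0}, U.2.isOpenMap_subtype_val _ hopen⟩
  have hV : V ≤ U := by
    rintro _ ⟨y, -, rfl⟩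
    exact y.2
  have hne : ∀ y : V, f ⟨y, hV y.2⟩ ≠ 0 := by
    rintro ⟨_, y, hy, rfl⟩
    exact hy
  refine ⟨V, hV, ⟨⟨x, hx⟩, hf, rfl⟩, ?_⟩
  refine IsUnit.of_mul_eq_one ⟨fun y => (f ⟨y, hV y.2⟩)⁻¹, ?_⟩ ?_
  · exact (smoothRestrict n hV f).contMDiff.inv₀ hne
  · ext y
    exact mul_inv_cancel₀ (hne y)

/-- The value at a point is the only family of characters compatible with restrictions. -/
theorem eq_value {W : Opens M} {x : M}
    (ψ : ∀ V : Opens M, V ≤ W → x ∈ V → (LocalModel n m V →ₐ[ℝ] ℝ))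
    (hψ : ∀ (U V : Opens M) (hU : U ≤ W) (h : V ≤ U) (hx : x ∈ V) (f : LocalModel n m U),
      ψ V (h.trans hU) hx (res n m h f) = ψ U hU (h hx) f)
    {V : Opens M} (hV : V ≤ W) (hx : x ∈ V) : ψ V hV hx = value n m ⟨x, hx⟩ := by
  have hsm : ∀ f : C^∞⟮𝓡 n, V; 𝓘(ℝ, ℝ), ℝ⟯, ψ V hV hx (f ⊗ₜ 1) = f ⟨x, hx⟩ := by
    intro f
    -- Otherwise `f` minus the constant `ψ (f ⊗ 1)` does not vanish at `x` and becomes invertible on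
    -- a smaller neighbourhood, although the character there sends it to 0.
    by_contra hne
    have hne' : (f - algebraMap ℝ _ (ψ V hV hx (f ⊗ₜ 1)) : C^∞⟮𝓡 n, V; 𝓘(ℝ, ℝ), ℝ⟯) ⟨x, hx⟩ ≠ 0 :=
      sub_ne_zero.2 (Ne.symm hne)
    obtain ⟨V', h, hx', hu⟩ := exists_isUnit_smoothRestrict hx _ hne'
    have hu' := (hu.map (Algebra.TensorProduct.includeLeft :
      _ →ₐ[ℝ] LocalModel n m V')).map (ψ V' (h.trans hV) hx')
    rw [Algebra.TensorProduct.includeLeft_apply, ← res_tmul, hψ V V' hV h hx',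
      TensorProduct.sub_tmul, map_sub,
      Algebra.algebraMap_eq_smul_one, ← TensorProduct.smul_tmul', map_smul,
      ← Algebra.TensorProduct.one_def, map_one] at hu'
    simp at hu'
  refine Algebra.TensorProduct.ext ?_ ?_
  · ext f
    have := value_tmul (m := m) ⟨x, hx⟩ f 1
    rw [map_one, mul_one] at this
    exact (hsm f).trans this.symm
  · refine (Grassmann.algHom_eq_aug _).trans (Grassmann.algHom_eq_aug _).symm

end LocalModel

end

noncomputable section

/-! ### Partial derivatives in a chart -/

theorem subset_of_le {M : Type u} [TopologicalSpace M] {U V : Opens M} {s : Set M} (h : V ≤ U)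
    (hU : (U : Set M) ⊆ s) : (V : Set M) ⊆ s :=
  Set.Subset.trans (SetLike.coe_subset_coe.2 h) hU

section ChartDeriv

open scoped Topology

variable {n : ℕ} {M : Type u} [TopologicalSpace M]

open Classical in
/-- Extension by zero of a function on an open set. -/
def zeroExt {V : Opens M} (h : V → ℝ) (x : M) : ℝ := if hx : x ∈ V then h ⟨x, hx⟩ else 0

theorem zeroExt_apply {V : Opens M} (h : V → ℝ) (x : V) : zeroExt h x = h x := by
  simp [zeroExt]

theorem zeroExt_of_mem {V : Opens M} (h : V → ℝ) {x : M} (hx : x ∈ V) :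
    zeroExt h x = h ⟨x, hx⟩ := by
  simp [zeroExt, hx]

theorem zeroExt_eventuallyEq {φ : OpenPartialHomeomorph M (EuclideanSpace ℝ (Fin n))} {V : Opens M}
    (h : V → ℝ) {g : M → ℝ} (hg : ∀ x : V, h x = g x) {x : M}
    (hx : x ∈ V) (hxφ : x ∈ φ.source) :
    (fun u => zeroExt h (φ.symm u)) =ᶠ[𝓝 (φ x)] fun u => g (φ.symm u) := by
  have h1 : φ.symm ⁻¹' V ∈ 𝓝 (φ x) :=
    (φ.continuousAt_symm (φ.map_source hxφ)).preimage_mem_nhds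
      (by rw [φ.left_inv hxφ]; exact V.2.mem_nhds hx)
  filter_upwards [h1] with u hu
  rw [zeroExt_of_mem h hu, hg]

variable [ChartedSpace (EuclideanSpace ℝ (Fin n)) M]

theorem contMDiffAt_zeroExt {V : Opens M} (h : C^∞⟮𝓡 n, V; 𝓘(ℝ, ℝ), ℝ⟯) {x : M} (hx : x ∈ V) :
    ContMDiffAt (𝓡 n) 𝓘(ℝ, ℝ) ∞ (zeroExt h) x := by
  rw [← contMDiffAt_subtype_iff (U := V) (x := ⟨x, hx⟩)]
  simp_rw [zeroExt_apply]
  exact h.contMDiff _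

variable {φ : OpenPartialHomeomorph M (EuclideanSpace ℝ (Fin n))}

theorem contDiffAt_zeroExt (hφ : φ ∈ IsManifold.maximalAtlas (𝓡 n) ∞ M) {V : Opens M}
    (h : C^∞⟮𝓡 n, V; 𝓘(ℝ, ℝ), ℝ⟯) {x : M} (hx : x ∈ V)
    (hxφ : x ∈ φ.source) : ContDiffAt ℝ ∞ (fun u => zeroExt h (φ.symm u)) (φ x) := by
  rw [← contMDiffAt_iff_contDiffAt]
  refine ContMDiffAt.comp (I' := 𝓡 n) (g := zeroExt h) (f := φ.symm) (φ x) ?_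
    (contMDiffAt_symm_of_mem_maximalAtlas hφ (φ.map_source hxφ))
  rw [φ.left_inv hxφ]
  exact contMDiffAt_zeroExt h hx

theorem contMDiff_comp_chart (hφ : φ ∈ IsManifold.maximalAtlas (𝓡 n) ∞ M) {V : Opens M}
    (hV : (V : Set M) ⊆ φ.source)
    {h : EuclideanSpace ℝ (Fin n) → ℝ} (hh : ∀ x ∈ V, ContDiffAt ℝ ∞ h (φ x)) :
    ContMDiff (𝓡 n) 𝓘(ℝ, ℝ) ∞ fun x : V => h (φ x) := by
  intro x
  refine (contMDiffAt_subtype_iff (U := V) (x := x) (f := fun x => h (φ x))).2 ?_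
  exact ContMDiffAt.comp (I' := 𝓡 n) x.1 (hh x x.2).contMDiffAt
    (contMDiffAt_of_mem_maximalAtlas hφ (hV x.2))

variable (hφ : φ ∈ IsManifold.maximalAtlas (𝓡 n) ∞ M)

/-- A smooth function of the coordinates of a chart. -/
def ofChart {V : Opens M} (hV : (V : Set M) ⊆ φ.source) (h : EuclideanSpace ℝ (Fin n) → ℝ)
    (hh : ∀ x ∈ V, ContDiffAt ℝ ∞ h (φ x)) : C^∞⟮𝓡 n, V; 𝓘(ℝ, ℝ), ℝ⟯ :=
  ⟨fun x => h (φ x), contMDiff_comp_chart hφ hV hh⟩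

/-- The partial derivative of a smooth function in a chart. -/
def chartDeriv {V : Opens M} (hV : (V : Set M) ⊆ φ.source) (i : Fin n) :
    C^∞⟮𝓡 n, V; 𝓘(ℝ, ℝ), ℝ⟯ →ₗ[ℝ] C^∞⟮𝓡 n, V; 𝓘(ℝ, ℝ), ℝ⟯ where
  toFun h := ofChart hφ hV
    (fun w => fderiv ℝ (fun u => zeroExt h (φ.symm u)) w (EuclideanSpace.single i 1)) fun _ hx =>
      ((contDiffAt_zeroExt hφ h hx (hV hx)).fderiv_right (m := ∞) (by simp)).clm_apply
        contDiffAt_const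
  map_add' h g := by
    ext x
    change fderiv ℝ (fun u => zeroExt (h + g : C^∞⟮𝓡 n, V; 𝓘(ℝ, ℝ), ℝ⟯) (φ.symm u)) _ _ =
      fderiv ℝ (fun u => zeroExt h (φ.symm u)) _ _ + fderiv ℝ (fun u => zeroExt g (φ.symm u)) _ _
    have e : (fun u => zeroExt (h + g : C^∞⟮𝓡 n, V; 𝓘(ℝ, ℝ), ℝ⟯) (φ.symm u)) =
        (fun u => zeroExt h (φ.symm u)) + fun u => zeroExt g (φ.symm u) := by
      funext u
      by_cases hu : φ.symm u ∈ V <;> simp [zeroExt, hu]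
    rw [e, fderiv_add ((contDiffAt_zeroExt hφ h x.2 (hV x.2)).differentiableAt (by simp))
      ((contDiffAt_zeroExt hφ g x.2 (hV x.2)).differentiableAt (by simp))]
    rfl
  map_smul' c h := by
    ext x
    change fderiv ℝ (fun u => zeroExt (c • h : C^∞⟮𝓡 n, V; 𝓘(ℝ, ℝ), ℝ⟯) (φ.symm u)) _ _ =
      c * fderiv ℝ (fun u => zeroExt h (φ.symm u)) _ _
    have e : (fun u => zeroExt (c • h : C^∞⟮𝓡 n, V; 𝓘(ℝ, ℝ), ℝ⟯) (φ.symm u)) =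
        c • (fun u => zeroExt h (φ.symm u)) := by
      funext u
      by_cases hu : φ.symm u ∈ V <;> simp [zeroExt, hu]
    rw [e, fderiv_const_smul ((contDiffAt_zeroExt hφ h x.2 (hV x.2)).differentiableAt (by simp))]
    rfl

theorem chartDeriv_apply {V : Opens M} (hV : (V : Set M) ⊆ φ.source) (i : Fin n)
    (h : C^∞⟮𝓡 n, V; 𝓘(ℝ, ℝ), ℝ⟯) (x : V) : chartDeriv hφ hV i h x =
      fderiv ℝ (fun u => zeroExt h (φ.symm u)) (φ x) (EuclideanSpace.single i 1) := rfl

theorem chartDeriv_mul {V : Opens M} (hV : (V : Set M) ⊆ φ.source) (i : Fin n)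
    (h g : C^∞⟮𝓡 n, V; 𝓘(ℝ, ℝ), ℝ⟯) :
    chartDeriv hφ hV i (h * g) = chartDeriv hφ hV i h * g + h * chartDeriv hφ hV i g := by
  ext x
  change fderiv ℝ _ _ _ = fderiv ℝ _ _ _ * g x + h x * fderiv ℝ _ _ _
  have e : (fun u => zeroExt (h * g : C^∞⟮𝓡 n, V; 𝓘(ℝ, ℝ), ℝ⟯) (φ.symm u)) =
      (fun u => zeroExt h (φ.symm u)) * fun u => zeroExt g (φ.symm u) := by
    funext u
    by_cases hu : φ.symm u ∈ V <;> simp [zeroExt, hu]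
  rw [e, fderiv_mul ((contDiffAt_zeroExt hφ h x.2 (hV x.2)).differentiableAt (by simp))
    ((contDiffAt_zeroExt hφ g x.2 (hV x.2)).differentiableAt (by simp))]
  simp only [φ.left_inv (hV x.2), zeroExt_apply, add_apply, smul_apply, smul_eq_mul]
  ring

theorem chartDeriv_res {U V : Opens M} (hU : (U : Set M) ⊆ φ.source) (hVU : V ≤ U) (i : Fin n)
    (h : C^∞⟮𝓡 n, U; 𝓘(ℝ, ℝ), ℝ⟯) :
    smoothRestrict n hVU (chartDeriv hφ hU i h) =
      chartDeriv hφ (subset_of_le hVU hU) i (smoothRestrict n hVU h) := by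
  ext x
  change fderiv ℝ _ _ _ = fderiv ℝ _ _ _
  congr 1
  refine ((zeroExt_eventuallyEq (φ := φ) _ (g := zeroExt h) (fun y => ?_) x.2
    (hU (hVU x.2))).fderiv_eq).symm
  rw [zeroExt_of_mem _ (hVU y.2)]
  rfl

/-- The coordinates of a chart as smooth functions. -/
def chartCoord {V : Opens M} (hV : (V : Set M) ⊆ φ.source) (i : Fin n) :
    C^∞⟮𝓡 n, V; 𝓘(ℝ, ℝ), ℝ⟯ :=
  ofChart hφ hV (fun u => u i) fun _ _ => (EuclideanSpace.proj (𝕜 := ℝ) i).contDiff.contDiffAt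

theorem chartDeriv_chartCoord {V : Opens M} (hV : (V : Set M) ⊆ φ.source) (i j : Fin n) :
    chartDeriv hφ hV i (chartCoord hφ hV j) = if i = j then 1 else 0 := by
  ext x
  rw [chartDeriv_apply]
  have h1 := zeroExt_eventuallyEq (φ := φ) (chartCoord hφ hV j) (g := fun x => φ x j)
    (fun y => rfl) x.2 (hV x.2)
  have h2 : (fun u => φ (φ.symm u) j) =ᶠ[𝓝 (φ x)] fun u => EuclideanSpace.proj (𝕜 := ℝ) j u := by
    filter_upwards [φ.open_target.mem_nhds (φ.map_source (hV x.2))] with u hu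
    rw [φ.right_inv hu]
    rfl
  rw [(h1.trans h2).fderiv_eq, ContinuousLinearMap.fderiv]
  rcases eq_or_ne i j with rfl | hij
  · simp
  · simp [hij, hij.symm]

theorem hasFDerivAt_zeroExt {V : Opens M} (hV : (V : Set M) ⊆ φ.source)
    (h : C^∞⟮𝓡 n, V; 𝓘(ℝ, ℝ), ℝ⟯) (x : V) :
    HasFDerivAt (fun u => zeroExt h (φ.symm u))
      (∑ i, chartDeriv hφ hV i h x • EuclideanSpace.proj (𝕜 := ℝ) i) (φ x) := by
  have hd := ((contDiffAt_zeroExt hφ h x.2 (hV x.2)).differentiableAt (by simp)).hasFDerivAt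
  convert! hd using 1
  ext v
  have hv : v = ∑ i, v i • EuclideanSpace.single i (1 : ℝ) := by
    ext j
    simp [Finset.sum_apply, Pi.single_apply]
  conv_rhs => rw [hv]
  simp [map_sum, chartDeriv_apply, mul_comm]

end ChartDeriv

/-! ### Partial derivatives of the local model -/

namespace LocalModel

variable {n m : ℕ} {M : Type u} [TopologicalSpace M] [ChartedSpace (EuclideanSpace ℝ (Fin n)) M]
  {φ : OpenPartialHomeomorph M (EuclideanSpace ℝ (Fin n))}
  (hφ : φ ∈ IsManifold.maximalAtlas (𝓡 n) ∞ M)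

/-- The parity of the coordinates of a superdomain of dimension `n|m`. -/
def _root_.coordDeg {n m : ℕ} : Fin n ⊕ Fin m → ZMod 2 := Sum.elim (fun _ => 0) fun _ => 1

/-- The partial derivatives of the local model. -/
def partialDeriv {V : Opens M} (hV : (V : Set M) ⊆ φ.source) :
    Fin n ⊕ Fin m → LocalModel n m V →ₗ[ℝ] LocalModel n m V
  | Sum.inl i => LinearMap.rTensor _ (chartDeriv hφ hV i)
  | Sum.inr α => LinearMap.lTensor _ (Grassmann.deriv α)

/-- The coordinates of the local model. -/
def coord {V : Opens M} (hV : (V : Set M) ⊆ φ.source) : Fin n ⊕ Fin m → LocalModel n m V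
  | Sum.inl i => chartCoord hφ hV i ⊗ₜ 1
  | Sum.inr α => gen V α

theorem partialDeriv_mem {V : Opens M} (hV : (V : Set M) ⊆ φ.source) (a : Fin n ⊕ Fin m)
    {j : ZMod 2} {x : LocalModel n m V} (hx : x ∈ par n m V j) :
    partialDeriv hφ hV a x ∈ par n m V (coordDeg a + j) := by
  refine par_induction (P := fun x => partialDeriv hφ hV a x ∈ par n m V (coordDeg a + j))
    (by rw [map_zero]; exact zero_mem _) (fun f b hb => ?_)
    (fun x y hx hy => by rw [map_add]; exact add_mem hx hy) hx
  rcases a with i | α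
  · simp only [coordDeg, Sum.elim_inl, zero_add]
    exact tmul_mem_par _ hb
  · exact tmul_mem_par _ (Grassmann.deriv_mem α hb)

theorem partialDeriv_mul {V : Opens M} (hV : (V : Set M) ⊆ φ.source) (a : Fin n ⊕ Fin m)
    {j : ZMod 2} {x : LocalModel n m V} (hx : x ∈ par n m V j) (y : LocalModel n m V) :
    partialDeriv hφ hV a (x * y) =
      partialDeriv hφ hV a x * y + koszul (coordDeg a) j • (x * partialDeriv hφ hV a y) := by
  refine par_induction (P := fun x => partialDeriv hφ hV a (x * y) =
      partialDeriv hφ hV a x * y + koszul (coordDeg a) j • (x * partialDeriv hφ hV a y))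
    (by simp) (fun f b hb => ?_) (fun x x' hx hx' => ?_) hx
  · induction y using TensorProduct.induction_on with
    | zero => simp
    | tmul g c =>
      rcases a with i | α
      · simp only [partialDeriv, LinearMap.rTensor_tmul, Algebra.TensorProduct.tmul_mul_tmul,
          chartDeriv_mul, TensorProduct.add_tmul]
        simp [coordDeg, koszul]
      · simp only [partialDeriv, LinearMap.lTensor_tmul, Algebra.TensorProduct.tmul_mul_tmul,
          Grassmann.deriv_mul α hb, TensorProduct.tmul_add, coordDeg, Sum.elim_inr]
        rw [← TensorProduct.tmul_smul]
    | add y z hy hz => rw [mul_add, map_add, hy, hz, map_add, mul_add, mul_add, smul_add]; abel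
  · rw [add_mul, map_add, hx, hx', map_add, add_mul, add_mul, smul_add]; abel

theorem partialDeriv_res {U V : Opens M} (hU : (U : Set M) ⊆ φ.source) (hVU : V ≤ U)
    (a : Fin n ⊕ Fin m) (x : LocalModel n m U) :
    res n m hVU (partialDeriv hφ hU a x) =
      partialDeriv hφ (subset_of_le hVU hU) a (res n m hVU x) := by
  induction x using TensorProduct.induction_on with
  | zero => simp
  | tmul f b =>
    rcases a with i | α
    · simp only [partialDeriv, LinearMap.rTensor_tmul, res_tmul, chartDeriv_res]
    · simp only [partialDeriv, LinearMap.lTensor_tmul, res_tmul]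
  | add x y hx hy => rw [map_add, map_add, hx, hy, map_add, map_add]

theorem coord_mem {V : Opens M} (hV : (V : Set M) ⊆ φ.source) (a : Fin n ⊕ Fin m) :
    coord hφ hV a ∈ par n m V (coordDeg a) := by
  rcases a with i | α
  · exact tmul_mem_par _ Grassmann.one_mem_par
  · exact tmul_mem_par _ (Grassmann.gen_mem α)

theorem coord_res {U V : Opens M} (hU : (U : Set M) ⊆ φ.source) (hVU : V ≤ U)
    (a : Fin n ⊕ Fin m) :
    res n m hVU (coord hφ hU a) = coord hφ (subset_of_le hVU hU) a := by
  rcases a with i | α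
  · rfl
  · change smoothRestrict n hVU 1 ⊗ₜ Grassmann.gen α = _
    rw [map_one]
    rfl

theorem partialDeriv_coord {V : Opens M} (hV : (V : Set M) ⊆ φ.source) (a b : Fin n ⊕ Fin m) :
    partialDeriv hφ hV a (coord hφ hV b) = if a = b then 1 else 0 := by
  have h1 : ∀ i, chartDeriv hφ hV i 1 = 0 := fun i => by
    have := chartDeriv_mul hφ hV i 1 1
    simpa using this
  rcases a with i | α <;> rcases b with j | β
  · simp only [partialDeriv, coord, LinearMap.rTensor_tmul, chartDeriv_chartCoord,
      Sum.inl.injEq]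
    split_ifs
    · rfl
    · simp
  · simp [partialDeriv, coord, gen, h1]
  · simp [partialDeriv, coord, Grassmann.deriv_one]
  · simp only [partialDeriv, coord, gen, LinearMap.lTensor_tmul, Grassmann.deriv_gen,
      Sum.inr.injEq]
    split_ifs
    · rfl
    · simp

/-- This links the algebraic derivation to calculus on M: `partialDeriv` in an even direction acts
on the smooth factor only, the augmentation on the Grassmann factor only, so they commute. -/
theorem hasFDerivAt_value {V : Opens M} (hV : (V : Set M) ⊆ φ.source) (f : LocalModel n m V)
    (x : V) :
    HasFDerivAt (fun u => zeroExt (fun y : V => value n m y f) (φ.symm u))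
      (∑ i, value n m x (partialDeriv hφ hV (Sum.inl i) f) • EuclideanSpace.proj (𝕜 := ℝ) i)
      (φ x) := by
  induction f using TensorProduct.induction_on with
  | zero =>
    have : (fun u => zeroExt (fun y : V => value n m y 0) (φ.symm u)) = fun _ => 0 := by
      funext u
      simp [zeroExt]
    rw [this]
    simpa using hasFDerivAt_const (0 : ℝ) (φ x)
  | tmul f a =>
    have h := (hasFDerivAt_zeroExt hφ hV f x).mul_const (Grassmann.aug m a)
    have e : (fun u => zeroExt (fun y : V => value n m y (f ⊗ₜ a)) (φ.symm u)) =
        fun u => zeroExt f (φ.symm u) * Grassmann.aug m a := by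
      funext u
      by_cases hu : φ.symm u ∈ V <;> simp [zeroExt, hu, value_tmul]
    rw [e]
    convert! h using 1
    simp only [partialDeriv, LinearMap.rTensor_tmul, value_tmul, Finset.smul_sum, smul_smul,
      mul_comm]
  | add f g hf hg =>
    have h := hf.add hg
    have e : (fun u => zeroExt (fun y : V => value n m y (f + g)) (φ.symm u)) =
        (fun u => zeroExt (fun y : V => value n m y f) (φ.symm u)) +
        fun u => zeroExt (fun y : V => value n m y g) (φ.symm u) := by
      funext u
      by_cases hu : φ.symm u ∈ V <;> simp [zeroExt, hu]
    rw [e]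
    convert! h using 1
    simp only [map_add, add_smul, Finset.sum_add_distrib]

end LocalModel

end

/-! ### Values of superfunctions, vector fields and local coordinates. -/

noncomputable section

/-! ### Values of superfunctions -/

namespace LocalModel

variable {n m : ℕ} {M : Type u} [TopologicalSpace M] [ChartedSpace (EuclideanSpace ℝ (Fin n)) M]

theorem value_res {U V : Opens M} (h : V ≤ U) (x : V) (f : LocalModel n m U) :
    value n m x (res n m h f) = value n m (⟨x, h x.2⟩ : U) f := by
  induction f using TensorProduct.induction_on with
  | zero => simp
  | tmul f a => rw [res_tmul, value_tmul, value_tmul]; rfl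
  | add f g hf hg => rw [map_add, map_add, hf, hg, map_add]

end LocalModel

namespace Supermanifold

variable {n m : ℕ} {M : Type u} [TopologicalSpace M] [ChartedSpace (EuclideanSpace ℝ (Fin n)) M]
  (𝒮 : Supermanifold.{u, v} n m M)

theorem value_res {U V : Opens M} (h : V ≤ U) {x : M} (hx : x ∈ V) (f : 𝒮.sec U) :
    𝒮.value x hx (𝒮.res h f) = 𝒮.value x (h hx) f := by
  change LocalModel.value n m _ ((𝒮.splitting x).iso _ _ (𝒮.res _ (𝒮.res h f))) =
    LocalModel.value n m _ ((𝒮.splitting x).iso _ _ (𝒮.res _ f))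
  rw [𝒮.res_res, ← 𝒮.res_res inf_le_left (inf_le_inf_right _ h),
    (𝒮.splitting x).iso_res _ _ inf_le_right (inf_le_inf_right _ h), LocalModel.value_res]

/-- Carried through a splitting, the values at `x` form a family of characters compatible with
restriction, and `LocalModel.eq_value` leaves only one such family. -/
theorem value_eq {W : Opens M} (σ : Splitting n m 𝒮.toSuperalgebraSheaf W) {V : Opens M}
    (hV : V ≤ W) {x : M} (hx : x ∈ V) (f : 𝒮.sec V) :
    𝒮.value x hx f = LocalModel.value n m ⟨x, hx⟩ (σ.iso V hV f) := by
  have := LocalModel.eq_value (W := W) (x := x)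
    (fun V hV hx => (𝒮.value x hx).comp (σ.iso V hV).symm.toAlgHom) (fun U V hU h hx f => ?_) hV hx
  · rw [← this]
    simp
  · have : (σ.iso V (h.trans hU)).symm (LocalModel.res n m h f) =
        𝒮.res h ((σ.iso U hU).symm f) := by
      rw [AlgEquiv.symm_apply_eq, σ.iso_res U V hU h, AlgEquiv.apply_symm_apply]
    change 𝒮.value x hx ((σ.iso V (h.trans hU)).symm _) = 𝒮.value x (h hx) ((σ.iso U hU).symm f)
    rw [this, value_res]

/-- Supercommutativity gives f² = -f² for odd f, so the square of its value is zero. -/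
theorem value_of_odd {U : Opens M} {x : M} (hx : x ∈ U) {f : 𝒮.sec U} (hf : f ∈ 𝒮.par U 1) :
    𝒮.value x hx f = 0 := by
  have h := 𝒮.supercomm hf hf
  have h2 : 𝒮.value x hx f * 𝒮.value x hx f = -(𝒮.value x hx f * 𝒮.value x hx f) := by
    rw [← map_mul, ← map_neg]
    refine congrArg _ (h.trans ?_)
    simp [koszul]
  exact mul_self_eq_zero.1 (by linarith)

theorem body_of_mem {U : Opens M} (f : 𝒮.sec U) {x : M} (hx : x ∈ U) :
    𝒮.body f x = 𝒮.value x hx f := by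
  simp [body, hx]

end Supermanifold

/-! ### Superderivations -/

namespace SuperalgebraSheaf

variable {M : Type u} [TopologicalSpace M] {𝒪 : SuperalgebraSheaf.{u, v} M}

theorem applyField_res_right {U V W : Opens M} (Y : 𝒪.tangent.sec U) (hV : V ≤ U) (hW : W ≤ V)
    (f : 𝒪.sec V) :
    𝒪.res hW (applyField Y hV f) = applyField Y (hW.trans hV) (𝒪.res hW f) := by
  obtain ⟨Y, hY⟩ := Y
  obtain ⟨D₀, h₀, D₁, h₁, rfl⟩ := Submodule.mem_sup.1 hY
  change 𝒪.res hW (D₀ ⟨V, hV⟩ f + D₁ ⟨V, hV⟩ f) =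
    D₀ ⟨W, hW.trans hV⟩ (𝒪.res hW f) + D₁ ⟨W, hW.trans hV⟩ (𝒪.res hW f)
  rw [map_add, h₀.1 ⟨V, hV⟩ ⟨W, hW.trans hV⟩ hW, h₁.1 ⟨V, hV⟩ ⟨W, hW.trans hV⟩ hW]

theorem applyField_res_left {U V W : Opens M} (Y : 𝒪.tangent.sec U) (hV : V ≤ U) (hW : W ≤ V) :
    applyField (𝒪.tangent.res hV Y) hW = applyField Y (hW.trans hV) := rfl

theorem mem_superDer {U : Opens M} {Y : 𝒪.tangent.sec U} {i : ZMod 2}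
    (hY : Y ∈ 𝒪.tangent.par U i) : (show 𝒪.vectorFields U from Y).1 ∈ 𝒪.superDer U i := hY

theorem applyField_mem {U V : Opens M} {Y : 𝒪.tangent.sec U} {i : ZMod 2}
    (hY : Y ∈ 𝒪.tangent.par U i) (hV : V ≤ U) {j : ZMod 2} {f : 𝒪.sec V} (hf : f ∈ 𝒪.par V j) :
    applyField Y hV f ∈ 𝒪.par V (i + j) :=
  (mem_superDer hY).2.1 ⟨V, hV⟩ j f hf

theorem applyField_mul {U V : Opens M} {Y : 𝒪.tangent.sec U} {i : ZMod 2}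
    (hY : Y ∈ 𝒪.tangent.par U i) (hV : V ≤ U) {j : ZMod 2} {f : 𝒪.sec V} (hf : f ∈ 𝒪.par V j)
    (g : 𝒪.sec V) : applyField Y hV (f * g) =
      applyField Y hV f * g + koszul i j • (f * applyField Y hV g) :=
  (mem_superDer hY).2.2 ⟨V, hV⟩ j f hf g

theorem applyField_add {U V : Opens M} (Y Z : 𝒪.tangent.sec U) (hV : V ≤ U) (f : 𝒪.sec V) :
    applyField (Y + Z) hV f = applyField Y hV f + applyField Z hV f := rfl

theorem applyField_sub {U V : Opens M} (Y Z : 𝒪.tangent.sec U) (hV : V ≤ U) (f : 𝒪.sec V) :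
    applyField (Y - Z) hV f = applyField Y hV f - applyField Z hV f := rfl

theorem applyField_real_smul {U V : Opens M} (c : ℝ) (Y : 𝒪.tangent.sec U) (hV : V ≤ U)
    (f : 𝒪.sec V) : applyField (c • Y) hV f = c • applyField Y hV f := rfl

theorem applyField_smul {U V : Opens M} (g : 𝒪.sec U) (Y : 𝒪.tangent.sec U) (hV : V ≤ U)
    (f : 𝒪.sec V) : applyField (g • Y) hV f = 𝒪.res hV g * applyField Y hV f := rfl

theorem applyField_sum {U V : Opens M} {ι : Type*} (s : Finset ι) (Y : ι → 𝒪.tangent.sec U)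
    (hV : V ≤ U) (f : 𝒪.sec V) :
    applyField (∑ a ∈ s, Y a) hV f = ∑ a ∈ s, applyField (Y a) hV f := by
  induction s using Finset.cons_induction with
  | empty => rfl
  | cons a s ha ih => rw [Finset.sum_cons, Finset.sum_cons, applyField_add, ih]

theorem exists_add_field {U : Opens M} (Y : 𝒪.tangent.sec U) :
    ∃ Y₀ ∈ 𝒪.tangent.par U 0, ∃ Y₁ ∈ 𝒪.tangent.par U 1, Y₀ + Y₁ = Y :=
  Submodule.mem_sup.1 ((𝒪.superDer_isCompl U).sup_eq_top.symm ▸ Submodule.mem_top :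
    (show 𝒪.vectorFields U from Y) ∈ _ ⊔ _)

theorem field_ext {U : Opens M} {Y Z : 𝒪.tangent.sec U}
    (h : ∀ (V : Opens M) (hV : V ≤ U) (f : 𝒪.sec V), applyField Y hV f = applyField Z hV f) :
    Y = Z :=
  Subtype.ext (funext fun V => LinearMap.ext fun f => h V.1 V.2 f)

theorem applyField_one {U V : Opens M} (Y : 𝒪.tangent.sec U) (hV : V ≤ U) :
    applyField Y hV 1 = 0 := by
  have hom : ∀ i, ∀ Z ∈ 𝒪.tangent.par U i, applyField Z hV 1 = 0 := fun i Z hZ => by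
    have := applyField_mul hZ hV (𝒪.one_mem V) 1
    simpa [koszul] using this
  obtain ⟨Y₀, h₀, Y₁, h₁, rfl⟩ := exists_add_field Y
  rw [applyField_add, hom _ _ h₀, hom _ _ h₁, add_zero]

theorem applyField_algebraMap {U V : Opens M} (Y : 𝒪.tangent.sec U) (hV : V ≤ U) (c : ℝ) :
    applyField Y hV (algebraMap ℝ _ c) = 0 := by
  rw [Algebra.algebraMap_eq_smul_one, map_smul, applyField_one, smul_zero]

end SuperalgebraSheaf

/-! ### Local coordinates on a supermanifold -/

open SuperalgebraSheaf

/-- A coordinate system on an open subset of a supermanifold, over a chart of the underlying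
manifold. -/
structure CoordSystem {n m : ℕ} {M : Type u} [TopologicalSpace M]
    [ChartedSpace (EuclideanSpace ℝ (Fin n)) M] (𝒮 : Supermanifold.{u, v} n m M)
    (φ : OpenPartialHomeomorph M (EuclideanSpace ℝ (Fin n))) (U : Opens M) where
  subset_source : (U : Set M) ⊆ φ.source
  coord : Fin n ⊕ Fin m → 𝒮.sec U
  field : Fin n ⊕ Fin m → 𝒮.tangent.sec U
  coord_mem : ∀ a, coord a ∈ 𝒮.par U (coordDeg a)
  field_mem : ∀ a, field a ∈ 𝒮.tangent.par U (coordDeg a)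
  apply_coord : ∀ a b, applyField (field a) le_rfl (coord b) = if a = b then 1 else 0
  eq_sum : ∀ {V : Opens M} (h : V ≤ U) (Z : 𝒮.tangent.sec V),
    Z = ∑ a, applyField Z le_rfl (𝒮.res h (coord a)) • 𝒮.tangent.res h (field a)
  exists_eq_sum : ∀ {V : Opens M} (h : V ≤ U) (f : 𝒮.sec V), (∀ x hx, 𝒮.value x hx f = 0) →
    ∃ g : Fin m → 𝒮.sec V, f = ∑ α, 𝒮.res h (coord (Sum.inr α)) * g α
  value_coord : ∀ x (hx : x ∈ U) i, 𝒮.value x hx (coord (Sum.inl i)) = φ x i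
  hasFDerivAt : ∀ {V : Opens M} (h : V ≤ U) (f : 𝒮.sec V) (x : M) (hx : x ∈ V),
    HasFDerivAt (fun u => 𝒮.body f (φ.symm u))
      (∑ i, 𝒮.value x hx (applyField (field (Sum.inl i)) h f) • EuclideanSpace.proj (𝕜 := ℝ) i)
      (φ x)
  exists_value_eq : ∀ {V : Opens M}, V ≤ U → ∀ h : EuclideanSpace ℝ (Fin n) → ℝ,
    (∀ x ∈ V, ContDiffAt ℝ ∞ h (φ x)) → ∃ f : 𝒮.sec V, ∀ x hx, 𝒮.value x hx f = h (φ x)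

namespace Splitting

variable {n m : ℕ} {M : Type u} [TopologicalSpace M] [ChartedSpace (EuclideanSpace ℝ (Fin n)) M]
  {𝒪 : SuperalgebraSheaf.{u, v} M} {W : Opens M} (σ : Splitting n m 𝒪 W)
  {φ : OpenPartialHomeomorph M (EuclideanSpace ℝ (Fin n))}
  (hφ : φ ∈ IsManifold.maximalAtlas (𝓡 n) ∞ M)

theorem symm_res {U V : Opens M} (hU : U ≤ W) (h : V ≤ U) (f : LocalModel n m U) :
    (σ.iso V (h.trans hU)).symm (LocalModel.res n m h f) = 𝒪.res h ((σ.iso U hU).symm f) := by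
  rw [AlgEquiv.symm_apply_eq, σ.iso_res U V hU h, AlgEquiv.apply_symm_apply]

theorem symm_mem {V : Opens M} (hV : V ≤ W) {i : ZMod 2} {f : LocalModel n m V}
    (hf : f ∈ LocalModel.par n m V i) : (σ.iso V hV).symm f ∈ 𝒪.par V i := by
  rw [← σ.iso_mem_iff V hV, AlgEquiv.apply_symm_apply]
  exact hf

/-- The coordinates given by a splitting and a chart. -/
def coord {U : Opens M} (hU : U ≤ W) (hUφ : (U : Set M) ⊆ φ.source) (a : Fin n ⊕ Fin m) :
    𝒪.sec U := (σ.iso U hU).symm (LocalModel.coord hφ hUφ a)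

theorem iso_coord {U : Opens M} (hU : U ≤ W) (hUφ : (U : Set M) ⊆ φ.source) (a : Fin n ⊕ Fin m) :
    σ.iso U hU (σ.coord hφ hU hUφ a) = LocalModel.coord hφ hUφ a := AlgEquiv.apply_symm_apply _ _

theorem coord_res {U V : Opens M} (hU : U ≤ W) (hUφ : (U : Set M) ⊆ φ.source) (h : V ≤ U)
    (a : Fin n ⊕ Fin m) : 𝒪.res h (σ.coord hφ hU hUφ a) =
      σ.coord hφ (h.trans hU) (subset_of_le h hUφ) a := by
  rw [coord, ← symm_res, LocalModel.coord_res]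
  rfl

theorem partial_mem {U : Opens M} (hU : U ≤ W) (hUφ : (U : Set M) ⊆ φ.source)
    (a : Fin n ⊕ Fin m) :
    (fun V => (σ.iso V.1 (V.2.trans hU)).symm.toLinearMap ∘ₗ
      LocalModel.partialDeriv hφ (subset_of_le V.2 hUφ) a ∘ₗ
      (σ.iso V.1 (V.2.trans hU)).toLinearMap : 𝒪.EndFamily U) ∈ 𝒪.superDer U (coordDeg a) := by
  refine ⟨fun V V' h f => ?_, fun V j f hf => ?_, fun V j f hf g => ?_⟩
  · change 𝒪.res h ((σ.iso V.1 _).symm _) = (σ.iso V'.1 _).symm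
      (LocalModel.partialDeriv hφ _ a (σ.iso V'.1 _ (𝒪.res h f)))
    rw [← symm_res σ (V.2.trans hU) h, σ.iso_res V.1 V'.1 (V.2.trans hU) h,
      ← LocalModel.partialDeriv_res hφ (subset_of_le V.2 hUφ) h]
    rfl
  · exact symm_mem _ _ (LocalModel.partialDeriv_mem hφ _ a ((σ.iso_mem_iff _ _ _ _).2 hf))
  · change (σ.iso V.1 _).symm (LocalModel.partialDeriv hφ _ a (σ.iso V.1 _ (f * g))) =
      (σ.iso V.1 _).symm (LocalModel.partialDeriv hφ _ a (σ.iso V.1 _ f)) * g +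
      koszul (coordDeg a) j •
        (f * (σ.iso V.1 _).symm (LocalModel.partialDeriv hφ _ a (σ.iso V.1 _ g)))
    have key := LocalModel.partialDeriv_mul hφ (subset_of_le V.2 hUφ) a
      ((σ.iso_mem_iff V.1 (V.2.trans hU) j f).2 hf) (σ.iso V.1 (V.2.trans hU) g)
    rw [map_mul]
    refine (congrArg (σ.iso V.1 (V.2.trans hU)).symm key).trans ?_
    rw [map_add, map_mul, map_zsmul, map_mul, AlgEquiv.symm_apply_apply,
      AlgEquiv.symm_apply_apply]

/-- The coordinate vector fields given by a splitting and a chart. -/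
def field {U : Opens M} (hU : U ≤ W) (hUφ : (U : Set M) ⊆ φ.source) (a : Fin n ⊕ Fin m) :
    𝒪.tangent.sec U :=
  show 𝒪.vectorFields U from ⟨_, 𝒪.superDer_le _ _ (σ.partial_mem hφ hU hUφ a)⟩

theorem field_mem {U : Opens M} (hU : U ≤ W) (hUφ : (U : Set M) ⊆ φ.source) (a : Fin n ⊕ Fin m) :
    σ.field hφ hU hUφ a ∈ 𝒪.tangent.par U (coordDeg a) := σ.partial_mem hφ hU hUφ a

theorem applyField_field {U : Opens M} (hU : U ≤ W) (hUφ : (U : Set M) ⊆ φ.source)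
    (a : Fin n ⊕ Fin m) {V : Opens M} (hV : V ≤ U) (f : 𝒪.sec V) :
    applyField (σ.field hφ hU hUφ a) hV f = (σ.iso V (hV.trans hU)).symm
      (LocalModel.partialDeriv hφ (subset_of_le hV hUφ) a (σ.iso V (hV.trans hU) f)) := rfl

theorem applyField_coord {U : Opens M} (hU : U ≤ W) (hUφ : (U : Set M) ⊆ φ.source)
    (a b : Fin n ⊕ Fin m) {V : Opens M} (hV : V ≤ U) :
    applyField (σ.field hφ hU hUφ a) hV
      (σ.coord hφ (hV.trans hU) (subset_of_le hV hUφ) b) = if a = b then 1 else 0 := by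
  rw [applyField_field, iso_coord, LocalModel.partialDeriv_coord]
  split_ifs <;> simp

/-- A homogeneous vector field that annihilates the coordinates vanishes. -/
theorem eq_zero_of_apply_coord {U : Opens M} (hU : U ≤ W) (hUφ : (U : Set M) ⊆ φ.source)
    {i : ZMod 2} {Z : 𝒪.tangent.sec U} (hZ : Z ∈ 𝒪.tangent.par U i)
    (h : ∀ a, applyField Z le_rfl (σ.coord hφ hU hUφ a) = 0) : Z = 0 := by
  have h' : ∀ (V : Opens M) (hV : V ≤ U) a,
      applyField Z hV (σ.coord hφ (hV.trans hU) (subset_of_le hV hUφ) a) = 0 := fun V hV a => by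
    rw [← coord_res σ hφ hU hUφ hV, ← applyField_res_right Z le_rfl hV, h, map_zero]
  -- the odd directions
  have hodd : ∀ (V : Opens M) (hV : V ≤ U) (b : Grassmann m),
      applyField Z hV ((σ.iso V (hV.trans hU)).symm (1 ⊗ₜ b)) = 0 := fun V hV b => by
    have hι : ∀ v : Fin m → ℝ,
        applyField Z hV ((σ.iso V (hV.trans hU)).symm (1 ⊗ₜ ExteriorAlgebra.ι ℝ v)) = 0 := by
      intro v
      rw [Grassmann.ι_eq_sum, TensorProduct.tmul_sum, map_sum, map_sum]
      refine Finset.sum_eq_zero fun α _ => ?_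
      rw [TensorProduct.tmul_smul, map_smul, map_smul]
      exact (congrArg _ (h' V hV (Sum.inr α))).trans (smul_zero _)
    refine CliffordAlgebra.left_induction (P := fun b => applyField Z hV
      ((σ.iso V (hV.trans hU)).symm (1 ⊗ₜ b)) = 0) (0 : QuadraticForm ℝ (Fin m → ℝ))
      (fun r => ?_) (fun b c hb hc => ?_) (fun b v hb => ?_) b
    · rw [Algebra.algebraMap_eq_smul_one, TensorProduct.tmul_smul, map_smul, map_smul,
        ← Algebra.TensorProduct.one_def, map_one, applyField_one, smul_zero]
    · rw [TensorProduct.tmul_add, map_add, map_add, hb, hc, add_zero]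
    · rw [← one_mul (1 : C^∞⟮𝓡 n, V; 𝓘(ℝ, ℝ), ℝ⟯), ← Algebra.TensorProduct.tmul_mul_tmul, map_mul,
        applyField_mul hZ hV (symm_mem σ _ (LocalModel.tmul_mem_par _ (Grassmann.ι_mem_par v))),
        hb]
      refine (congrArg₂ (· + ·) (congrArg₂ (· * ·) (hι v) rfl) ?_).trans
        ((congrArg₂ (· + ·) (zero_mul _) rfl).trans (add_zero _))
      rw [mul_zero, smul_zero]
  -- the even directions
  have heven : ∀ (V : Opens M) (hV : V ≤ U) (f : C^∞⟮𝓡 n, V; 𝓘(ℝ, ℝ), ℝ⟯),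
      applyField Z hV ((σ.iso V (hV.trans hU)).symm (f ⊗ₜ 1)) = 0 := fun V hV f => by
    rw [← (σ.iso V (hV.trans hU)).map_eq_zero_iff]
    -- One point is treated at a time, but all Grassmann coefficients at `x` must vanish, not only
    -- the value.
    refine LocalModel.eq_zero_of_coeffAt fun x => ?_
    have hVφ : (V : Set M) ⊆ φ.source := subset_of_le hV hUφ
    obtain ⟨f', hf', hff'⟩ : ∃ f' : EuclideanSpace ℝ (Fin n) → ℝ, ContDiff ℝ ∞ f' ∧
        f' =ᶠ[nhds (φ x)] fun u => zeroExt f (φ.symm u) := by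
      refine exists_contDiff_eventuallyEq
        (φ.symm.isOpen_inter_preimage V.2 : IsOpen (φ.target ∩ φ.symm ⁻¹' V)) ?_
        ⟨φ.map_source (hVφ x.2), by simp [φ.left_inv (hVφ x.2)]⟩
      rintro u ⟨hu, hu'⟩
      have := contDiffAt_zeroExt hφ f hu' (φ.map_target hu)
      rw [φ.right_inv hu] at this
      exact this.contDiffWithinAt
    obtain ⟨g, hg, hfg⟩ := hadamard_of_contDiff hf' (φ x)
    obtain ⟨O, hO, hOo, hxO⟩ := eventually_nhds_iff.1 hff'
    -- On `V'` the function `f` coincides with the globally defined `f'` and inherits its Hadamard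
    -- expansion about `x`.
    let V' : Opens M := ⟨V ∩ (φ.source ∩ φ ⁻¹' O), V.2.inter (φ.isOpen_inter_preimage hOo)⟩
    have hV' : V' ≤ V := fun _ h => h.1
    have hx' : x.1 ∈ V' := ⟨x.2, hVφ x.2, hxO⟩
    let G : Fin n → C^∞⟮𝓡 n, V'; 𝓘(ℝ, ℝ), ℝ⟯ := fun i =>
      ofChart hφ (subset_of_le hV' hVφ) (g i) fun _ _ => (hg i).contDiffAt
    have key : smoothRestrict n hV' f = algebraMap ℝ _ (f x) +
        ∑ i, (chartCoord hφ (subset_of_le hV' hVφ) i - algebraMap ℝ _ (φ x i)) * G i := by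
      ext y
      have h1 := hO (φ y) y.2.2.2
      simp only at h1
      rw [φ.left_inv (hVφ (hV' y.2)), zeroExt_of_mem _ (hV' y.2)] at h1
      have h2 := hO (φ x) hxO
      simp only at h2
      rw [φ.left_inv (hVφ x.2), zeroExt_apply] at h2
      rw [LocalModel.smoothRestrict_apply, ← h1, hfg (φ y), h2]
      rw [ContMDiffMap.coe_add, Pi.add_apply]
      congr 1
      rw [← ContMDiffMap.coeFnAddMonoidHom_apply, map_sum, Finset.sum_apply]
      rfl
    -- `Z` kills constants and coordinates, so only the terms (x^i - x^i(x)) Z(G_i) survive, and all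
    -- their coefficients at `x` are zero.
    have key2 : applyField Z (hV'.trans hV) ((σ.iso V' (hV'.trans (hV.trans hU))).symm
        (smoothRestrict n hV' f ⊗ₜ 1)) =
        ∑ i, (σ.coord hφ (hV'.trans (hV.trans hU)) (subset_of_le hV' hVφ) (Sum.inl i) -
          algebraMap ℝ _ (φ x i)) * applyField Z (hV'.trans hV)
            ((σ.iso V' (hV'.trans (hV.trans hU))).symm (G i ⊗ₜ 1)) := by
      rw [key, TensorProduct.add_tmul, map_add, map_add, Algebra.algebraMap_eq_smul_one,
        ← TensorProduct.smul_tmul', map_smul, map_smul, ← Algebra.TensorProduct.one_def, map_one,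
        applyField_one, smul_zero, zero_add, TensorProduct.sum_tmul, map_sum, map_sum]
      refine Finset.sum_congr rfl fun i _ => ?_
      have e : ((chartCoord hφ (subset_of_le hV' hVφ) i - algebraMap ℝ _ (φ x i)) * G i) ⊗ₜ 1 =
          (LocalModel.coord hφ (subset_of_le hV' hVφ) (Sum.inl i) - algebraMap ℝ _ (φ x i)) *
            (G i ⊗ₜ 1 : LocalModel n m V') := by
        conv_lhs => rw [← mul_one (1 : Grassmann m), ← Algebra.TensorProduct.tmul_mul_tmul,
          TensorProduct.sub_tmul]
        rfl
      have hmem : σ.coord hφ (hV'.trans (hV.trans hU)) (subset_of_le hV' hVφ) (Sum.inl i) -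
          algebraMap ℝ _ (φ x i) ∈ 𝒪.par V' 0 := by
        refine sub_mem (symm_mem σ _ (LocalModel.coord_mem hφ _ (Sum.inl i))) ?_
        rw [Algebra.algebraMap_eq_smul_one]
        exact Submodule.smul_mem _ _ (𝒪.one_mem _)
      rw [e, map_mul, map_sub, AlgEquiv.commutes]
      refine (applyField_mul hZ _ hmem _).trans ?_
      rw [map_sub, h' V' (hV'.trans hV), applyField_algebraMap]
      simp [koszul]
    have key3 := LocalModel.coeffAt_res hV' ⟨x.1, hx'⟩
      (σ.iso V (hV.trans hU) (applyField Z hV ((σ.iso V (hV.trans hU)).symm (f ⊗ₜ 1))))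
    rw [← σ.iso_res V V' (hV.trans hU) hV', applyField_res_right, ← symm_res,
      LocalModel.res_tmul, key2, map_sum, map_sum] at key3
    refine key3.symm.trans (Finset.sum_eq_zero fun i _ => ?_)
    rw [map_mul, map_mul, map_sub, map_sub, iso_coord, LocalModel.coord,
      LocalModel.coeffAt_tmul, AlgEquiv.commutes, AlgHom.commutes, Algebra.algebraMap_eq_smul_one]
    refine (congrArg₂ (· * ·) (sub_self _) rfl).trans (zero_mul _)
  refine field_ext fun V hV f => ?_
  obtain ⟨f, rfl⟩ := (σ.iso V (hV.trans hU)).symm.surjective f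
  change applyField Z hV _ = 0
  induction f using TensorProduct.induction_on with
  | zero => simp
  | tmul f b =>
    rw [← mul_one f, ← one_mul b, ← Algebra.TensorProduct.tmul_mul_tmul, map_mul,
      applyField_mul hZ hV (symm_mem σ _ (LocalModel.tmul_mem_par _ Grassmann.one_mem_par)),
      hodd, heven]
    simp
  | add f g hf hg => rw [map_add, map_add, hf, hg, add_zero]

end Splitting

end

/-! ### Coordinate systems from splittings, and the flat connection of a coordinate system. -/

noncomputable section

open SuperalgebraSheaf

namespace CoordSystem

variable {n m : ℕ} {M : Type u} [TopologicalSpace M] [ChartedSpace (EuclideanSpace ℝ (Fin n)) M]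
  {𝒮 : Supermanifold.{u, v} n m M}
  {φ : OpenPartialHomeomorph M (EuclideanSpace ℝ (Fin n))} {U : Opens M}

/-- The coordinate system given by a splitting of the structure sheaf and a chart. -/
def ofSplitting {W : Opens M} (σ : Splitting n m 𝒮.toSuperalgebraSheaf W)
    (hφ : φ ∈ IsManifold.maximalAtlas (𝓡 n) ∞ M) (hU : U ≤ W) (hUφ : (U : Set M) ⊆ φ.source) :
    CoordSystem 𝒮 φ U where
  subset_source := hUφ
  coord := σ.coord hφ hU hUφ
  field := σ.field hφ hU hUφ
  coord_mem a := σ.symm_mem hU (LocalModel.coord_mem hφ hUφ a)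
  field_mem := σ.field_mem hφ hU hUφ
  apply_coord a b := σ.applyField_coord hφ hU hUφ a b le_rfl
  eq_sum {V} h Z := by
    have hom : ∀ i, ∀ Z ∈ 𝒮.tangent.par V i, Z = ∑ a, applyField Z le_rfl
        (𝒮.res h (σ.coord hφ hU hUφ a)) • 𝒮.tangent.res h (σ.field hφ hU hUφ a) := by
      intro i Z hZ
      rw [← sub_eq_zero]
      -- Both sides act in the same way on the coordinates, and this determines a homogeneous field.
      refine σ.eq_zero_of_apply_coord hφ (h.trans hU) (subset_of_le h hUφ) (i := i)
        (sub_mem hZ (sum_mem fun a _ => ?_)) fun b => ?_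
      · have h1 := 𝒮.tangent.smul_mem (applyField_mem hZ le_rfl
          (𝒮.res_mem h (σ.symm_mem hU (LocalModel.coord_mem hφ hUφ a))))
          (𝒮.tangent.res_mem h (σ.field_mem hφ hU hUφ a))
        have h2 : ∀ i j : ZMod 2, i + j + j = i := by decide
        rw [h2] at h1
        exact h1
      · rw [applyField_sub, applyField_sum, Finset.sum_eq_single b]
        · rw [applyField_smul, applyField_res_left, σ.applyField_coord hφ hU hUφ b b h, if_pos rfl,
            mul_one, 𝒮.res_refl, σ.coord_res hφ hU hUφ h, sub_self]
        · intro a _ hab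
          rw [applyField_smul, applyField_res_left, σ.applyField_coord hφ hU hUφ a b h, if_neg hab,
            mul_zero]
        · simp
    obtain ⟨Z₀, h₀, Z₁, h₁, rfl⟩ := exists_add_field Z
    conv_lhs => rw [hom _ _ h₀, hom _ _ h₁, ← Finset.sum_add_distrib]
    refine Finset.sum_congr rfl fun a _ => ?_
    rw [applyField_add, add_smul]
  exists_eq_sum {V} h f hf := by
    obtain ⟨g, hg⟩ := LocalModel.exists_eq_sum_gen_mul (f := σ.iso V (h.trans hU) f) fun x => by
      rw [← 𝒮.value_eq σ (h.trans hU) x.2, hf]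
    refine ⟨fun α => (σ.iso V (h.trans hU)).symm (g α), ?_⟩
    apply (σ.iso V (h.trans hU)).injective
    rw [hg, map_sum]
    refine Finset.sum_congr rfl fun α _ => ?_
    rw [map_mul, AlgEquiv.apply_symm_apply, σ.coord_res hφ hU hUφ h, σ.iso_coord]
    rfl
  value_coord x hx i := by
    rw [𝒮.value_eq σ hU hx, σ.iso_coord, LocalModel.coord, LocalModel.value_tmul, map_one, mul_one]
    rfl
  hasFDerivAt {V} h f x hx := by
    have := LocalModel.hasFDerivAt_value hφ (subset_of_le h hUφ) (σ.iso V (h.trans hU) f) ⟨x, hx⟩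
    convert! this using 1
    · funext u
      by_cases hu : φ.symm u ∈ V
      · rw [𝒮.body_of_mem f hu, zeroExt_of_mem _ hu, 𝒮.value_eq σ (h.trans hU)]
      · simp [Supermanifold.body, zeroExt, hu]
    · refine Finset.sum_congr rfl fun i _ => ?_
      rw [𝒮.value_eq σ (h.trans hU), σ.applyField_field, AlgEquiv.apply_symm_apply]
  exists_value_eq {V} h f hf := by
    refine ⟨(σ.iso V (h.trans hU)).symm (ofChart hφ (subset_of_le h hUφ) f hf ⊗ₜ 1), fun x hx => ?_⟩
    rw [𝒮.value_eq σ (h.trans hU), AlgEquiv.apply_symm_apply, LocalModel.value_tmul, map_one,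
      mul_one]
    rfl

theorem exists_coordSystem [IsManifold (𝓡 n) ∞ M] (𝒮 : Supermanifold.{u, v} n m M) (x : M) :
    ∃ U : Opens M, x ∈ U ∧ Nonempty (CoordSystem 𝒮 (chartAt (EuclideanSpace ℝ (Fin n)) x) U) := by
  refine ⟨𝒮.splitNhd x ⊓ ⟨(chartAt (EuclideanSpace ℝ (Fin n)) x).source,
    (chartAt (EuclideanSpace ℝ (Fin n)) x).open_source⟩, ⟨𝒮.mem_splitNhd x, mem_chart_source _ x⟩,
    ⟨ofSplitting (𝒮.splitting x) (IsManifold.chart_mem_maximalAtlas x) inf_le_left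
      fun _ h => h.2⟩⟩

variable (C : CoordSystem 𝒮 φ U)

/-- The restriction of a coordinate system to a smaller open set. -/
def restrict {V : Opens M} (h : V ≤ U) : CoordSystem 𝒮 φ V where
  subset_source := subset_of_le h C.subset_source
  coord a := 𝒮.res h (C.coord a)
  field a := 𝒮.tangent.res h (C.field a)
  coord_mem a := 𝒮.res_mem h (C.coord_mem a)
  field_mem a := 𝒮.tangent.res_mem h (C.field_mem a)
  apply_coord a b := by
    rw [applyField_res_left, ← applyField_res_right _ le_rfl h, C.apply_coord]
    split_ifs <;> simp
  eq_sum {V'} h' Z := by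
    conv_lhs => rw [C.eq_sum (h'.trans h) Z]
    simp only [𝒮.res_res, 𝒮.tangent.res_res]
  exists_eq_sum {V'} h' f hf := by
    simpa only [𝒮.res_res] using C.exists_eq_sum (h'.trans h) f hf
  value_coord x hx i := by rw [𝒮.value_res, C.value_coord]
  hasFDerivAt h' f x hx := C.hasFDerivAt (h'.trans h) f x hx
  exists_value_eq h' := C.exists_value_eq (h'.trans h)

/-- The coordinate vector fields, with their parity. -/
def homField (a : Fin n ⊕ Fin m) : 𝒮.HomField U := ⟨coordDeg a, C.field a, C.field_mem a⟩

theorem field_eq_zero {Z : 𝒮.tangent.sec U} (h : ∀ a, applyField Z le_rfl (C.coord a) = 0) :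
    Z = 0 := by
  rw [C.eq_sum le_rfl Z]
  refine Finset.sum_eq_zero fun a _ => ?_
  rw [𝒮.res_refl, h, zero_smul]

theorem applyField_apply_coord (Z : 𝒮.tangent.sec U) (a b : Fin n ⊕ Fin m) :
    applyField Z le_rfl (applyField (C.field a) le_rfl (C.coord b)) = 0 := by
  rw [C.apply_coord]
  split_ifs
  · exact applyField_one Z le_rfl
  · exact map_zero _

/-- The functions ∂_b x^c are constant, so both halves of the bracket kill all coordinates. -/
theorem bracket_eq_zero (a b : Fin n ⊕ Fin m) : (C.homField a).bracket (C.homField b) = 0 := by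
  refine C.field_eq_zero fun c => ?_
  change applyField (C.field a) le_rfl (applyField (C.field b) le_rfl (C.coord c)) -
    koszul _ _ • applyField (C.field b) le_rfl (applyField (C.field a) le_rfl (C.coord c)) = 0
  rw [applyField_apply_coord, applyField_apply_coord, smul_zero, sub_zero]

/-- The connection on the tangent sheaf for which the coordinate vector fields are parallel. -/
def flat : SuperConnection 𝒮.tangent U where
  nabla V h := LinearMap.mk₂ ℝ
    (fun Y Z => ∑ a, applyField Y le_rfl (applyField Z le_rfl (𝒮.res h (C.coord a))) •
      𝒮.tangent.res h (C.field a))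
    (fun Y Y' Z => by simp only [applyField_add, add_smul, Finset.sum_add_distrib])
    (fun c Y Z => by simp only [applyField_real_smul, smul_assoc, Finset.smul_sum])
    (fun Y Z Z' => by simp only [applyField_add, map_add, add_smul, Finset.sum_add_distrib])
    (fun c Y Z => by simp only [applyField_real_smul, map_smul, smul_assoc, Finset.smul_sum])
  nabla_res U' V hU' h Y Z := by
    simp only [LinearMap.mk₂_apply, map_sum, SupermodulePresheaf.res_smul,
      applyField_res_right _ le_rfl h, 𝒮.res_res, 𝒮.tangent.res_res, applyField_res_left]
  nabla_mem V hV i j Y hY Z hZ := by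
    rw [LinearMap.mk₂_apply]
    refine sum_mem fun a _ => ?_
    have h1 := 𝒮.tangent.smul_mem (applyField_mem hY le_rfl (applyField_mem hZ le_rfl
      (𝒮.res_mem hV (C.coord_mem a)))) (𝒮.tangent.res_mem hV (C.field_mem a))
    have h2 : ∀ i j k : ZMod 2, i + (j + k) + k = i + j := by decide
    rwa [h2] at h1
  nabla_smul_left V hV f Y Z := by
    simp only [LinearMap.mk₂_apply, Finset.smul_sum, applyField_smul, 𝒮.res_refl, mul_smul]
  nabla_smul_right V hV i j Y hY f hf Z := by
    simp only [LinearMap.mk₂_apply, applyField_smul, 𝒮.res_refl, applyField_mul hY le_rfl hf,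
      add_smul, Finset.sum_add_distrib]
    congr 1
    · conv_rhs => rw [C.eq_sum hV Z]
      simp only [Finset.smul_sum, mul_smul]
    · simp only [Finset.smul_sum, mul_smul, smul_assoc]

/-- The reason for choosing this ∇̄: the correction terms in covariant derivatives of the curvature
along coordinate fields drop out. -/
theorem flat_homField (a b : Fin n ⊕ Fin m) :
    (SuperConnection.homNabla C.flat (C.homField a) (C.homField b)).field = 0 := by
  change ∑ c, applyField (C.field a) le_rfl (applyField (C.field b) le_rfl
    (𝒮.res le_rfl (C.coord c))) • 𝒮.tangent.res le_rfl (C.field c) = 0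
  refine Finset.sum_eq_zero fun c _ => ?_
  rw [𝒮.res_refl, C.applyField_apply_coord, zero_smul]

/-- The odd coordinates. -/
def odd (α : Fin m) : 𝒮.sec U := C.coord (Sum.inr α)

/-- The odd coordinate vector fields. -/
def oddField (α : Fin m) : 𝒮.tangent.sec U := C.field (Sum.inr α)

theorem odd_mem (α : Fin m) : C.odd α ∈ 𝒮.par U 1 := C.coord_mem (Sum.inr α)

theorem oddField_mem (α : Fin m) : C.oddField α ∈ 𝒮.tangent.par U 1 := C.field_mem (Sum.inr α)

theorem odd_anticomm (α β : Fin m) : C.odd α * C.odd β = -(C.odd β * C.odd α) := by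
  have := 𝒮.supercomm (C.odd_mem α) (C.odd_mem β)
  simpa [koszul] using this

end CoordSystem

end

/-! ### Tensoriality of the curvature and of its covariant derivatives. -/

noncomputable section

open SuperalgebraSheaf

/-! ### Covariant derivatives of the curvature -/

namespace SuperConnection

variable {M : Type u} [TopologicalSpace M] {𝒪 : SuperalgebraSheaf.{u, v} M}
  {E : SupermodulePresheaf.{u, v, w} 𝒪} (D : SuperConnection E ⊤) {U : Opens M}

theorem curvatureDeriv_zero (D' : SuperConnection 𝒪.tangent U) (Ys : Fin 0 → 𝒪.HomField U)
    (Y Z : 𝒪.HomField U) (X : E.sec U) :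
    D.curvatureDeriv D' 0 Ys Y Z X = D.curvature Y Z X := rfl

theorem curvatureDeriv_succ (D' : SuperConnection 𝒪.tangent U) {r : ℕ}
    (Ys : Fin (r + 1) → 𝒪.HomField U) (Y Z : 𝒪.HomField U) (X : E.sec U) :
    D.curvatureDeriv D' (r + 1) Ys Y Z X =
      D.nabla U le_top (Ys 0).field (D.curvatureDeriv D' r (Fin.tail Ys) Y Z X)
      - ∑ l : Fin r, koszul (Ys 0).deg
            (∑ k ∈ Finset.univ.filter (· < l), (Fin.tail Ys k).deg) •
          D.curvatureDeriv D' r (Function.update (Fin.tail Ys) l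
            (homNabla D' (Ys 0) (Fin.tail Ys l))) Y Z X
      - koszul (Ys 0).deg (∑ k, (Fin.tail Ys k).deg) •
          D.curvatureDeriv D' r (Fin.tail Ys) (homNabla D' (Ys 0) Y) Z X
      - koszul (Ys 0).deg (∑ k, (Fin.tail Ys k).deg + Y.deg) •
          D.curvatureDeriv D' r (Fin.tail Ys) Y (homNabla D' (Ys 0) Z) X
      - koszul (Ys 0).deg (∑ k, (Fin.tail Ys k).deg + Y.deg + Z.deg) •
          D.curvatureDeriv D' r (Fin.tail Ys) Y Z (D.nabla U le_top (Ys 0).field X) := rfl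

theorem curvatureDeriv_add (D' : SuperConnection 𝒪.tangent U) {r : ℕ} (Ys : Fin r → 𝒪.HomField U)
    (Y Z : 𝒪.HomField U) (X X' : E.sec U) : D.curvatureDeriv D' r Ys Y Z (X + X') =
      D.curvatureDeriv D' r Ys Y Z X + D.curvatureDeriv D' r Ys Y Z X' := by
  induction r generalizing Y Z X X' with
  | zero => simp only [curvatureDeriv_zero, curvature, map_add, smul_add]; abel
  | succ r ih =>
    simp only [curvatureDeriv_succ, map_add, ih, smul_add, Finset.sum_add_distrib]
    abel

/-- The covariant derivatives of the curvature as additive maps. -/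
def curvatureHom (D' : SuperConnection 𝒪.tangent U) {r : ℕ} (Ys : Fin r → 𝒪.HomField U)
    (Y Z : 𝒪.HomField U) : E.sec U →+ E.sec U :=
  AddMonoidHom.mk' (D.curvatureDeriv D' r Ys Y Z) (D.curvatureDeriv_add D' Ys Y Z)

theorem curvatureDeriv_apply_zero (D' : SuperConnection 𝒪.tangent U) {r : ℕ}
    (Ys : Fin r → 𝒪.HomField U) (Y Z : 𝒪.HomField U) :
    D.curvatureDeriv D' r Ys Y Z 0 = 0 :=
  (D.curvatureHom D' Ys Y Z).map_zero

/-- Each term of the recursion contains a lower derivative of the curvature, applied to `X` or to a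
covariant derivative of `X`, which is zero. -/
theorem curvatureDeriv_of_parallel (D' : SuperConnection 𝒪.tangent U) {X : E.sec U}
    (hX : ∀ Y, D.nabla U le_top Y X = 0) {r : ℕ} (Ys : Fin r → 𝒪.HomField U)
    (Y Z : 𝒪.HomField U) : D.curvatureDeriv D' r Ys Y Z X = 0 := by
  induction r generalizing Y Z with
  | zero => simp [curvatureDeriv_zero, curvature, hX]
  | succ r ih => simp [curvatureDeriv_succ, ih, hX, curvatureDeriv_apply_zero]

theorem bracket_eq_zero_of_left {Y Z : 𝒪.HomField U} (h : Y.field = 0) : Y.bracket Z = 0 := by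
  refine field_ext fun V hV f => ?_
  change applyField Y.field hV (applyField Z.field hV f) -
    koszul _ _ • applyField Z.field hV (applyField Y.field hV f) = 0
  rw [h]
  change 0 - koszul _ _ • applyField Z.field hV 0 = 0
  simp

theorem bracket_eq_zero_of_right {Y Z : 𝒪.HomField U} (h : Z.field = 0) : Y.bracket Z = 0 := by
  refine field_ext fun V hV f => ?_
  change applyField Y.field hV (applyField Z.field hV f) -
    koszul _ _ • applyField Z.field hV (applyField Y.field hV f) = 0
  rw [h]
  change applyField Y.field hV 0 - koszul _ _ • 0 = 0
  simp

theorem homNabla_eq_zero_of_left (D' : SuperConnection 𝒪.tangent U) {Y Z : 𝒪.HomField U}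
    (h : Y.field = 0) : (homNabla D' Y Z).field = 0 := by
  change D'.nabla U le_rfl Y.field Z.field = 0
  rw [h, map_zero, LinearMap.zero_apply]

theorem homNabla_eq_zero_of_right (D' : SuperConnection 𝒪.tangent U) {Y Z : 𝒪.HomField U}
    (h : Z.field = 0) : (homNabla D' Y Z).field = 0 := by
  change D'.nabla U le_rfl Y.field Z.field = 0
  rw [h, map_zero]

/-- A zero field in `HomField` still carries an arbitrary parity, so the condition is put on the
underlying field. This is all the multilinearity in the vector fields that is needed: it discards
the terms in which ∇̄ produces zero. -/
theorem curvatureDeriv_eq_zero_of_field (D' : SuperConnection 𝒪.tangent U) {r : ℕ}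
    (Ys : Fin r → 𝒪.HomField U) (Y Z : 𝒪.HomField U) (X : E.sec U)
    (h : (∃ l, (Ys l).field = 0) ∨ Y.field = 0 ∨ Z.field = 0) :
    D.curvatureDeriv D' r Ys Y Z X = 0 := by
  induction r generalizing Y Z X with
  | zero =>
    rw [curvatureDeriv_zero, curvature]
    rcases h with ⟨l, -⟩ | h | h
    · exact l.elim0
    · simp [h, bracket_eq_zero_of_left h]
    · simp [h, bracket_eq_zero_of_right h]
  | succ r ih =>
    rw [curvatureDeriv_succ]
    by_cases h0 : (Ys 0).field = 0
    · have hsum : ∀ l : Fin r, D.curvatureDeriv D' r (Function.update (Fin.tail Ys) l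
            (homNabla D' (Ys 0) (Fin.tail Ys l))) Y Z X = 0 := fun l =>
        ih _ _ _ _ (Or.inl ⟨l, by simpa using homNabla_eq_zero_of_left D' h0⟩)
      rw [ih _ (homNabla D' (Ys 0) Y) _ _ (Or.inr (Or.inl (homNabla_eq_zero_of_left D' h0))),
        ih _ _ (homNabla D' (Ys 0) Z) _ (Or.inr (Or.inr (homNabla_eq_zero_of_left D' h0)))]
      simp [h0, hsum, curvatureDeriv_apply_zero]
    · have h' : (∃ l, (Fin.tail Ys l).field = 0) ∨ Y.field = 0 ∨ Z.field = 0 := by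
        refine h.imp_left ?_
        rintro ⟨l, hl⟩
        obtain ⟨k, rfl⟩ := Fin.exists_succ_eq.2 (fun e : l = 0 => h0 (e ▸ hl))
        exact ⟨k, hl⟩
      have hsum : ∀ l : Fin r, D.curvatureDeriv D' r (Function.update (Fin.tail Ys) l
            (homNabla D' (Ys 0) (Fin.tail Ys l))) Y Z X = 0 := fun l => by
        refine ih _ _ _ _ (h'.imp_left ?_)
        rintro ⟨k, hk⟩
        refine ⟨k, ?_⟩
        rcases eq_or_ne k l with rfl | hkl
        · simpa using homNabla_eq_zero_of_right D' hk
        · simpa [Function.update_of_ne hkl] using hk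
      rw [ih _ (homNabla D' (Ys 0) Y) _ _
          (h'.imp_right (Or.imp_left (homNabla_eq_zero_of_right D'))),
        ih _ _ (homNabla D' (Ys 0) Z) _
          (h'.imp_right (Or.imp_right (homNabla_eq_zero_of_right D'))),
        ih _ _ _ _ h', ih _ _ _ _ h']
      simp [hsum]

theorem nabla_homField_smul (Y : 𝒪.HomField U) {j : ZMod 2} {f : 𝒪.sec U} (hf : f ∈ 𝒪.par U j)
    (X : E.sec U) : D.nabla U le_top Y.field (f • X) =
      applyField Y.field le_rfl f • X + koszul Y.deg j • (f • D.nabla U le_top Y.field X) :=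
  D.nabla_smul_right U le_top _ _ Y.field Y.mem f hf X

/-- The second derivatives of `f` cancel against the bracket term and the mixed first order terms
cancel in pairs; the signs are checked in the eight parity cases. -/
theorem curvature_smul (Y Z : 𝒪.HomField U) {j : ZMod 2} {f : 𝒪.sec U} (hf : f ∈ 𝒪.par U j)
    (X : E.sec U) : D.curvature Y Z (f • X) =
      koszul (Y.deg + Z.deg) j • (f • D.curvature Y Z X) := by
  have hb : Y.bracket Z ∈ 𝒪.tangent.par U (Y.deg + Z.deg) := superDer_bracket Y.mem Z.mem
  have hb' : applyField (Y.bracket Z) le_rfl f = applyField Y.field le_rfl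
      (applyField Z.field le_rfl f) - koszul Y.deg Z.deg •
      applyField Z.field le_rfl (applyField Y.field le_rfl f) := rfl
  simp only [curvature]
  rw [D.nabla_homField_smul Y hf, D.nabla_homField_smul Z hf,
    D.nabla_smul_right U le_top _ _ _ hb _ hf, map_add, map_add, map_zsmul, map_zsmul,
    D.nabla_homField_smul Y hf, D.nabla_homField_smul Z hf,
    D.nabla_homField_smul Y (applyField_mem Z.mem le_rfl hf),
    D.nabla_homField_smul Z (applyField_mem Y.mem le_rfl hf), hb']
  obtain ⟨y, Y, hY⟩ := Y
  obtain ⟨z, Z, hZ⟩ := Z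
  rcases ZMod.two_cases y with rfl | rfl <;> rcases ZMod.two_cases z with rfl | rfl <;>
    rcases ZMod.two_cases j with rfl | rfl <;>
    simp [koszul, smul_sub, sub_smul, add_smul, show (1 : ZMod 2) + 1 = 0 from rfl] <;> abel

theorem sum_update_deg {r : ℕ} (T : Fin r → 𝒪.HomField U) (l : Fin r) (Y : 𝒪.HomField U)
    (D' : SuperConnection 𝒪.tangent U) :
    ∑ k, (Function.update T l (homNabla D' Y (T l)) k).deg = Y.deg + ∑ k, (T k).deg := by
  rw [← Finset.add_sum_erase _ _ (Finset.mem_univ l),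
    ← Finset.add_sum_erase _ (fun k => (T k).deg) (Finset.mem_univ l), Function.update_self,
    ← add_assoc]
  congr 1
  refine Finset.sum_congr rfl fun k hk => ?_
  rw [Function.update_of_ne (Finset.ne_of_mem_erase hk)]

/-- The covariant derivatives of the curvature are tensors. -/
theorem curvatureDeriv_smul (D' : SuperConnection 𝒪.tangent U) {r : ℕ} (Ys : Fin r → 𝒪.HomField U)
    (Y Z : 𝒪.HomField U) {j : ZMod 2} {f : 𝒪.sec U} (hf : f ∈ 𝒪.par U j) (X : E.sec U) :
    D.curvatureDeriv D' r Ys Y Z (f • X) =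
      koszul (∑ k, (Ys k).deg + Y.deg + Z.deg) j • (f • D.curvatureDeriv D' r Ys Y Z X) := by
  induction r generalizing Y Z X j f with
  | zero => simpa [curvatureDeriv_zero] using D.curvature_smul Y Z hf X
  | succ r ih =>
    set T : Fin r → 𝒪.HomField U := Fin.tail Ys with hT
    set W := Ys 0 with hW
    set d := ∑ k, (T k).deg + Y.deg + Z.deg with hd
    have hdeg : ∑ k, (Ys k).deg + Y.deg + Z.deg = W.deg + d := by
      rw [Fin.sum_univ_succ, hd, hW]
      simp only [hT, Fin.tail, add_assoc]
    have e1 : ∀ l, ∑ k, (Function.update T l (homNabla D' W (T l)) k).deg + Y.deg + Z.deg =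
        W.deg + d := fun l => by rw [sum_update_deg, hd]; abel
    have e2 : ∑ k, (T k).deg + (homNabla D' W Y).deg + Z.deg = W.deg + d := by
      rw [show (homNabla D' W Y).deg = W.deg + Y.deg from rfl, hd]; abel
    have e3 : ∑ k, (T k).deg + Y.deg + (homNabla D' W Z).deg = W.deg + d := by
      rw [show (homNabla D' W Z).deg = W.deg + Z.deg from rfl, hd]; abel
    -- The first and the last term of the recursion are taken together, because the derivative of
    -- `f` along `W` cancels only between these two.
    have h1 : D.nabla U le_top W.field (D.curvatureDeriv D' r T Y Z (f • X)) -
        koszul W.deg d • D.curvatureDeriv D' r T Y Z (D.nabla U le_top W.field (f • X)) =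
        koszul (W.deg + d) j • f • (D.nabla U le_top W.field (D.curvatureDeriv D' r T Y Z X) -
          koszul W.deg d • D.curvatureDeriv D' r T Y Z (D.nabla U le_top W.field X)) := by
      rw [ih _ _ _ hf, map_zsmul, D.nabla_homField_smul W hf, D.nabla_homField_smul W hf,
        curvatureDeriv_add,
        ih _ _ _ (applyField_mem W.mem le_rfl hf), ← hd]
      have h2 : D.curvatureDeriv D' r T Y Z (koszul W.deg j • f • D.nabla U le_top W.field X) =
          koszul W.deg j • D.curvatureDeriv D' r T Y Z (f • D.nabla U le_top W.field X) :=
        (D.curvatureHom D' T Y Z).map_zsmul _ _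
      rw [h2, ih _ _ _ hf, ← hd]
      generalize W.deg = y
      rcases ZMod.two_cases y with rfl | rfl <;> rcases ZMod.two_cases d with h | h <;>
        rcases ZMod.two_cases j with rfl | rfl <;>
        simp [h, koszul, smul_sub, show (1 : ZMod 2) + 1 = 0 from rfl]
    rw [curvatureDeriv_succ, curvatureDeriv_succ, hdeg]
    simp only [← hT, ← hW, ← hd]
    have hs : ∑ l : Fin r, koszul W.deg (∑ k ∈ Finset.univ.filter (· < l), (T k).deg) •
        D.curvatureDeriv D' r (Function.update T l (homNabla D' W (T l))) Y Z (f • X) =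
        koszul (W.deg + d) j • f • ∑ l : Fin r,
          koszul W.deg (∑ k ∈ Finset.univ.filter (· < l), (T k).deg) •
          D.curvatureDeriv D' r (Function.update T l (homNabla D' W (T l))) Y Z X := by
      rw [Finset.smul_sum, Finset.smul_sum]
      refine Finset.sum_congr rfl fun l _ => ?_
      rw [ih _ _ _ hf, e1, smul_comm (koszul W.deg _), smul_comm (koszul W.deg _) f]
    rw [sub_eq_iff_eq_add] at h1
    rw [h1, hs, ih _ (homNabla D' W Y) _ hf, ih _ _ (homNabla D' W Z) hf, e2, e3,
      smul_comm (koszul W.deg (∑ k, (T k).deg)),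
      smul_comm (koszul W.deg (∑ k, (T k).deg)) f,
      smul_comm (koszul W.deg (∑ k, (T k).deg + Y.deg)),
      smul_comm (koszul W.deg (∑ k, (T k).deg + Y.deg)) f]
    simp only [smul_sub]
    abel

end SuperConnection

end

/-! ### The filtration by powers of the odd ideal and the odd Euler operator N. -/

noncomputable section

open SuperalgebraSheaf

/-! ### Integration in the odd directions -/

/-- A repeated factor can be moved, up to sign, next to its twin, where its square is zero. -/
theorem List.prod_map_eq_zero_of_anticomm {ι A : Type*} [Ring A] {ξ : ι → A}
    (hsq : ∀ a, ξ a * ξ a = 0) (hanti : ∀ a b, ξ a * ξ b = -(ξ b * ξ a)) {l : List ι}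
    (hl : ¬ l.Nodup) : (l.map ξ).prod = 0 := by
  have key : ∀ (a : ι) (l : List ι), a ∈ l → ξ a * (l.map ξ).prod = 0 := by
    intro a l hal
    induction l with
    | nil => simp at hal
    | cons b l ih =>
      rw [List.map_cons, List.prod_cons, ← mul_assoc]
      rcases List.mem_cons.1 hal with rfl | h
      · rw [hsq, zero_mul]
      · rw [hanti, neg_mul, mul_assoc, ih h, mul_zero, neg_zero]
  induction l with
  | nil => simp at hl
  | cons b l ih =>
    rw [List.map_cons, List.prod_cons]
    by_cases hb : b ∈ l
    · exact key b l hb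
    · rw [ih fun h => hl (List.nodup_cons.2 ⟨hb, h⟩), mul_zero]

namespace CoordSystem

variable {n m : ℕ} {M : Type u} [TopologicalSpace M] [ChartedSpace (EuclideanSpace ℝ (Fin n)) M]
  {𝒮 : Supermanifold.{u, v} n m M}
  {φ : OpenPartialHomeomorph M (EuclideanSpace ℝ (Fin n))} {U : Opens M} (C : CoordSystem 𝒮 φ U)
  (E : SupermodulePresheaf.{u, v, w} 𝒮.toSuperalgebraSheaf)

/-- The filtration of the sections over a coordinate domain by powers of the ideal generated by the
odd coordinates. -/
def oddFiltration : ℕ → Submodule ℝ (E.sec U)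
  | 0 => ⊤
  | k + 1 => Submodule.span ℝ {s | ∃ α, ∃ t ∈ oddFiltration k, s = C.odd α • t}

variable {E}

theorem odd_smul_mem (α : Fin m) {k : ℕ} {t : E.sec U} (ht : t ∈ C.oddFiltration E k) :
    C.odd α • t ∈ C.oddFiltration E (k + 1) :=
  Submodule.subset_span ⟨α, t, ht, rfl⟩

theorem oddFiltration_succ_le (k : ℕ) : C.oddFiltration E (k + 1) ≤ C.oddFiltration E k := by
  induction k with
  | zero => exact le_top
  | succ k ih =>
    refine Submodule.span_le.2 ?_
    rintro _ ⟨α, t, ht, rfl⟩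
    exact C.odd_smul_mem α (ih ht)

theorem oddFiltration_antitone : Antitone (C.oddFiltration E) :=
  antitone_nat_of_succ_le C.oddFiltration_succ_le

theorem odd_mul_self (α : Fin m) : C.odd α * C.odd α = 0 := by
  have h := C.odd_anticomm α α
  have h2 : (2 : ℝ) • (C.odd α * C.odd α) = 0 := by
    rw [two_smul]
    exact eq_neg_iff_add_eq_zero.1 h
  exact (smul_eq_zero.1 h2).resolve_left two_ne_zero

/-- Elements of step `k` are combinations of sections multiplied by `k` odd coordinates, and `m + 1`
factors chosen among `m` coordinates contain a repetition. -/
theorem oddFiltration_eq_bot : C.oddFiltration E (m + 1) = ⊥ := by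
  have key : ∀ k, C.oddFiltration E k ≤ Submodule.span ℝ
      {s | ∃ (l : List (Fin m)) (t : E.sec U), l.length = k ∧ s = (l.map C.odd).prod • t} := by
    intro k
    induction k with
    | zero =>
      intro s _
      exact Submodule.subset_span ⟨[], s, rfl, by simp⟩
    | succ k ih =>
      refine Submodule.span_le.2 ?_
      rintro _ ⟨α, t, ht, rfl⟩
      have ht' := ih ht
      clear ht
      induction ht' using Submodule.span_induction with
      | mem s hs =>
        obtain ⟨l, t, hl, rfl⟩ := hs
        exact Submodule.subset_span ⟨α :: l, t, by simp [hl], by simp [mul_smul]⟩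
      | zero => rw [smul_zero]; exact zero_mem _
      | add s t _ _ hs ht => rw [smul_add]; exact add_mem hs ht
      | smul c s _ hs => rw [smul_comm]; exact Submodule.smul_mem _ c hs
  refine le_bot_iff.1 ((key (m + 1)).trans (Submodule.span_le.2 ?_))
  rintro _ ⟨l, t, hl, rfl⟩
  have : ¬ l.Nodup := fun h => by
    have := h.length_le_card
    simp [hl] at this
  rw [List.prod_map_eq_zero_of_anticomm C.odd_mul_self C.odd_anticomm this, zero_smul]
  exact zero_mem _

variable (D : SuperConnection E ⊤)

/-- The covariant derivative along the Euler vector field of the odd coordinates. -/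
def euler : E.sec U →ₗ[ℝ] E.sec U :=
  ∑ α, Algebra.lsmul ℝ ℝ (E.sec U) (C.odd α) ∘ₗ D.nabla U le_top (C.oddField α)

theorem euler_apply (s : E.sec U) :
    C.euler D s = ∑ α, C.odd α • D.nabla U le_top (C.oddField α) s := by
  simp [euler]

theorem euler_mem (s : E.sec U) : C.euler D s ∈ C.oddFiltration E 1 := by
  rw [euler_apply]
  exact sum_mem fun α _ => C.odd_smul_mem α (k := 0) Submodule.mem_top

theorem nabla_oddField_odd_smul (α β : Fin m) (s : E.sec U) :
    D.nabla U le_top (C.oddField β) (C.odd α • s) =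
      (if β = α then s else 0) - C.odd α • D.nabla U le_top (C.oddField β) s := by
  have h := D.nabla_smul_right U le_top 1 1 _ (C.oddField_mem β) _ (C.odd_mem α) s
  have h2 : applyField (C.oddField β) le_rfl (C.odd α) = if β = α then 1 else 0 := by
    refine (C.apply_coord (Sum.inr β) (Sum.inr α)).trans ?_
    simp only [Sum.inr.injEq]
  rw [h, h2]
  split_ifs <;> simp [koszul, sub_eq_add_neg]

/-- The Leibniz rule for ∇ along ∂/∂ξ^β; the sign from passing ξ^α through ∇ cancels the one from
exchanging ξ^β and ξ^α. Thus multiplication by ξ^α raises the degree measured by N by one. -/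
theorem euler_odd_smul (α : Fin m) (s : E.sec U) :
    C.euler D (C.odd α • s) = C.odd α • s + C.odd α • C.euler D s := by
  simp only [euler_apply, nabla_oddField_odd_smul, smul_sub, Finset.sum_sub_distrib,
    Finset.smul_sum]
  rw [sub_eq_add_neg, ← Finset.sum_neg_distrib]
  congr 1
  · rw [Finset.sum_eq_single α (fun β _ h => by simp [h]) (by simp), if_pos rfl]
  · refine Finset.sum_congr rfl fun β _ => ?_
    rw [smul_smul, smul_smul, C.odd_anticomm α β, neg_smul]

/-- By iteration of `euler_odd_smul`, N is multiplication by `k` on the `k`-th graded piece of the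
filtration. The integration in the odd directions rests on this. -/
theorem euler_sub_mem {k : ℕ} {s : E.sec U} (hs : s ∈ C.oddFiltration E k) :
    C.euler D s - (k : ℝ) • s ∈ C.oddFiltration E (k + 1) := by
  induction k generalizing s with
  | zero => simpa using C.euler_mem D s
  | succ k ih =>
    induction hs using Submodule.span_induction with
    | mem s hs =>
      obtain ⟨α, t, ht, rfl⟩ := hs
      have : C.euler D (C.odd α • t) - ((k + 1 : ℕ) : ℝ) • C.odd α • t =
          C.odd α • (C.euler D t - (k : ℝ) • t) := by
        rw [euler_odd_smul, smul_sub, smul_comm (C.odd α) (k : ℝ), Nat.cast_succ, add_smul,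
          one_smul]
        abel
      rw [this]
      exact C.odd_smul_mem α (ih ht)
    | zero => simp
    | add s t _ _ hs ht =>
      rw [map_add, smul_add, add_sub_add_comm]
      exact add_mem hs ht
    | smul c s _ hs =>
      rw [map_smul, smul_comm, ← smul_sub]
      exact Submodule.smul_mem _ c hs

/-- On the `k`-th graded piece N + c is multiplication by the non-zero number k + c, hence
injective. -/
theorem mem_succ_of_euler {k : ℕ} {c : ℝ} (hc : (k : ℝ) + c ≠ 0) {s : E.sec U}
    (hs : s ∈ C.oddFiltration E k) (h : C.euler D s + c • s ∈ C.oddFiltration E (k + 1)) :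
    s ∈ C.oddFiltration E (k + 1) := by
  have h1 : ((k : ℝ) + c) • s ∈ C.oddFiltration E (k + 1) := by
    have := sub_mem h (C.euler_sub_mem D hs)
    convert this using 1
    rw [add_smul]
    abel
  exact (Submodule.smul_mem_iff _ hc).1 h1

/-- A family of sections that is stable, up to higher order, under the Euler derivation vanishes
if it vanishes to sufficiently high order. -/
theorem eq_zero_of_euler {ι : Type*} {S : ι → E.sec U} {c : ℝ} {k₀ : ℕ} (hc : 0 < (k₀ : ℝ) + c)
    (h₀ : ∀ i, S i ∈ C.oddFiltration E k₀)
    (step : ∀ k, (∀ i, S i ∈ C.oddFiltration E k) →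
      ∀ i, C.euler D (S i) + c • S i ∈ C.oddFiltration E (k + 1)) (i : ι) : S i = 0 := by
  have key : ∀ k, ∀ i, S i ∈ C.oddFiltration E (k₀ + k) := by
    intro k
    induction k with
    | zero => exact h₀
    | succ k ih =>
      intro i
      refine C.mem_succ_of_euler D ?_ (ih i) (step _ ih i)
      have h1 : (0 : ℝ) ≤ k := k.cast_nonneg
      have h2 : ((k₀ + k : ℕ) : ℝ) = k₀ + k := Nat.cast_add _ _
      have h3 : 0 < ((k₀ + k : ℕ) : ℝ) + c := by rw [h2]; linarith
      exact h3.ne'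
  have := C.oddFiltration_antitone (by omega : m + 1 ≤ k₀ + (m + 1)) (key (m + 1) i)
  rw [oddFiltration_eq_bot] at this
  exact this

/-- If N X is in step k + 1, then N multiplies it by k + 1 up to the next step, so replacing X by X
- N X/(k + 1) raises the order of N X. After `m` corrections N X is zero. The corrections lie in
step 1 and do not affect values at points. -/
theorem exists_euler_eq_zero (X₀ : E.sec U) :
    ∃ X : E.sec U, X - X₀ ∈ C.oddFiltration E 1 ∧ C.euler D X = 0 := by
  have key : ∀ k, ∃ X : E.sec U, X - X₀ ∈ C.oddFiltration E 1 ∧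
      C.euler D X ∈ C.oddFiltration E (k + 1) := by
    intro k
    induction k with
    | zero => exact ⟨X₀, by simp, C.euler_mem D X₀⟩
    | succ k ih =>
      obtain ⟨X, hX, hN⟩ := ih
      have hk : ((k + 1 : ℕ) : ℝ) ≠ 0 := by positivity
      refine ⟨X - ((k + 1 : ℕ) : ℝ)⁻¹ • C.euler D X, ?_, ?_⟩
      · rw [sub_right_comm]
        exact sub_mem hX (Submodule.smul_mem _ _ (C.euler_mem D X))
      · have := Submodule.smul_mem _ (-((k + 1 : ℕ) : ℝ)⁻¹) (C.euler_sub_mem D hN)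
        convert this using 1
        rw [map_sub, map_smul, smul_sub, smul_smul, neg_mul, inv_mul_cancel₀ hk, neg_smul, neg_smul,
          one_smul]
        abel
  obtain ⟨X, hX, hN⟩ := key m
  rw [oddFiltration_eq_bot] at hN
  exact ⟨X, hX, hN⟩

/-- The covariant derivatives of the curvature along odd coordinate vector fields, on coordinate
vector fields. -/
def curvDeriv {r : ℕ} (T : Fin r → Fin m) (b a : Fin n ⊕ Fin m) : E.sec U → E.sec U :=
  D.curvatureDeriv C.flat r (fun k => C.homField (Sum.inr (T k))) (C.homField b) (C.homField a)

/-- Every correction term contains ∇̄ of one coordinate field along another, zero for `flat`; only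
the supercommutator with ∇ is left. -/
theorem curvDeriv_cons {r : ℕ} (α : Fin m) (T : Fin r → Fin m) (b a : Fin n ⊕ Fin m)
    (X : E.sec U) : C.curvDeriv D (Fin.cons α T : Fin (r + 1) → Fin m) b a X =
      D.nabla U le_top (C.oddField α) (C.curvDeriv D T b a X) -
        koszul 1 (∑ k, (C.homField (Sum.inr (T k))).deg + (C.homField b).deg + (C.homField a).deg) •
          C.curvDeriv D T b a (D.nabla U le_top (C.oddField α) X) := by
  have ht : Fin.tail (fun k => C.homField (Sum.inr ((Fin.cons α T : Fin (r + 1) → Fin m) k))) =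
      fun k => C.homField (Sum.inr (T k)) := by
    funext k
    simp [Fin.tail]
  have h0 : C.homField (Sum.inr ((Fin.cons α T : Fin (r + 1) → Fin m) 0)) =
      C.homField (Sum.inr α) := by simp
  have hz := D.curvatureDeriv_eq_zero_of_field C.flat (r := r)
  rw [curvDeriv, D.curvatureDeriv_succ, ht, h0,
    hz _ (SuperConnection.homNabla C.flat _ (C.homField b)) _ _
      (Or.inr (Or.inl (C.flat_homField _ _))),
    hz _ _ (SuperConnection.homNabla C.flat _ (C.homField a)) _
      (Or.inr (Or.inr (C.flat_homField _ _))),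
    Finset.sum_eq_zero fun l _ => by
      rw [hz _ _ _ _ (Or.inl ⟨l, by
        rw [Function.update_self]; exact C.flat_homField _ _⟩), smul_zero]]
  simp only [smul_zero, sub_zero]
  rfl

/-- In the sum against ξ^α, tensoriality moves ξ^α inside the second half of the supercommutator,
which becomes the curvature derivative applied to N X = 0. -/
theorem euler_curvDeriv {X : E.sec U} (hX : C.euler D X = 0) {r : ℕ} (T : Fin r → Fin m)
    (b a : Fin n ⊕ Fin m) : C.euler D (C.curvDeriv D T b a X) =
      ∑ α, C.odd α • C.curvDeriv D (Fin.cons α T : Fin (r + 1) → Fin m) b a X := by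
  set d := ∑ k, (C.homField (Sum.inr (T k))).deg + (C.homField b).deg + (C.homField a).deg with hd
  have h1 : ∑ α, C.odd α • (koszul 1 d • C.curvDeriv D T b a
      (D.nabla U le_top (C.oddField α) X)) = 0 := by
    have h2 : ∀ α, C.odd α • (koszul 1 d • C.curvDeriv D T b a
        (D.nabla U le_top (C.oddField α) X)) = C.curvDeriv D T b a
          (C.odd α • D.nabla U le_top (C.oddField α) X) := fun α => by
      rw [curvDeriv, D.curvatureDeriv_smul C.flat _ _ _ (C.odd_mem α), ← hd, koszul_comm,
        smul_comm]
    rw [Finset.sum_congr rfl fun α _ => h2 α]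
    refine (map_sum (D.curvatureHom C.flat (fun k => C.homField (Sum.inr (T k)))
      (C.homField b) (C.homField a)) _ _).symm.trans ?_
    rw [← euler_apply, hX, map_zero]
  rw [euler_apply]
  simp only [curvDeriv_cons, smul_sub, Finset.sum_sub_distrib, ← hd]
  rw [h1, sub_zero]

/-- A section that is parallel along the odd Euler field, whose underlying section is parallel and
annihilated by the covariant derivatives of the curvature, is parallel. -/
theorem nabla_eq_zero {X : E.sec U} (hX : C.euler D X = 0)
    (hcurv : ∀ (r : ℕ) (T : Fin r → Fin m) (b a : Fin n ⊕ Fin m),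
      C.curvDeriv D T b a X ∈ C.oddFiltration E 1)
    (heven : ∀ i, D.nabla U le_top (C.field (Sum.inl i)) X ∈ C.oddFiltration E 1)
    (a : Fin n ⊕ Fin m) : D.nabla U le_top (C.field a) X = 0 := by
  -- All orders of derivatives form one family, since N of a derivative of order r involves those of
  -- order r + 1. If the family lies in step k, then N of each member lies in step k + 1.
  have hS : ∀ i : (Σ r : ℕ, Fin r → Fin m) × (Fin n ⊕ Fin m) × (Fin n ⊕ Fin m),
      C.curvDeriv D i.1.2 i.2.1 i.2.2 X = 0 := by
    refine C.eq_zero_of_euler D (k₀ := 1) (c := 0) (by norm_num) (fun i => hcurv _ _ _ _) ?_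
    intro k hk i
    rw [zero_smul, add_zero, C.euler_curvDeriv D hX]
    exact sum_mem fun α _ => C.odd_smul_mem α (hk ⟨⟨_, Fin.cons α i.1.2⟩, i.2⟩)
  -- The members of order zero are R(∂_α, ∂_a) X; as coordinate fields commute, their vanishing lets
  -- the two covariant derivatives be exchanged.
  have hR : ∀ α, D.nabla U le_top (C.oddField α) (D.nabla U le_top (C.field a) X) =
      koszul 1 (coordDeg a) • D.nabla U le_top (C.field a)
        (D.nabla U le_top (C.oddField α) X) := fun α => by
    have h1 : D.curvature (C.homField (Sum.inr α)) (C.homField a) X = 0 :=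
      hS ⟨⟨0, Fin.elim0⟩, Sum.inr α, a⟩
    rw [SuperConnection.curvature, C.bracket_eq_zero, map_zero, LinearMap.zero_apply, sub_zero,
      sub_eq_zero] at h1
    exact h1
  have hder : ∀ α, C.odd α • D.nabla U le_top (C.oddField α) (D.nabla U le_top (C.field a) X) =
      D.nabla U le_top (C.field a) (C.odd α • D.nabla U le_top (C.oddField α) X) -
        (if a = Sum.inr α then D.nabla U le_top (C.field a) X else 0) := fun α => by
    have h2 : applyField (C.field a) le_rfl (C.odd α) = if a = Sum.inr α then 1 else 0 :=
      C.apply_coord a (Sum.inr α)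
    rw [hR, D.nabla_smul_right U le_top _ _ _ (C.field_mem a) _ (C.odd_mem α), h2,
      koszul_comm, smul_comm]
    split_ifs with h
    · subst h
      rw [one_smul]
      exact (add_sub_cancel_left _ _).symm
    · simp
  -- Since ∇_a (N X) = 0, the section ∇_a X satisfies the eigenvector equation of N with eigenvalue
  -- 0 for even a and -1 for odd a.
  have hN : C.euler D (D.nabla U le_top (C.field a) X) +
      (∑ α, if a = Sum.inr α then (1 : ℝ) else 0) • D.nabla U le_top (C.field a) X = 0 := by
    rw [euler_apply, Finset.sum_congr rfl fun α _ => hder α, Finset.sum_sub_distrib, ← map_sum,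
      ← euler_apply, hX, map_zero, zero_sub, Finset.sum_smul]
    simp
  rcases a with i | α
  -- Eigenvalue 0 is excluded only from step 1 on, and here `heven` is needed. In the odd case
  -- eigenvalue -1 is excluded already in step 0, without any hypothesis on values.
  · exact C.eq_zero_of_euler D (ι := Unit) (S := fun _ => D.nabla U le_top (C.field _) X)
      (k₀ := 1) (c := 0) (by norm_num) (fun _ => heven i)
      (fun k _ _ => by simp at hN; simp [hN]) ()
  · refine C.eq_zero_of_euler D (ι := Unit) (S := fun _ => D.nabla U le_top (C.field _) X)
      (k₀ := 0) (c := 1) (by norm_num) (fun _ => Submodule.mem_top)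
      (fun k _ _ => by
        have : (∑ β, if (Sum.inr α : Fin n ⊕ Fin m) = Sum.inr β then (1 : ℝ) else 0) = 1 := by simp
        rw [this] at hN
        rw [hN]
        exact zero_mem _) ()

theorem nabla_res_eq_zero {X : E.sec U} (hX : ∀ a, D.nabla U le_top (C.field a) X = 0)
    {V : Opens M} (h : V ≤ U) (Y : 𝒮.tangent.sec V) :
    D.nabla V le_top Y (E.res h X) = 0 := by
  rw [C.eq_sum h Y, map_sum, LinearMap.sum_apply]
  refine Finset.sum_eq_zero fun a _ => ?_
  rw [D.nabla_smul_left, ← D.nabla_res U V le_top h, hX, map_zero, smul_zero]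

/-- A parallel section satisfies N X = 0, and N is injective on step 1. -/
theorem eq_zero_of_parallel {X : E.sec U} (hX : ∀ Y, D.nabla U le_top Y X = 0)
    (h : X ∈ C.oddFiltration E 1) : X = 0 :=
  C.eq_zero_of_euler D (ι := Unit) (S := fun _ => X) (k₀ := 1) (c := 0) (by norm_num)
    (fun _ => h) (fun k _ _ => by simp [euler_apply, hX]) ()

end CoordSystem

end

/-! ### Frames, and the coordinates they give on fibres. -/

noncomputable section

open SuperalgebraSheaf

/-! ### Frames -/

namespace SupermodulePresheaf

section Frames

variable {M : Type u} [TopologicalSpace M] {𝒪 : SuperalgebraSheaf.{u, v} M}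
  {E : SupermodulePresheaf.{u, v, w} 𝒪}

theorem isCompl_par (E : SupermodulePresheaf.{u, v, w} 𝒪) (U : Opens M) :
    IsCompl (E.par U 0) (E.par U 1) :=
  (DirectSum.isInternal_submodule_iff_isCompl (E.par U) (i := 0) (j := 1)
    (by decide) (by ext i; revert i; decide)).1 (E.par_isInternal U)

theorem exists_add {U : Opens M} (s : E.sec U) :
    ∃ s₀ ∈ E.par U 0, ∃ s₁ ∈ E.par U 1, s₀ + s₁ = s :=
  Submodule.mem_sup.1 ((E.isCompl_par U).sup_eq_top ▸ Submodule.mem_top)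

theorem eq_zero_of_mem {U : Opens M} {s : E.sec U} {i : ZMod 2}
    (h₀ : s ∈ E.par U i) (h₁ : s ∈ E.par U (1 + i)) : s = 0 := by
  obtain rfl | rfl := ZMod.two_cases i
  · exact Submodule.disjoint_def.1 (E.isCompl_par U).disjoint s h₀ h₁
  · exact Submodule.disjoint_def.1 (E.isCompl_par U).disjoint s h₁ h₀

namespace IsFrame

variable {p q : ℕ} {W : Opens M} {e : Fin p ⊕ Fin q → E.sec W} (he : E.IsFrame W e)

theorem mem (he : E.IsFrame W e) (A : Fin p ⊕ Fin q) : e A ∈ E.par W (coordDeg A) := by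
  rcases A with I | Φ
  · exact he.even I
  · exact he.odd Φ

theorem restrict (he : E.IsFrame W e) {V : Opens M} (h : V ≤ W) :
    E.IsFrame V fun A => E.res h (e A) where
  even I := E.res_mem h (he.even I)
  odd Φ := E.res_mem h (he.odd Φ)
  linearIndependent V' h' := by
    simpa only [E.res_res] using he.linearIndependent V' (h'.trans h)
  span_eq_top V' h' := by
    simpa only [E.res_res] using he.span_eq_top V' (h'.trans h)

/-- The basis of the sections over a smaller open set given by a frame. -/
def basis {V : Opens M} (h : V ≤ W) : Module.Basis (Fin p ⊕ Fin q) (𝒪.sec V) (E.sec V) :=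
  Module.Basis.mk (he.linearIndependent V h) (he.span_eq_top V h).ge

theorem basis_apply {V : Opens M} (h : V ≤ W) (A : Fin p ⊕ Fin q) :
    he.basis h A = E.res h (e A) := by
  rw [basis, Module.Basis.mk_apply]

/-- The coefficients of a section in a frame. -/
def coef {V : Opens M} (h : V ≤ W) (s : E.sec V) (A : Fin p ⊕ Fin q) : 𝒪.sec V :=
  (he.basis h).repr s A

theorem sum_coef {V : Opens M} (h : V ≤ W) (s : E.sec V) :
    ∑ A, he.coef h s A • E.res h (e A) = s := by
  simp_rw [← he.basis_apply h]
  exact (he.basis h).sum_repr s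

theorem coef_unique {V : Opens M} (h : V ≤ W) {s : E.sec V} {f : Fin p ⊕ Fin q → 𝒪.sec V}
    (hs : s = ∑ A, f A • E.res h (e A)) : he.coef h s = f := by
  simp_rw [← he.basis_apply h] at hs
  funext A
  rw [hs, coef, Module.Basis.repr_sum_self]

theorem coef_add {V : Opens M} (h : V ≤ W) (s t : E.sec V) (A : Fin p ⊕ Fin q) :
    he.coef h (s + t) A = he.coef h s A + he.coef h t A := by
  simp [coef]

theorem coef_real_smul {V : Opens M} (h : V ≤ W) (c : ℝ) (s : E.sec V) (A : Fin p ⊕ Fin q) :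
    he.coef h (c • s) A = c • he.coef h s A := by
  rw [← algebraMap_smul (𝒪.sec V) c s, coef, map_smul, Finsupp.smul_apply, algebraMap_smul]
  rfl

theorem coef_smul {V : Opens M} (h : V ≤ W) (f : 𝒪.sec V) (s : E.sec V) (A : Fin p ⊕ Fin q) :
    he.coef h (f • s) A = f * he.coef h s A := by
  simp [coef]

theorem coef_res {V V' : Opens M} (h : V ≤ W) (h' : V' ≤ V) (s : E.sec V) (A : Fin p ⊕ Fin q) :
    he.coef (h'.trans h) (E.res h' s) A = 𝒪.res h' (he.coef h s A) := by
  refine congrFun (he.coef_unique (f := fun A => 𝒪.res h' (he.coef h s A)) (h'.trans h) ?_) A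
  conv_lhs => rw [← he.sum_coef h s]
  simp only [map_sum, E.res_smul, E.res_res]

theorem coef_frame (A B : Fin p ⊕ Fin q) {V : Opens M} (h : V ≤ W) :
    he.coef h (E.res h (e A)) B = if A = B then 1 else 0 := by
  rw [← he.basis_apply h, coef, Module.Basis.repr_self, Finsupp.single_apply]

/-- Each coefficient is split into the part of the expected parity and the rest. The rest
contributes a section of the opposite parity that is also a difference of sections of parity `i`,
hence zero; coefficients in a frame being unique, the expected parts are the coefficients. -/
theorem coef_mem {V : Opens M} (h : V ≤ W) {i : ZMod 2} {s : E.sec V} (hs : s ∈ E.par V i)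
    (A : Fin p ⊕ Fin q) : he.coef h s A ∈ 𝒪.par V (i + coordDeg A) := by
  have hdec : ∀ A, ∃ f ∈ 𝒪.par V (i + coordDeg A), ∃ g ∈ 𝒪.par V (1 + (i + coordDeg A)),
      f + g = he.coef h s A := fun A => by
    obtain ⟨f₀, h₀, f₁, h₁, hf⟩ := 𝒪.exists_add V (he.coef h s A)
    rcases ZMod.two_cases (i + coordDeg A) with hA | hA <;> rw [hA]
    · exact ⟨f₀, h₀, f₁, h₁, hf⟩
    · exact ⟨f₁, h₁, f₀, h₀, by rw [add_comm, hf]⟩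
  choose f hf g hg hfg using hdec
  have h2 : ∀ i j : ZMod 2, i + j + j = i := by decide
  have hs1 : ∑ A, f A • E.res h (e A) ∈ E.par V i := sum_mem fun A _ => by
    have := E.smul_mem (hf A) (E.res_mem h (he.mem A))
    rwa [h2] at this
  have hs2 : ∑ A, g A • E.res h (e A) ∈ E.par V (1 + i) := sum_mem fun A _ => by
    have := E.smul_mem (hg A) (E.res_mem h (he.mem A))
    rwa [← add_assoc, h2] at this
  have hsum : s = ∑ A, f A • E.res h (e A) + ∑ A, g A • E.res h (e A) := by
    conv_lhs => rw [← he.sum_coef h s]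
    rw [← Finset.sum_add_distrib]
    exact Finset.sum_congr rfl fun A _ => by rw [← add_smul, hfg]
  have hz : ∑ A, g A • E.res h (e A) = 0 := by
    refine eq_zero_of_mem (i := i) ?_ hs2
    rw [show ∑ A, g A • E.res h (e A) = s - ∑ A, f A • E.res h (e A) by rw [hsum]; abel]
    exact sub_mem hs hs1
  rw [he.coef_unique h (f := f) (by rw [hsum, hz, add_zero])]
  exact hf A

end IsFrame

end Frames

/-! ### Fibres -/

section Fibres

variable {n m : ℕ} {M : Type u} [TopologicalSpace M] [ChartedSpace (EuclideanSpace ℝ (Fin n)) M]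
  {𝒮 : Supermanifold.{u, v} n m M} {E : SupermodulePresheaf.{u, v, w} 𝒮.toSuperalgebraSheaf}

theorem germ_res {V V' : Opens M} (h : V' ≤ V) {x : M} (hx : x ∈ V') (s : E.sec V) :
    E.germ x hx (E.res h s) = E.germ x (h hx) s := by
  classical
  exact Module.DirectLimit.of_f (R := ℝ) (ι := OpenNhd x)
    (G := fun V : OpenNhd x => E.sec (OrderDual.ofDual V).1) (f := fun _ _ h => E.res h)
    (i := OrderDual.toDual ⟨V, h hx⟩) (j := OrderDual.toDual ⟨V', hx⟩) (hij := h) (x := s)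

theorem eval_res {V V' : Opens M} (h : V' ≤ V) {x : M} (hx : x ∈ V') (s : E.sec V) :
    E.eval x hx (E.res h s) = E.eval x (h hx) s := by
  simp [eval, germ_res]

/-- The superfunction f - f(x) vanishes at x, so its products die in the fibre. -/
theorem eval_smul {V : Opens M} {x : M} (hx : x ∈ V) (f : 𝒮.sec V) (s : E.sec V) :
    E.eval x hx (f • s) = 𝒮.value x hx f • E.eval x hx s := by
  rw [← map_smul, ← algebraMap_smul (𝒮.sec V) (𝒮.value x hx f) s, ← sub_eq_zero, ← map_sub,
    ← sub_smul]
  refine (Submodule.Quotient.mk_eq_zero _).2 (Submodule.subset_span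
    ⟨V, hx, f - algebraMap ℝ _ (𝒮.value x hx f), s, ?_, rfl⟩)
  rw [map_sub, AlgHom.commutes]
  simp

theorem exists_eval_eq {x : M} (a : E.Fibre x) :
    ∃ (V : Opens M) (hx : x ∈ V) (s : E.sec V), E.eval x hx s = a := by
  classical
  obtain ⟨g, rfl⟩ := Submodule.Quotient.mk_surjective _ a
  have : Nonempty (OpenNhd x) := ⟨OrderDual.toDual ⟨⊤, Opens.mem_top x⟩⟩
  have : IsDirectedOrder (OpenNhd x) := ⟨fun V V' => ⟨OrderDual.toDual
    ⟨(OrderDual.ofDual V).1 ⊓ (OrderDual.ofDual V').1, (OrderDual.ofDual V).2,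
      (OrderDual.ofDual V').2⟩,
    show (OrderDual.ofDual V).1 ⊓ (OrderDual.ofDual V').1 ≤ (OrderDual.ofDual V).1 from inf_le_left,
    show (OrderDual.ofDual V).1 ⊓ (OrderDual.ofDual V').1 ≤ (OrderDual.ofDual V').1 from
      inf_le_right⟩⟩
  obtain ⟨V, s, rfl⟩ := Module.DirectLimit.exists_of g
  exact ⟨(OrderDual.ofDual V).1, (OrderDual.ofDual V).2, s, rfl⟩

namespace IsFrame

variable {p q : ℕ} {W : Opens M} {e : Fin p ⊕ Fin q → E.sec W} (he : E.IsFrame W e)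

/-- The coordinates of the value of a section at a point in a frame. -/
def valueCoef {V : Opens M} (x : M) (hx : x ∈ V) (hW : x ∈ W) :
    E.sec V →ₗ[ℝ] (Fin p ⊕ Fin q → ℝ) where
  toFun s A := 𝒮.value x (Opens.mem_inf.2 ⟨hx, hW⟩ : x ∈ V ⊓ W)
    (he.coef inf_le_right (E.res (inf_le_left : V ⊓ W ≤ V) s) A)
  map_add' s t := by
    funext A
    rw [map_add, he.coef_add, map_add]
    rfl
  map_smul' c s := by
    funext A
    rw [map_smul, he.coef_real_smul, map_smul]
    rfl

theorem valueCoef_of_le {V : Opens M} {x : M} (hx : x ∈ V) (hV : V ≤ W) (s : E.sec V)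
    (A : Fin p ⊕ Fin q) :
    he.valueCoef x hx (hV hx) s A = 𝒮.value x hx (he.coef hV s A) := by
  rw [← 𝒮.value_res (inf_le_left : V ⊓ W ≤ V) (Opens.mem_inf.2 ⟨hx, hV hx⟩ : x ∈ V ⊓ W),
    ← he.coef_res hV]
  rfl

theorem valueCoef_res {V V' : Opens M} (h : V' ≤ V) {x : M} (hx : x ∈ V') (hW : x ∈ W)
    (s : E.sec V) : he.valueCoef x hx hW (E.res h s) = he.valueCoef x (h hx) hW s := by
  funext A
  change 𝒮.value x (Opens.mem_inf.2 ⟨hx, hW⟩ : x ∈ V' ⊓ W) (he.coef _ (E.res _ (E.res h s)) A) =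
    𝒮.value x (Opens.mem_inf.2 ⟨h hx, hW⟩ : x ∈ V ⊓ W) (he.coef _ (E.res _ s) A)
  rw [E.res_res, ← E.res_res inf_le_left (inf_le_inf_right W h),
    he.coef_res inf_le_right (inf_le_inf_right W h), 𝒮.value_res]

open Classical in
/-- The coordinates of the value of a germ in a frame. -/
def stalkCoef (x : M) (hW : x ∈ W) : E.Stalk x →ₗ[ℝ] (Fin p ⊕ Fin q → ℝ) :=
  Module.DirectLimit.lift ℝ (OpenNhd x) (fun V : OpenNhd x => E.sec (OrderDual.ofDual V).1)
    (fun _ _ h => E.res h) (fun V => he.valueCoef x (OrderDual.ofDual V).2 hW)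
    fun _ _ h s => he.valueCoef_res h _ hW s

theorem stalkCoef_germ {V : Opens M} {x : M} (hx : x ∈ V) (hW : x ∈ W) (s : E.sec V) :
    he.stalkCoef x hW (E.germ x hx s) = he.valueCoef x hx hW s := by
  classical
  exact Module.DirectLimit.lift_of (R := ℝ) (ι := OpenNhd x)
    (G := fun V : OpenNhd x => E.sec (OrderDual.ofDual V).1) (f := fun _ _ h => E.res h)
    (fun V => he.valueCoef x (OrderDual.ofDual V).2 hW)
    (fun _ _ h s => he.valueCoef_res h _ hW s) (i := OrderDual.toDual ⟨V, hx⟩) s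

/-- The coordinates in the fibre given by a frame. -/
def fibreCoef (x : M) (hW : x ∈ W) : E.Fibre x →ₗ[ℝ] (Fin p ⊕ Fin q → ℝ) :=
  Submodule.liftQ _ (he.stalkCoef x hW) (by
    refine Submodule.span_le.2 ?_
    rintro _ ⟨V, hx, f, s, hf, rfl⟩
    refine (he.stalkCoef_germ hx hW _).trans ?_
    funext A
    change 𝒮.value x (Opens.mem_inf.2 ⟨hx, hW⟩ : x ∈ V ⊓ W) (he.coef _ (E.res _ (f • s)) A) = 0
    rw [E.res_smul, he.coef_smul, map_mul, 𝒮.value_res, hf, zero_mul])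

theorem fibreCoef_eval {V : Opens M} {x : M} (hx : x ∈ V) (hV : V ≤ W) (s : E.sec V)
    (A : Fin p ⊕ Fin q) :
    he.fibreCoef x (hV hx) (E.eval x hx s) A = 𝒮.value x hx (he.coef hV s A) := by
  rw [← he.valueCoef_of_le]
  exact congrFun (he.stalkCoef_germ hx (hV hx) s) A

theorem eval_eq_sum {V : Opens M} {x : M} (hx : x ∈ V) (hV : V ≤ W) (s : E.sec V) :
    E.eval x hx s = ∑ A, 𝒮.value x hx (he.coef hV s A) • E.eval x (hV hx) (e A) := by
  conv_lhs => rw [← he.sum_coef hV s]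
  rw [map_sum]
  exact Finset.sum_congr rfl fun A _ => by rw [eval_smul, eval_res]

/-- The isomorphism of the fibre with `ℝ^{p+q}` given by a frame. -/
def fibreEquiv (x : M) (hW : x ∈ W) : E.Fibre x ≃ₗ[ℝ] (Fin p ⊕ Fin q → ℝ) :=
  { he.fibreCoef x hW with
    invFun := fun c => ∑ A, c A • E.eval x hW (e A)
    left_inv := fun a => by
      obtain ⟨V, hx, s, rfl⟩ := exists_eval_eq a
      rw [← eval_res (inf_le_left : V ⊓ W ≤ V) (Opens.mem_inf.2 ⟨hx, hW⟩ : x ∈ V ⊓ W)]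
      change ∑ A, he.fibreCoef x hW _ A • _ = _
      conv_rhs => rw [he.eval_eq_sum (Opens.mem_inf.2 ⟨hx, hW⟩ : x ∈ V ⊓ W) inf_le_right]
      refine Finset.sum_congr rfl fun A _ => ?_
      rw [← he.fibreCoef_eval (Opens.mem_inf.2 ⟨hx, hW⟩ : x ∈ V ⊓ W) inf_le_right]
    right_inv := fun c => by
      funext B
      change he.fibreCoef x hW (∑ A, c A • E.eval x hW (e A)) B = c B
      rw [map_sum, Finset.sum_apply, Finset.sum_eq_single B]
      · rw [map_smul, Pi.smul_apply, he.fibreCoef_eval hW le_rfl]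
        have := he.coef_frame B B le_rfl
        rw [E.res_refl, if_pos rfl] at this
        rw [this, map_one, smul_eq_mul, mul_one]
      · intro A _ hA
        rw [map_smul, Pi.smul_apply, he.fibreCoef_eval hW le_rfl]
        have := he.coef_frame A B le_rfl
        rw [E.res_refl, if_neg hA] at this
        rw [this, map_zero, smul_zero]
      · simp }

theorem fibreEquiv_eval {V : Opens M} {x : M} (hx : x ∈ V) (hV : V ≤ W) (s : E.sec V)
    (A : Fin p ⊕ Fin q) :
    he.fibreEquiv x (hV hx) (E.eval x hx s) A = 𝒮.value x hx (he.coef hV s A) :=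
  he.fibreCoef_eval hx hV s A

theorem fibreEquiv_symm_apply {x : M} (hW : x ∈ W) (c : Fin p ⊕ Fin q → ℝ) :
    (he.fibreEquiv x hW).symm c = ∑ A, c A • E.eval x hW (e A) := rfl

end IsFrame

end Fibres

end SupermodulePresheaf

namespace CoordSystem

variable {n m : ℕ} {M : Type u} [TopologicalSpace M] [ChartedSpace (EuclideanSpace ℝ (Fin n)) M]
  {𝒮 : Supermanifold.{u, v} n m M}
  {φ : OpenPartialHomeomorph M (EuclideanSpace ℝ (Fin n))} {U : Opens M} (C : CoordSystem 𝒮 φ U)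
  {E : SupermodulePresheaf.{u, v, w} 𝒮.toSuperalgebraSheaf}

theorem eval_eq_zero_of_mem {s : E.sec U} (hs : s ∈ C.oddFiltration E 1) {x : M} (hx : x ∈ U) :
    E.eval x hx s = 0 := by
  induction hs using Submodule.span_induction with
  | mem s hs =>
    obtain ⟨α, t, -, rfl⟩ := hs
    rw [SupermodulePresheaf.eval_smul, 𝒮.value_of_odd hx (C.odd_mem α), zero_smul]
  | zero => exact map_zero _
  | add s t _ _ hs ht => rw [map_add, hs, ht, add_zero]
  | smul c s _ hs => rw [map_smul, hs, smul_zero]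

/-- The frame coefficients of `s` have value zero everywhere, hence lie in the ideal of the odd
coordinates. With `eval_eq_zero_of_mem`, this identifies step 1 of the filtration with the sections
whose values all vanish. -/
theorem mem_of_eval_eq_zero {p q : ℕ} {e : Fin p ⊕ Fin q → E.sec U} (he : E.IsFrame U e)
    {s : E.sec U} (hs : ∀ x (hx : x ∈ U), E.eval x hx s = 0) : s ∈ C.oddFiltration E 1 := by
  rw [← he.sum_coef le_rfl s]
  refine sum_mem fun A _ => ?_
  obtain ⟨g, hg⟩ := C.exists_eq_sum le_rfl (he.coef le_rfl s A) fun x hx => by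
    rw [← he.fibreEquiv_eval hx le_rfl, hs, map_zero]
    rfl
  rw [hg, Finset.sum_smul]
  refine sum_mem fun α _ => ?_
  rw [𝒮.res_refl, mul_smul]
  exact C.odd_smul_mem α (k := 0) Submodule.mem_top

end CoordSystem

end

/-! ### Parity in the fibres, annihilators, and curvature operators on fibres. -/

noncomputable section

open SuperalgebraSheaf

/-! ### The grading of the fibres -/

namespace SupermodulePresheaf

variable {n m : ℕ} {M : Type u} [TopologicalSpace M] [ChartedSpace (EuclideanSpace ℝ (Fin n)) M]
  {𝒮 : Supermanifold.{u, v} n m M} {E : SupermodulePresheaf.{u, v, w} 𝒮.toSuperalgebraSheaf}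

theorem eval_mem_fibrePar {V : Opens M} {x : M} (hx : x ∈ V) {i : ZMod 2} {s : E.sec V}
    (hs : s ∈ E.par V i) : E.eval x hx s ∈ E.fibrePar x i :=
  Submodule.subset_span ⟨V, hx, s, hs, rfl⟩

/-- The coefficient of a homogeneous section along a frame member of the other parity is odd, so its
value is zero. -/
theorem IsFrame.fibreEquiv_eq_zero {p q : ℕ} {W : Opens M} {e : Fin p ⊕ Fin q → E.sec W}
    (he : E.IsFrame W e) {x : M} (hW : x ∈ W) {i : ZMod 2} {a : E.Fibre x}
    (ha : a ∈ E.fibrePar x i) {A : Fin p ⊕ Fin q} (hA : i + coordDeg A = 1) :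
    he.fibreEquiv x hW a A = 0 := by
  induction ha using Submodule.span_induction with
  | mem a ha =>
    obtain ⟨V, hx, s, hs, rfl⟩ := ha
    rw [← eval_res (inf_le_left : V ⊓ W ≤ V) (Opens.mem_inf.2 ⟨hx, hW⟩ : x ∈ V ⊓ W),
      he.fibreEquiv_eval (Opens.mem_inf.2 ⟨hx, hW⟩ : x ∈ V ⊓ W) inf_le_right]
    refine 𝒮.value_of_odd _ ?_
    rw [← hA]
    exact he.coef_mem _ (E.res_mem _ hs) A
  | zero => rw [map_zero]; rfl
  | add a b _ _ ha hb => rw [map_add, Pi.add_apply, ha, hb, add_zero]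
  | smul c a _ ha => rw [map_smul, Pi.smul_apply, ha, smul_zero]

theorem IsFrame.isCompl_fibrePar {p q : ℕ} {W : Opens M} {e : Fin p ⊕ Fin q → E.sec W}
    (he : E.IsFrame W e) {x : M} (hW : x ∈ W) :
    IsCompl (E.fibrePar x 0) (E.fibrePar x 1) := by
  constructor
  · rw [Submodule.disjoint_def]
    intro a h₀ h₁
    refine (he.fibreEquiv x hW).map_eq_zero_iff.1 (funext fun A => ?_)
    rcases ZMod.two_cases (coordDeg A) with hA | hA
    · exact he.fibreEquiv_eq_zero hW h₁ (by rw [hA]; decide)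
    · exact he.fibreEquiv_eq_zero hW h₀ (by rw [hA]; decide)
  · rw [codisjoint_iff, eq_top_iff]
    intro a _
    obtain ⟨V, hx, s, rfl⟩ := exists_eval_eq a
    obtain ⟨s₀, h₀, s₁, h₁, rfl⟩ := E.exists_add s
    rw [map_add]
    exact Submodule.add_mem_sup (eval_mem_fibrePar hx h₀) (eval_mem_fibrePar hx h₁)

/-- The annihilator of a pair of homogeneous vectors is a Lie supersubalgebra. -/
theorem isLieSupersubalgebra_annihilator {x : M}
    (h : IsCompl (E.fibrePar x 0) (E.fibrePar x 1)) {a₀ a₁ : E.Fibre x}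
    (h₀ : a₀ ∈ E.fibrePar x 0) (h₁ : a₁ ∈ E.fibrePar x 1)
    (L : Submodule ℝ (Module.End ℝ (E.Fibre x))) (hL : ∀ A, A ∈ L ↔ A a₀ = 0 ∧ A a₁ = 0) :
    E.IsLieSupersubalgebra x L where
  graded := by
    refine le_antisymm (sup_le inf_le_left inf_le_left) fun A hA => ?_
    obtain ⟨hA₀, hA₁⟩ := (hL A).1 hA
    -- With P and Q the projections to the even and odd part, A has even part P A P + Q A Q and odd
    -- part Q A P + P A Q. Both kill `a₀` and `a₁`, because P and Q fix or kill these homogeneous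
    -- vectors.
    set P := (E.fibrePar x 0).projection (E.fibrePar x 1) h with hP
    set Q := (E.fibrePar x 1).projection (E.fibrePar x 0) h.symm with hQ
    have hPm : ∀ v, P v ∈ E.fibrePar x 0 := Submodule.projection_apply_mem h
    have hQm : ∀ v, Q v ∈ E.fibrePar x 1 := Submodule.projection_apply_mem h.symm
    have hP0 : ∀ v ∈ E.fibrePar x 0, P v = v := fun v hv =>
      Submodule.projection_apply_left h ⟨v, hv⟩
    have hP1 : ∀ v ∈ E.fibrePar x 1, P v = 0 := fun v hv =>
      (Submodule.projection_apply_eq_zero_iff h).2 hv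
    have hQ1 : ∀ v ∈ E.fibrePar x 1, Q v = v := fun v hv =>
      Submodule.projection_apply_left h.symm ⟨v, hv⟩
    have hQ0 : ∀ v ∈ E.fibrePar x 0, Q v = 0 := fun v hv =>
      (Submodule.projection_apply_eq_zero_iff h.symm).2 hv
    have hPQ : ∀ v, P v + Q v = v := fun v => by
      obtain ⟨v₀, hv₀, v₁, hv₁, rfl⟩ := Submodule.mem_sup.1
        (h.sup_eq_top ▸ Submodule.mem_top : v ∈ E.fibrePar x 0 ⊔ E.fibrePar x 1)
      rw [map_add, map_add, hP0 _ hv₀, hP1 _ hv₁, hQ0 _ hv₀, hQ1 _ hv₁, add_zero, zero_add]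
    refine Submodule.mem_sup.2 ⟨P * A * P + Q * A * Q, ⟨(hL _).2 ⟨?_, ?_⟩, ?_⟩,
      Q * A * P + P * A * Q, ⟨(hL _).2 ⟨?_, ?_⟩, ?_⟩, ?_⟩
    · simp [hP0 _ h₀, hQ0 _ h₀, hA₀]
    · simp [hP1 _ h₁, hQ1 _ h₁, hA₁]
    · intro j v hv
      obtain rfl | rfl := ZMod.two_cases j
      · simpa [hP0 _ hv, hQ0 _ hv] using hPm (A v)
      · simpa [hP1 _ hv, hQ1 _ hv] using hQm (A v)
    · simp [hP0 _ h₀, hQ0 _ h₀, hA₀]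
    · simp [hP1 _ h₁, hQ1 _ h₁, hA₁]
    · intro j v hv
      obtain rfl | rfl := ZMod.two_cases j
      · simpa [hP0 _ hv, hQ0 _ hv] using hQm (A v)
      · simpa [hP1 _ hv, hQ1 _ hv, show (1 + 1 : ZMod 2) = 0 by decide] using hPm (A v)
    · refine LinearMap.ext fun v => ?_
      change P (A (P v)) + Q (A (Q v)) + (Q (A (P v)) + P (A (Q v))) = A v
      conv_rhs => rw [← hPQ v, map_add, ← hPQ (A (P v)), ← hPQ (A (Q v))]
      abel
  bracket_mem i j A hA B hB := by
    obtain ⟨hA₀, hA₁⟩ := (hL A).1 hA.1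
    obtain ⟨hB₀, hB₁⟩ := (hL B).1 hB.1
    refine (hL _).2 ⟨?_, ?_⟩ <;> simp [hA₀, hA₁, hB₀, hB₁]

theorem subset_lieSuperClosure (x : M) (S : Set (Module.End ℝ (E.Fibre x))) :
    S ⊆ E.lieSuperClosure x S := fun _ hA =>
  Submodule.mem_sInf.2 fun _ hL => hL.2 hA

/-- The annihilator of `a₀ + a₁` alone need not be graded; the common annihilator of its components
is, and so contains the generated supersubalgebra. -/
theorem apply_eq_zero_of_mem_lieSuperClosure {x : M}
    (h : IsCompl (E.fibrePar x 0) (E.fibrePar x 1)) {a₀ a₁ : E.Fibre x}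
    (h₀ : a₀ ∈ E.fibrePar x 0) (h₁ : a₁ ∈ E.fibrePar x 1)
    {S : Set (Module.End ℝ (E.Fibre x))} (hS : ∀ A ∈ S, A a₀ = 0 ∧ A a₁ = 0)
    {A : Module.End ℝ (E.Fibre x)} (hA : A ∈ E.lieSuperClosure x S) : A (a₀ + a₁) = 0 := by
  let L : Submodule ℝ (Module.End ℝ (E.Fibre x)) :=
    LinearMap.ker (LinearMap.applyₗ a₀) ⊓ LinearMap.ker (LinearMap.applyₗ a₁)
  have hL : ∀ A, A ∈ L ↔ A a₀ = 0 ∧ A a₁ = 0 := fun A => Iff.rfl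
  obtain ⟨hA₀, hA₁⟩ := (hL A).1 (Submodule.mem_sInf.1 hA L
    ⟨isLieSupersubalgebra_annihilator h h₀ h₁ L hL, fun B hB => (hL B).2 (hS B hB)⟩)
  rw [map_add, hA₀, hA₁, add_zero]

end SupermodulePresheaf

/-! ### Curvature operators -/

namespace SuperConnection

open SupermodulePresheaf

section

variable {M : Type u} [TopologicalSpace M] {𝒪 : SuperalgebraSheaf.{u, v} M}
  {E : SupermodulePresheaf.{u, v, w} 𝒪} (D : SuperConnection E ⊤)

/-- The homogeneous components of a parallel section are parallel. -/
theorem IsParallel.of_add {D : SuperConnection E ⊤} {X₀ X₁ : E.sec ⊤} (h₀ : X₀ ∈ E.par ⊤ 0)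
    (h₁ : X₁ ∈ E.par ⊤ 1) (h : D.IsParallel (X₀ + X₁)) : D.IsParallel X₀ ∧ D.IsParallel X₁ := by
  have hom : ∀ (U : Opens M) (i : ZMod 2), ∀ Y ∈ 𝒪.tangent.par U i,
      D.nabla U le_top Y (E.res le_top X₀) = 0 ∧ D.nabla U le_top Y (E.res le_top X₁) = 0 := by
    intro U i Y hY
    have hsum := h U Y
    rw [map_add, map_add] at hsum
    have m₀ := D.nabla_mem U le_top i 0 Y hY _ (E.res_mem le_top h₀)
    have m₁ := D.nabla_mem U le_top i 1 Y hY _ (E.res_mem le_top h₁)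
    have hz : D.nabla U le_top Y (E.res le_top X₀) = 0 := by
      refine eq_zero_of_mem (i := i) (by simpa using m₀) ?_
      rw [eq_neg_of_add_eq_zero_left hsum, add_comm]
      exact neg_mem m₁
    exact ⟨hz, by rwa [hz, zero_add] at hsum⟩
  have key : ∀ (U : Opens M) (Y : 𝒪.tangent.sec U),
      D.nabla U le_top Y (E.res le_top X₀) = 0 ∧ D.nabla U le_top Y (E.res le_top X₁) = 0 := by
    intro U Y
    obtain ⟨Y₀, hY₀, Y₁, hY₁, rfl⟩ := 𝒪.tangent.exists_add Y
    rw [map_add, LinearMap.add_apply, LinearMap.add_apply, (hom U 0 Y₀ hY₀).1, (hom U 1 Y₁ hY₁).1,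
      (hom U 0 Y₀ hY₀).2, (hom U 1 Y₁ hY₁).2, add_zero]
    exact ⟨rfl, rfl⟩
  exact ⟨fun U Y => (key U Y).1, fun U Y => (key U Y).2⟩

end

variable {n m : ℕ} {M : Type u} [TopologicalSpace M] [ChartedSpace (EuclideanSpace ℝ (Fin n)) M]
  {𝒮 : Supermanifold.{u, v} n m M} {E : SupermodulePresheaf.{u, v, w} 𝒮.toSuperalgebraSheaf}
  (D : SuperConnection E ⊤)

theorem IsCurvatureOperator.apply_eval {D : SuperConnection E ⊤} {y : M}
    {B : Module.End ℝ (E.Fibre y)} (hB : D.IsCurvatureOperator y B) {X : E.sec ⊤}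
    (hX : D.IsParallel X) : B (E.eval y (Opens.mem_top y) X) = 0 := by
  obtain ⟨U, hy, D', r, Ys, Y, Z, h⟩ := hB
  rw [← eval_res le_top hy, h, D.curvatureDeriv_of_parallel D' (hX U), map_zero]

/-- Covariant derivatives of the curvature are tensors. -/
theorem eval_curvatureDeriv_smul {U : Opens M} {y : M} (hy : y ∈ U)
    (D' : SuperConnection 𝒮.tangent U) {r : ℕ} (Ys : Fin r → 𝒮.HomField U) (Y Z : 𝒮.HomField U)
    (f : 𝒮.sec U) (X : E.sec U) : E.eval y hy (D.curvatureDeriv D' r Ys Y Z (f • X)) =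
      𝒮.value y hy f • E.eval y hy (D.curvatureDeriv D' r Ys Y Z X) := by
  obtain ⟨f₀, h₀, f₁, h₁, rfl⟩ := 𝒮.exists_add U f
  rw [add_smul, D.curvatureDeriv_add, D.curvatureDeriv_smul D' Ys Y Z h₀,
    D.curvatureDeriv_smul D' Ys Y Z h₁, map_add, map_zsmul, map_zsmul, eval_smul, eval_smul,
    map_add, 𝒮.value_of_odd hy h₁, zero_smul, smul_zero, add_zero, add_zero]
  simp [koszul]

/-- By tensoriality the value at `y` depends only on the value of `X` at `y`; the endomorphism is
written down through its effect on the frame. -/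
theorem exists_curvatureOperator {p q : ℕ} {U : Opens M} {e : Fin p ⊕ Fin q → E.sec U}
    (he : E.IsFrame U e) {y : M} (hy : y ∈ U) (D' : SuperConnection 𝒮.tangent U) {r : ℕ}
    (Ys : Fin r → 𝒮.HomField U) (Y Z : 𝒮.HomField U) :
    ∃ B : Module.End ℝ (E.Fibre y), D.IsCurvatureOperator y B ∧
      ∀ X : E.sec U, B (E.eval y hy X) = E.eval y hy (D.curvatureDeriv D' r Ys Y Z X) := by
  have key : ∀ X : E.sec U, (∑ A, ((LinearMap.proj A).comp
      (he.fibreEquiv y hy).toLinearMap).smulRight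
        (E.eval y hy (D.curvatureDeriv D' r Ys Y Z (e A)))) (E.eval y hy X) =
      E.eval y hy (D.curvatureDeriv D' r Ys Y Z X) := fun X => by
    have hX : D.curvatureDeriv D' r Ys Y Z X =
        ∑ A, D.curvatureDeriv D' r Ys Y Z (he.coef le_rfl X A • e A) := by
      conv_lhs => rw [← he.sum_coef le_rfl X]
      simp only [E.res_refl]
      exact map_sum (D.curvatureHom D' Ys Y Z) _ _
    rw [hX, map_sum, LinearMap.sum_apply]
    refine Finset.sum_congr rfl fun A _ => ?_
    rw [D.eval_curvatureDeriv_smul]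
    rw [← he.fibreEquiv_eval hy le_rfl]
    rfl
  exact ⟨_, ⟨U, hy, D', r, Ys, Y, Z, key⟩, key⟩

end SuperConnection

end

/-! ### The connection on the underlying bundle: connection form and derivatives along curves. -/

noncomputable section

open SuperalgebraSheaf SupermodulePresheaf

/-! ### The connection form of the induced connection -/

namespace CoordSystem

variable {n m : ℕ} {M : Type u} [TopologicalSpace M] [ChartedSpace (EuclideanSpace ℝ (Fin n)) M]
  {𝒮 : Supermanifold.{u, v} n m M}
  {φ : OpenPartialHomeomorph M (EuclideanSpace ℝ (Fin n))} {U : Opens M} (C : CoordSystem 𝒮 φ U)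

/-- The image of the domain of a coordinate system. -/
def image (_ : CoordSystem 𝒮 φ U) : Set (EuclideanSpace ℝ (Fin n)) := φ.target ∩ φ.symm ⁻¹' U

theorem isOpen_image : IsOpen C.image := φ.isOpen_inter_preimage_symm U.isOpen

theorem apply_mem_image {x : M} (hx : x ∈ U) : φ x ∈ C.image :=
  ⟨φ.map_source (C.subset_source hx), by
    change φ.symm (φ x) ∈ U
    rwa [φ.left_inv (C.subset_source hx)]⟩

/-- The partial derivatives of the function underlying `f` again underlie superfunctions, namely the
∂_i f, so smoothness follows by induction on the order. -/
theorem contDiffOn_body (f : 𝒮.sec U) :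
    ContDiffOn ℝ ∞ (fun u => 𝒮.body f (φ.symm u)) C.image := by
  have hd : ∀ (f : 𝒮.sec U) (u : EuclideanSpace ℝ (Fin n)), u ∈ C.image →
      HasFDerivAt (fun u => 𝒮.body f (φ.symm u))
        (∑ i, 𝒮.body (applyField (C.field (Sum.inl i)) le_rfl f) (φ.symm u) •
          EuclideanSpace.proj (𝕜 := ℝ) i) u := fun f u hu => by
    have := C.hasFDerivAt le_rfl f (φ.symm u) hu.2
    rw [φ.right_inv hu.1] at this
    convert this using 4 with i
    exact 𝒮.body_of_mem _ hu.2
  refine contDiffOn_infty.2 fun k => ?_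
  induction k generalizing f with
  | zero =>
    exact contDiffOn_zero.2 fun u hu => (hd f u hu).continuousAt.continuousWithinAt
  | succ k ih =>
    push_cast
    refine (contDiffOn_succ_iff_fderiv_of_isOpen C.isOpen_image).2
      ⟨fun u hu => (hd f u hu).differentiableAt.differentiableWithinAt, by simp, ?_⟩
    refine ContDiffOn.congr ?_ fun u hu => (hd f u hu).fderiv
    exact ContDiffOn.sum fun i _ => (ih _).smul contDiffOn_const

variable {E : SupermodulePresheaf.{u, v, w} 𝒮.toSuperalgebraSheaf} {p q : ℕ}
  {e : Fin p ⊕ Fin q → E.sec U} (he : E.IsFrame U e) (D : SuperConnection E ⊤)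

/-- The Christoffel symbols of a connection in coordinates and a frame. -/
def christoffel (i : Fin n) (A B : Fin p ⊕ Fin q) : 𝒮.sec U :=
  he.coef le_rfl (D.nabla U le_top (C.field (Sum.inl i)) (e A)) B

/-- The connection form of the induced connection in coordinates and a frame. -/
def connForm (u : EuclideanSpace ℝ (Fin n)) : EuclideanSpace ℝ (Fin n) →L[ℝ]
    (Fin p ⊕ Fin q → ℝ) →L[ℝ] (Fin p ⊕ Fin q → ℝ) :=
  ∑ i, ∑ A, ∑ B, 𝒮.body (C.christoffel he D i A B) (φ.symm u) •
    (EuclideanSpace.proj (𝕜 := ℝ) i : EuclideanSpace ℝ (Fin n) →L[ℝ] ℝ).smulRight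
      ((ContinuousLinearMap.proj A : (Fin p ⊕ Fin q → ℝ) →L[ℝ] ℝ).smulRight
        (Pi.single B 1 : Fin p ⊕ Fin q → ℝ))

theorem connForm_apply (u v : EuclideanSpace ℝ (Fin n)) (c : Fin p ⊕ Fin q → ℝ)
    (B : Fin p ⊕ Fin q) : C.connForm he D u v c B =
      ∑ A, c A * ∑ i, v i * 𝒮.body (C.christoffel he D i A B) (φ.symm u) := by
  simp only [connForm, sum_apply, smul_apply,
    ContinuousLinearMap.smulRight_apply, Finset.sum_apply, Pi.smul_apply, smul_eq_mul,
    ContinuousLinearMap.proj_apply, PiLp.proj_apply, Finset.mul_sum]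
  rw [Finset.sum_comm]
  refine Finset.sum_congr rfl fun A _ => Finset.sum_congr rfl fun i _ => ?_
  rw [Finset.sum_eq_single B]
  · rw [Pi.single_eq_same]
    ring
  · intro B' _ hB
    rw [Pi.single_eq_of_ne hB.symm]
    ring
  · simp

theorem contDiffOn_connForm : ContDiffOn ℝ ∞ (C.connForm he D) C.image :=
  ContDiffOn.sum fun _ _ => ContDiffOn.sum fun _ _ => ContDiffOn.sum fun _ _ =>
    (ContinuousLinearMap.toSpanSingleton ℝ _).contDiff.comp_contDiffOn (C.contDiffOn_body _)

/-- The covariant derivative of a section in coordinates and a frame. -/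
theorem value_coef_nabla {x : M} (hx : x ∈ U) (i : Fin n) (s : E.sec U) (B : Fin p ⊕ Fin q) :
    𝒮.value x hx (he.coef le_rfl (D.nabla U le_top (C.field (Sum.inl i)) s) B) =
      𝒮.value x hx (applyField (C.field (Sum.inl i)) le_rfl (he.coef le_rfl s B)) +
        ∑ A, 𝒮.value x hx (he.coef le_rfl s A) * 𝒮.value x hx (C.christoffel he D i A B) := by
  have hleib : ∀ (f : 𝒮.sec U) (t : E.sec U), D.nabla U le_top (C.field (Sum.inl i)) (f • t) =
      applyField (C.field (Sum.inl i)) le_rfl f • t +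
        f • D.nabla U le_top (C.field (Sum.inl i)) t := fun f t => by
    obtain ⟨f₀, h₀, f₁, h₁, rfl⟩ := 𝒮.exists_add U f
    have hm : C.field (Sum.inl i) ∈ 𝒮.tangent.par U 0 := C.field_mem (Sum.inl i)
    rw [add_smul, map_add, D.nabla_smul_right U le_top 0 0 _ hm _ h₀,
      D.nabla_smul_right U le_top 0 1 _ hm _ h₁, map_add, add_smul, add_smul]
    simp only [koszul, zero_ne_one, false_and, if_false, one_smul]
    abel
  have hs : D.nabla U le_top (C.field (Sum.inl i)) s =
      ∑ A, (applyField (C.field (Sum.inl i)) le_rfl (he.coef le_rfl s A) • e A +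
        he.coef le_rfl s A • D.nabla U le_top (C.field (Sum.inl i)) (e A)) := by
    conv_lhs => rw [← he.sum_coef le_rfl s]
    rw [map_sum]
    exact Finset.sum_congr rfl fun A _ => by rw [E.res_refl, hleib]
  have hcoef : he.coef le_rfl (D.nabla U le_top (C.field (Sum.inl i)) s) B =
      ∑ A, (applyField (C.field (Sum.inl i)) le_rfl (he.coef le_rfl s A) *
          (if A = B then 1 else 0) + he.coef le_rfl s A * C.christoffel he D i A B) := by
    rw [hs, IsFrame.coef, map_sum, Finset.sum_apply']
    refine Finset.sum_congr rfl fun A _ => ?_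
    have h1 := he.coef_frame A B le_rfl
    rw [E.res_refl] at h1
    rw [← h1, map_add, map_smul, map_smul]
    rfl
  rw [hcoef, map_sum]
  simp only [map_add, map_mul, Finset.sum_add_distrib]
  congr 1
  rw [Finset.sum_eq_single B]
  · rw [if_pos rfl, map_one, mul_one]
  · intro A _ hA
    rw [if_neg hA, map_zero, mul_zero]
  · simp

/-! ### Curves -/

theorem hasDerivWithinAt_body {γ : ℝ → M} {S : Set ℝ} {t : ℝ} {v : EuclideanSpace ℝ (Fin n)}
    (hγ : ContinuousWithinAt γ S t) (hv : HasDerivWithinAt (fun s => φ (γ s)) v S t)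
    {V : Opens M} (hV : V ≤ U) (ht : γ t ∈ V) (f : 𝒮.sec V) :
    HasDerivWithinAt (fun s => 𝒮.body f (γ s))
      (∑ i, v i * 𝒮.value (γ t) ht (applyField (C.field (Sum.inl i)) hV f)) S t := by
  have h := (C.hasFDerivAt hV f (γ t) ht).comp_hasDerivWithinAt t hv
  have hev : ∀ᶠ s in nhdsWithin t S, γ s ∈ φ.source :=
    hγ (φ.open_source.mem_nhds (C.subset_source (hV ht)))
  have := h.congr_of_eventuallyEq (f₁ := fun s => 𝒮.body f (γ s))
    (hev.mono fun s hs => by simp [φ.left_inv hs])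
    (by simp [φ.left_inv (C.subset_source (hV ht))])
  refine this.congr_deriv ?_
  rw [sum_apply]
  exact Finset.sum_congr rfl fun i _ => mul_comm _ _

theorem extendsVelocity {γ : ℝ → M} {a b t : ℝ} {v : EuclideanSpace ℝ (Fin n)}
    (hγ : ContinuousWithinAt γ (Icc a b) t)
    (hv : HasDerivWithinAt (fun s => φ (γ s)) v (Icc a b) t) :
    SuperConnection.ExtendsVelocity 𝒮 γ a b t U (∑ i, v i • C.field (Sum.inl i)) := by
  refine ⟨sum_mem fun i _ => Submodule.smul_mem _ _ (C.field_mem (Sum.inl i)), ?_⟩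
  intro W hW hx f
  convert C.hasDerivWithinAt_body hγ hv hW hx f using 1
  have : applyField (∑ i, v i • C.field (Sum.inl i)) hW f =
      ∑ i, v i • applyField (C.field (Sum.inl i)) hW f := by
    rw [applyField_sum]
    exact Finset.sum_congr rfl fun i _ => applyField_real_smul _ _ _ _
  rw [this, map_sum]
  exact Finset.sum_congr rfl fun i _ => by rw [map_smul, smul_eq_mul]

/-- The covariant derivative of the induced connection along a curve, in coordinates. -/
theorem isReducedDeriv_eq_sum {γ : ℝ → M} {a b t : ℝ} {v : EuclideanSpace ℝ (Fin n)}
    (hab : a < b) (ht : t ∈ Icc a b) (hγ : ContinuousWithinAt γ (Icc a b) t)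
    (hv : HasDerivWithinAt (fun s => φ (γ s)) v (Icc a b) t) (hU : γ t ∈ U) {W : Opens M}
    (hW : U ≤ W) {s : E.sec W} {c : E.Fibre (γ t)} (hc : D.IsReducedDeriv γ a b t s c) :
    c = ∑ i, v i • E.eval (γ t) hU (D.nabla U le_top (C.field (Sum.inl i)) (E.res hW s)) := by
  obtain ⟨V, h, hV, Y, hY, rfl⟩ := hc
  have hx : γ t ∈ V ⊓ U := Opens.mem_inf.2 ⟨hV, hU⟩
  -- Testing the velocity condition on the even coordinates fixes the values of the components of
  -- `Y` at `γ t`; derivatives within `Icc a b` are unique because `a < b`.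
  have hval : ∀ j, 𝒮.value (γ t) hx (applyField Y inf_le_left
      (𝒮.res (inf_le_right : V ⊓ U ≤ U) (C.coord (Sum.inl j)))) = v j := fun j => by
    have h1 := hY.2 (V ⊓ U) inf_le_left hx (𝒮.res inf_le_right (C.coord (Sum.inl j)))
    have h2 := C.hasDerivWithinAt_body hγ hv inf_le_right hx
      (𝒮.res inf_le_right (C.coord (Sum.inl j)))
    rw [(uniqueDiffOn_Icc hab t ht).eq_deriv _ h1 h2, Finset.sum_eq_single j]
    · rw [← applyField_res_right (C.field (Sum.inl j)) le_rfl inf_le_right, 𝒮.value_res,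
        C.apply_coord, if_pos rfl, map_one, mul_one]
    · intro i _ hi
      rw [← applyField_res_right (C.field (Sum.inl i)) le_rfl inf_le_right, 𝒮.value_res,
        C.apply_coord, if_neg (by simpa using hi), map_zero, mul_zero]
    · simp
  -- `Y` is even, so it sends ξ^α to an odd superfunction, with value zero.
  have hodd : ∀ α, 𝒮.value (γ t) hx (applyField Y inf_le_left
      (𝒮.res (inf_le_right : V ⊓ U ≤ U) (C.coord (Sum.inr α)))) = 0 := fun α =>
    𝒮.value_of_odd hx (by
      have := applyField_mem hY.1 (inf_le_left : V ⊓ U ≤ V)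
        (𝒮.res_mem (inf_le_right : V ⊓ U ≤ U) (C.coord_mem (Sum.inr α)))
      simpa [coordDeg] using this)
  rw [← eval_res (inf_le_left : V ⊓ U ≤ V) hx, D.nabla_res,
    C.eq_sum (inf_le_right : V ⊓ U ≤ U) (𝒮.tangent.res inf_le_left Y), map_sum,
    LinearMap.sum_apply, map_sum, Fintype.sum_sum_type]
  have hsec : ∀ a, E.eval (γ t) hx (D.nabla (V ⊓ U) le_top
      (applyField (𝒮.tangent.res (inf_le_left : V ⊓ U ≤ V) Y) le_rfl
        (𝒮.res inf_le_right (C.coord a)) • 𝒮.tangent.res inf_le_right (C.field a))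
        (E.res inf_le_left (E.res h s))) =
      𝒮.value (γ t) hx (applyField Y inf_le_left
        (𝒮.res (inf_le_right : V ⊓ U ≤ U) (C.coord a))) •
      E.eval (γ t) hU (D.nabla U le_top (C.field a) (E.res hW s)) := fun a => by
    rw [D.nabla_smul_left, eval_smul, E.res_res,
      ← E.res_res hW (inf_le_right : V ⊓ U ≤ U), ← D.nabla_res, eval_res]
    rfl
  rw [Finset.sum_congr rfl fun a _ => hsec (Sum.inl a),
    Finset.sum_congr rfl fun a _ => hsec (Sum.inr a)]
  simp only [hval, hodd, zero_smul, Finset.sum_const_zero, add_zero]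

end CoordSystem

end

/-! ### Linear transport along segments in a normed space. -/

noncomputable section

/-! ### Linear transport along segments -/

section Segments

variable {V F : Type*} [NormedAddCommGroup V] [NormedSpace ℝ V] [NormedAddCommGroup F]
  [NormedSpace ℝ F] (A : V → V →L[ℝ] F →L[ℝ] F)

/-- Solutions of the linear differential equation `f' = -A f` along the segment from `w₁` to
`w₂`. -/
def IsSegmentSolution (w₁ w₂ : V) (f : ℝ → F) : Prop :=
  ∀ t ∈ Icc (0 : ℝ) 1,
    HasDerivWithinAt f (-(A (w₁ + t • (w₂ - w₁)) (w₂ - w₁) (f t))) (Icc 0 1) t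

variable {A} {w₁ w₂ : V}

namespace IsSegmentSolution

theorem add {f g : ℝ → F} (hf : IsSegmentSolution A w₁ w₂ f) (hg : IsSegmentSolution A w₁ w₂ g) :
    IsSegmentSolution A w₁ w₂ (f + g) := fun t ht =>
  ((hf t ht).add (hg t ht)).congr_deriv (by simp only [Pi.add_apply, map_add]; abel)

theorem const_smul {f : ℝ → F} (hf : IsSegmentSolution A w₁ w₂ f) (c : ℝ) :
    IsSegmentSolution A w₁ w₂ (c • f) := fun t ht =>
  ((hf t ht).const_smul c).congr_deriv (by simp only [Pi.smul_apply, map_smul, smul_neg])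

theorem sub {f g : ℝ → F} (hf : IsSegmentSolution A w₁ w₂ f) (hg : IsSegmentSolution A w₁ w₂ g) :
    IsSegmentSolution A w₁ w₂ (f - g) := fun t ht =>
  ((hf t ht).sub (hg t ht)).congr_deriv (by simp only [Pi.sub_apply, map_sub]; abel)

/-- Restriction to an initial piece of the segment, reparametrized to unit time; thus one solution
controls the transport to every intermediate point. -/
theorem rescale {f : ℝ → F} (hf : IsSegmentSolution A w₁ w₂ f) {t : ℝ} (ht : t ∈ Icc (0 : ℝ) 1) :
    IsSegmentSolution A w₁ (w₁ + t • (w₂ - w₁)) fun s => f (t * s) := fun s hs => by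
  have hmaps : MapsTo (fun s => t * s) (Icc (0 : ℝ) 1) (Icc 0 1) := fun s hs =>
    ⟨mul_nonneg ht.1 hs.1, mul_le_one₀ ht.2 hs.1 hs.2⟩
  have h1 : HasDerivWithinAt (fun s => t * s) t (Icc 0 1) s := by
    simpa using (hasDerivWithinAt_id s (Icc (0 : ℝ) 1)).const_mul t
  refine ((hf _ (hmaps hs)).scomp s h1 hmaps).congr_deriv ?_
  rw [add_sub_cancel_left, map_smul, smul_neg, smul_smul, mul_comm s t]
  rfl

theorem eq_zero {f : ℝ → F} (hf : IsSegmentSolution A w₁ w₂ f) {B : Set V} (hB : Convex ℝ B)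
    (h₁ : w₁ ∈ B) (h₂ : w₂ ∈ B) {K : ℝ} (hK : ∀ w ∈ B, ‖A w‖ ≤ K) {t₀ : ℝ}
    (ht₀ : t₀ ∈ Icc (0 : ℝ) 1) (h0 : f t₀ = 0) : ∀ t ∈ Icc (0 : ℝ) 1, f t = 0 := by
  refine eq_zero_of_norm_deriv_le hf ht₀ h0 (K := K * ‖w₂ - w₁‖) fun t ht => ?_
  rw [norm_neg]
  refine ((A _ _).le_opNorm _).trans (mul_le_mul_of_nonneg_right ?_ (norm_nonneg _))
  exact ((A _).le_opNorm _).trans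
    (mul_le_mul_of_nonneg_right (hK _ (hB.add_smul_sub_mem h₁ h₂ ht)) (norm_nonneg _))

end IsSegmentSolution

theorem exists_isSegmentSolution [CompleteSpace F] {B : Set V} (hB : Convex ℝ B)
    (hA : ContinuousOn A B) (h₁ : w₁ ∈ B) (h₂ : w₂ ∈ B) {K : ℝ} (hK : ∀ w ∈ B, ‖A w‖ ≤ K)
    (hlen : 2 * (K * ‖w₂ - w₁‖) ≤ 1) (x₀ : F) :
    ∃ f, f 0 = x₀ ∧ IsSegmentSolution A w₁ w₂ f := by
  have hmaps : MapsTo (fun t : ℝ => w₁ + t • (w₂ - w₁)) (Icc 0 1) B := fun t ht =>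
    hB.add_smul_sub_mem h₁ h₂ ht
  obtain ⟨f, hf, hderiv⟩ := exists_linear_ode_solution (a := 0) (b := 1) (C := K * ‖w₂ - w₁‖)
    (A := fun t : ℝ => -(A (w₁ + t • (w₂ - w₁)) (w₂ - w₁))) zero_le_one
    ((ContinuousOn.clm_apply (hA.comp (by fun_prop) hmaps) continuousOn_const).neg)
    (fun t ht => by
      rw [norm_neg]
      exact ((A _).le_opNorm _).trans
        (mul_le_mul_of_nonneg_right (hK _ (hmaps ht)) (norm_nonneg _)))
    (by simpa using hlen) x₀
  exact ⟨f, hf, hderiv⟩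

/-- The transport along a short segment. -/
theorem exists_segment_transport [FiniteDimensional ℝ F] {B : Set V} (hB : Convex ℝ B)
    (hA : ContinuousOn A B) (h₁ : w₁ ∈ B) (h₂ : w₂ ∈ B) {K : ℝ} (hK : ∀ w ∈ B, ‖A w‖ ≤ K)
    (hlen : 2 * (K * ‖w₂ - w₁‖) ≤ 1) :
    ∃ T : F ≃ₗ[ℝ] F, ∀ f, IsSegmentSolution A w₁ w₂ f → T (f 0) = f 1 := by
  have : CompleteSpace F := FiniteDimensional.complete ℝ F
  choose sol hsol0 hsol using exists_isSegmentSolution hB hA h₁ h₂ hK hlen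
  have huniq : ∀ f, IsSegmentSolution A w₁ w₂ f → sol (f 0) 1 = f 1 := fun f hf => by
    have := ((hsol (f 0)).sub hf).eq_zero hB h₁ h₂ hK (t₀ := 0) (by simp)
      (by simp [hsol0]) 1 (by simp)
    exact sub_eq_zero.1 this
  let T : F →ₗ[ℝ] F :=
    { toFun := fun c => sol c 1
      map_add' := fun c d => by
        simpa [hsol0] using huniq _ ((hsol c).add (hsol d))
      map_smul' := fun r c => by
        simpa [hsol0] using huniq _ ((hsol c).const_smul r) }
  -- A solution that vanishes at time 1 vanishes at time 0, by uniqueness backward in time; in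
  -- finite dimension injectivity is enough.
  have hT : Function.Injective T := by
    refine (injective_iff_map_eq_zero T).2 fun c hc => ?_
    rw [← hsol0 c]
    exact (hsol c).eq_zero hB h₁ h₂ hK (t₀ := 1) (by simp) hc 0 (by simp)
  exact ⟨LinearEquiv.ofInjectiveEndo T hT, fun f hf => huniq f hf⟩

/-- A function compatible with the transport along all segments has directional derivatives. -/
theorem hasDerivAt_of_transport [CompleteSpace F] {B : Set V} (hB : Convex ℝ B) (hBo : IsOpen B)
    (hA : ContinuousOn A B) {K : ℝ} (hK : ∀ w ∈ B, ‖A w‖ ≤ K)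
    (hlen : ∀ w₁ ∈ B, ∀ w₂ ∈ B, 2 * (K * ‖w₂ - w₁‖) ≤ 1) {c : V → F}
    (hc : ∀ w₁ ∈ B, ∀ w₂ ∈ B, ∀ f, IsSegmentSolution A w₁ w₂ f → f 0 = c w₁ → f 1 = c w₂)
    {w : V} (hw : w ∈ B) (v : V) :
    HasDerivAt (fun t : ℝ => c (w + t • v)) (-(A w v (c w))) 0 := by
  have hev : ∀ᶠ t : ℝ in nhds 0, w + t • v ∈ B := by
    have : Continuous fun t : ℝ => w + t • v := by fun_prop
    exact this.continuousAt.eventually_mem (hBo.mem_nhds (by simpa using hw))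
  obtain ⟨δ, hδ, hball⟩ := Metric.eventually_nhds_iff.1 hev
  set ε := δ / 2 with hε
  have hε0 : 0 < ε := by positivity
  have hm : ∀ t : ℝ, |t| ≤ ε → w + t • v ∈ B := fun t ht => hball (by
    rw [Real.dist_eq, sub_zero]
    linarith)
  have hp₁ : w + (-ε) • v ∈ B := hm _ (by rw [abs_neg, abs_of_pos hε0])
  have hp₂ : w + ε • v ∈ B := hm _ (by rw [abs_of_pos hε0])
  have hsub : w + ε • v - (w + (-ε) • v) = (2 * ε) • v := by module
  -- The segment is centred at `w`, which is reached at the interior time 1/2, so that the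
  -- derivative there is two-sided.
  obtain ⟨f, hf0, hf⟩ := exists_isSegmentSolution hB hA hp₁ hp₂ hK (hlen _ hp₁ _ hp₂)
    (c (w + (-ε) • v))
  have hft : ∀ t ∈ Icc (0 : ℝ) 1, c (w + (2 * ε * t - ε) • v) = f t := fun t ht => by
    have h := hc _ hp₁ _ (hB.add_smul_sub_mem hp₁ hp₂ ht) _ (hf.rescale ht)
      (by rw [mul_zero, hf0])
    rw [mul_one, hsub] at h
    rw [h]
    congr 1
    module
  have hhalf : c w = f (1 / 2) := by
    rw [← hft _ (by norm_num)]
    congr 1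
    rw [show 2 * ε * (1 / 2) - ε = 0 by ring, zero_smul, add_zero]
  have hd := (hf (1 / 2) (by norm_num)).hasDerivAt (Icc_mem_nhds (by norm_num) (by norm_num))
  have hlin : HasDerivAt (fun s : ℝ => (s + ε) / (2 * ε)) (1 / (2 * ε)) 0 :=
    ((hasDerivAt_id (0 : ℝ)).add_const ε).div_const _
  have h0 : (0 + ε) / (2 * ε) = 1 / 2 := by field_simp; norm_num
  have hcomp : HasDerivAt (fun s : ℝ => f ((s + ε) / (2 * ε))) _ 0 :=
    HasDerivAt.scomp (h := fun s : ℝ => (s + ε) / (2 * ε)) 0 (by rw [h0]; exact hd) hlin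
  refine (hcomp.congr_deriv ?_).congr_of_eventuallyEq ?_
  · rw [hsub, ← hhalf, show w + (-ε) • v + (1 / 2 : ℝ) • (2 * ε) • v = w by module, map_smul,
      smul_neg, smul_apply, smul_smul, one_div_mul_cancel (by positivity), one_smul]
  · filter_upwards [Metric.ball_mem_nhds (0 : ℝ) hε0] with s hs
    rw [Metric.mem_ball, Real.dist_eq, sub_zero, abs_lt] at hs
    rw [← hft]
    · congr 3
      field_simp
      ring
    · constructor
      · exact div_nonneg (by linarith) (by linarith)
      · rw [div_le_one (by positivity)]
        linarith

/-- The radius R is at most 1/(4K), so two points of the ball are at distance at most 2R ≤ 1/(2K):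
short enough for transport along every segment in it. -/
theorem exists_ball_norm_le {S : Set V} (hS : IsOpen S) (hA : ContinuousOn A S) {x : V}
    (hx : x ∈ S) : ∃ K R : ℝ, 0 < R ∧ Metric.ball x R ⊆ S ∧ (∀ u ∈ Metric.ball x R, ‖A u‖ ≤ K) ∧
      ∀ w₁ ∈ Metric.ball x R, ∀ w₂ ∈ Metric.ball x R, 2 * (K * ‖w₂ - w₁‖) ≤ 1 := by
  have hmem : S ∈ nhds x := hS.mem_nhds hx
  set K := ‖A x‖ + 1 with hK
  have hK0 : 0 < K := by positivity
  obtain ⟨r, hr, hball⟩ := Metric.mem_nhds_iff.1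
    (Filter.inter_mem hmem ((ContinuousAt.norm (E := V →L[ℝ] F →L[ℝ] F)
      (hA.continuousAt hmem)).eventually_lt_const (lt_add_one _)))
  have hRK : 4 * K * min r (1 / (4 * K)) ≤ 1 := by
    have := min_le_right r (1 / (4 * K))
    rw [le_div_iff₀ (by positivity)] at this
    linarith
  have hballR : Metric.ball x (min r (1 / (4 * K))) ⊆ Metric.ball x r :=
    Metric.ball_subset_ball (min_le_left _ _)
  refine ⟨K, _, lt_min hr (by positivity), fun u hu => (hball (hballR hu)).1,
    fun u hu => (hball (hballR hu)).2.le, fun w₁ h₁ w₂ h₂ => ?_⟩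
  rw [Metric.mem_ball, dist_eq_norm] at h₁ h₂
  have h3 : ‖w₂ - w₁‖ ≤ 2 * min r (1 / (4 * K)) := by
    have := norm_sub_le (w₂ - x) (w₁ - x)
    rw [sub_sub_sub_cancel_right] at this
    linarith
  nlinarith

/-- The small interval is nondegenerate even when `t₀` is an endpoint, so that derivatives within it
remain unique. -/
theorem exists_Icc_subset_of_mem_nhdsWithin {a b t₀ : ℝ} (hab : a < b) (ht₀ : t₀ ∈ Icc a b)
    {S : Set ℝ} (hS : S ∈ nhdsWithin t₀ (Icc a b)) :
    ∃ a' b', a' < b' ∧ t₀ ∈ Icc a' b' ∧ Icc a' b' ⊆ Icc a b ∧ Icc a' b' ⊆ S ∧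
      Icc a' b' ∈ nhdsWithin t₀ (Icc a b) := by
  obtain ⟨ε, hε, h⟩ := Metric.mem_nhdsWithin_iff.1 hS
  refine ⟨max a (t₀ - ε / 2), min b (t₀ + ε / 2), ?_, ?_, ?_, ?_, ?_⟩
  · simp only [max_lt_iff, lt_min_iff]
    exact ⟨⟨hab, by linarith [ht₀.2]⟩, by linarith [ht₀.1], by linarith⟩
  · simp only [mem_Icc, max_le_iff, le_min_iff]
    exact ⟨⟨ht₀.1, by linarith⟩, ht₀.2, by linarith⟩
  · exact Icc_subset_Icc (le_max_left _ _) (min_le_left _ _)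
  · intro t ht
    simp only [mem_Icc, max_le_iff, le_min_iff] at ht
    refine h ⟨?_, ht.1.1, ht.2.1⟩
    rw [Metric.mem_ball, Real.dist_eq, abs_lt]
    constructor <;> linarith [ht.1.2, ht.2.2]
  · refine Metric.mem_nhdsWithin_iff.2 ⟨ε / 2, by positivity, ?_⟩
    rintro t ⟨ht, hta, htb⟩
    rw [Metric.mem_ball, Real.dist_eq, abs_lt] at ht
    simp only [mem_Icc, max_le_iff, le_min_iff]
    exact ⟨⟨hta, by linarith⟩, htb, by linarith⟩

end Segments

end

/-! ### Parallel displacement along curves and coordinate segments. -/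

noncomputable section

open SuperalgebraSheaf SupermodulePresheaf

variable {n m : ℕ} {M : Type u} [TopologicalSpace M] [ChartedSpace (EuclideanSpace ℝ (Fin n)) M]
  {𝒮 : Supermanifold.{u, v} n m M} {E : SupermodulePresheaf.{u, v, w} 𝒮.toSuperalgebraSheaf}

/-! ### Parallel displacement of parallel sections -/

namespace CoordSystem

variable {φ : OpenPartialHomeomorph M (EuclideanSpace ℝ (Fin n))} {U : Opens M}
  (C : CoordSystem 𝒮 φ U) {p q : ℕ} {e : Fin p ⊕ Fin q → E.sec U} (he : E.IsFrame U e)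
  (D : SuperConnection E ⊤)

theorem fibreEquiv_sum_nabla {x : M} (hx : x ∈ U) (v : EuclideanSpace ℝ (Fin n))
    (c : Fin p ⊕ Fin q → ℝ) : he.fibreEquiv x hx (∑ A, c A • ∑ i, v i •
      E.eval x hx (D.nabla U le_top (C.field (Sum.inl i)) (e A))) =
      C.connForm he D (φ x) v c := by
  funext B
  rw [C.connForm_apply he D, map_sum, Finset.sum_apply]
  refine Finset.sum_congr rfl fun A _ => ?_
  rw [map_smul, Pi.smul_apply, map_sum, Finset.sum_apply, smul_eq_mul]
  congr 1
  refine Finset.sum_congr rfl fun i _ => ?_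
  rw [map_smul, Pi.smul_apply, he.fibreEquiv_eval hx le_rfl, smul_eq_mul,
    φ.left_inv (C.subset_source hx), 𝒮.body_of_mem _ hx]
  rfl

/-- The coordinates of a parallel section along a curve. -/
theorem hasDerivWithinAt_parallel {X : E.sec U}
    (hX : ∀ i, D.nabla U le_top (C.field (Sum.inl i)) X = 0) {γ : ℝ → M} {S : Set ℝ} {t : ℝ}
    {v : EuclideanSpace ℝ (Fin n)} (hγ : ContinuousWithinAt γ S t)
    (hv : HasDerivWithinAt (fun s => φ (γ s)) v S t) (ht : γ t ∈ U) :
    HasDerivWithinAt (fun s B => 𝒮.body (he.coef le_rfl X B) (γ s))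
      (-(C.connForm he D (φ (γ t)) v fun B => 𝒮.body (he.coef le_rfl X B) (γ t))) S t := by
  refine hasDerivWithinAt_pi.2 fun B => ?_
  refine (C.hasDerivWithinAt_body hγ hv le_rfl ht _).congr_deriv ?_
  have hval : ∀ i, 𝒮.value (γ t) ht (applyField (C.field (Sum.inl i)) le_rfl
      (he.coef le_rfl X B)) = -∑ A, 𝒮.value (γ t) ht (he.coef le_rfl X A) *
        𝒮.value (γ t) ht (C.christoffel he D i A B) := fun i => by
    have h := C.value_coef_nabla he D ht i X B
    have h0 : he.coef le_rfl (0 : E.sec U) B = 0 := by simp [IsFrame.coef]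
    rw [hX, h0, map_zero] at h
    exact eq_neg_of_add_eq_zero_left h.symm
  rw [Pi.neg_apply, C.connForm_apply he D, ← Finset.sum_neg_distrib]
  simp only [hval, 𝒮.body_of_mem _ ht, φ.left_inv (C.subset_source ht), mul_neg, Finset.mul_sum,
    Finset.sum_neg_distrib]
  rw [Finset.sum_comm]
  exact congrArg _ (Finset.sum_congr rfl fun A _ => Finset.sum_congr rfl fun i _ => by ring)

end CoordSystem

namespace SuperConnection

variable {D : SuperConnection E ⊤} {p q : ℕ}

theorem IsReducedDeriv.mono {γ : ℝ → M} {a b a' b' t : ℝ} (hJ : Icc a' b' ⊆ Icc a b)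
    {W : Opens M} {s : E.sec W} {c : E.Fibre (γ t)} (h : D.IsReducedDeriv γ a b t s c) :
    D.IsReducedDeriv γ a' b' t s c := by
  obtain ⟨V, hV, ht, Y, hY, rfl⟩ := h
  exact ⟨V, hV, ht, Y, ⟨hY.1, fun W hW hx f => (hY.2 W hW hx f).mono hJ⟩, rfl⟩

/-- The coordinates of a parallel section along a curve satisfy a linear differential equation. -/
theorem IsParallelAlong.hasDerivWithinAt {φ : OpenPartialHomeomorph M (EuclideanSpace ℝ (Fin n))}
    {U : Opens M} (C : CoordSystem 𝒮 φ U) {e : Fin p ⊕ Fin q → E.sec U} (he : E.IsFrame U e)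
    {γ : ℝ → M} {a b t : ℝ} {v : EuclideanSpace ℝ (Fin n)} (hab : a < b) (ht : t ∈ Icc a b)
    (hγ : ContinuousWithinAt γ (Icc a b) t)
    (hv : HasDerivWithinAt (fun s => φ (γ s)) v (Icc a b) t) (hU : γ t ∈ U)
    {c : Fin p ⊕ Fin q → ℝ → ℝ} {c' : Fin p ⊕ Fin q → ℝ}
    (hc : ∀ A, HasDerivWithinAt (c A) (c' A) (Icc a b) t) {d : Fin p ⊕ Fin q → E.Fibre (γ t)}
    (hd : ∀ A, D.IsReducedDeriv γ a b t (e A) (d A))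
    (h : ∑ A, (c' A • E.eval (γ t) hU (e A) + c A t • d A) = 0) :
    HasDerivWithinAt (fun s A => c A s) (-(C.connForm he D (φ (γ t)) v fun A => c A t))
      (Icc a b) t := by
  have hd' : ∀ A, d A = ∑ i, v i • E.eval (γ t) hU
      (D.nabla U le_top (C.field (Sum.inl i)) (e A)) := fun A => by
    have := C.isReducedDeriv_eq_sum D hab ht hγ hv hU le_rfl (hd A)
    rwa [E.res_refl] at this
  refine hasDerivWithinAt_pi.2 fun B => (hc B).congr_deriv ?_
  rw [Finset.sum_add_distrib, ← he.fibreEquiv_symm_apply hU c'] at h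
  have h2 := congrArg (he.fibreEquiv (γ t) hU) h
  rw [map_add, LinearEquiv.apply_symm_apply, map_zero, Finset.sum_congr rfl fun A _ => by rw [hd'],
    C.fibreEquiv_sum_nabla he D hU] at h2
  rw [eq_neg_of_add_eq_zero_left h2]

/-- A parallel section along a curve that agrees with a parallel section at one point agrees with
it nearby. -/
theorem IsParallelAlong.eventually_eq_eval [IsManifold (𝓡 n) ∞ M] {γ : ℝ → M} {a b : ℝ}
    (hab : a < b) (hγ : ContMDiffOn 𝓘(ℝ, ℝ) (𝓡 n) ∞ γ (Icc a b)) {X : ∀ t, E.Fibre (γ t)}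
    (hX : D.IsParallelAlong p q γ a b X) {Z : E.sec ⊤} (hZ : D.IsParallel Z) {t₀ : ℝ}
    (ht₀ : t₀ ∈ Icc a b) : ∀ᶠ t in nhdsWithin t₀ (Icc a b),
      (X t₀ = E.eval (γ t₀) (Opens.mem_top _) Z ↔ X t = E.eval (γ t) (Opens.mem_top _) Z) := by
  obtain ⟨W, e, c, c', hW, he, h⟩ := hX t₀ ht₀
  obtain ⟨U₀, hU₀, ⟨C₀⟩⟩ := CoordSystem.exists_coordSystem 𝒮 (γ t₀)
  set φ := chartAt (EuclideanSpace ℝ (Fin n)) (γ t₀) with hφ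
  set U : Opens M := U₀ ⊓ W with hU
  have hUW : U ≤ W := inf_le_right
  let C := C₀.restrict (inf_le_left : U ≤ U₀)
  have heU := he.restrict hUW
  have hγc := hγ.continuousOn
  obtain ⟨a', b', hab', hmem, hJ, hJU, hJn⟩ := exists_Icc_subset_of_mem_nhdsWithin hab ht₀
    (hγc t₀ ht₀ (U.isOpen.mem_nhds (Opens.mem_inf.2 ⟨hU₀, hW⟩)))
  have hJU' : ∀ t ∈ Icc a' b', γ t ∈ U := fun t ht => hJU ht
  have hsm : ContDiffOn ℝ ∞ (fun t => φ (γ t)) (Icc a' b') := by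
    rw [← contMDiffOn_iff_contDiffOn]
    exact (contMDiffOn_chart (I := 𝓡 n) (x := γ t₀)).comp (hγ.mono hJ)
      fun t ht => C.subset_source (hJU' t ht)
  have hv : ∀ t ∈ Icc a' b', HasDerivWithinAt (fun t => φ (γ t))
      (derivWithin (fun t => φ (γ t)) (Icc a' b') t) (Icc a' b') t := fun t ht =>
    (hsm.differentiableOn (by simp) t ht).hasDerivWithinAt
  have hvc : ContinuousOn (derivWithin (fun t => φ (γ t)) (Icc a' b')) (Icc a' b') :=
    hsm.continuousOn_derivWithin (uniqueDiffOn_Icc hab') (by simp)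
  set v := derivWithin (fun t => φ (γ t)) (Icc a' b')
  set Γ : ℝ → (Fin p ⊕ Fin q → ℝ) →L[ℝ] (Fin p ⊕ Fin q → ℝ) :=
    fun t => C.connForm heU D (φ (γ t)) (v t) with hΓ
  have hΓc : ContinuousOn Γ (Icc a' b') :=
    ((C.contDiffOn_connForm heU D).continuousOn.comp hsm.continuousOn
      fun t ht => C.apply_mem_image (hJU' t ht)).clm_apply hvc
  obtain ⟨K, hK⟩ := isCompact_Icc.exists_bound_of_continuousOn hΓc
  set d : ℝ → Fin p ⊕ Fin q → ℝ := fun t B => 𝒮.body (heU.coef le_rfl (E.res le_top Z) B) (γ t)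
    with hd
  -- Both coordinate vectors solve the same linear equation, hence so does their difference.
  have hcd : ∀ t ∈ Icc a' b', HasDerivWithinAt (fun s => (fun A => c A s) - d s)
      (-(Γ t ((fun A => c A t) - d t))) (Icc a' b') t := fun t ht => by
    obtain ⟨-, hc, δ, hδ, hsum⟩ := h t (hJ ht) (hUW (hJU' t ht))
    have h1 := IsParallelAlong.hasDerivWithinAt (D := D) C heU hab' ht
      ((hγc t (hJ ht)).mono hJ) (hv t ht) (hJU' t ht)
      (fun A => (hc A).mono hJ) (d := δ) (fun A => by
        -- The frame now lives on `U` instead of `W`, so the witnessing neighbourhood is shrunk to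
        -- `V ⊓ U`.
        obtain ⟨V, hV, htV, Y, hY, hYd⟩ := (hδ A).mono hJ
        refine ⟨V ⊓ U, inf_le_right, Opens.mem_inf.2 ⟨htV, hJU' t ht⟩,
          𝒮.tangent.res inf_le_left Y, ⟨𝒮.tangent.res_mem _ hY.1, fun W' hW' hx f =>
            hY.2 W' (hW'.trans inf_le_left) hx f⟩, ?_⟩
        rw [hYd, E.res_res, ← E.res_res hV (inf_le_left : V ⊓ U ≤ V), ← D.nabla_res, eval_res])
      (by simpa only [eval_res] using hsum)
    have h2 := C.hasDerivWithinAt_parallel heU D (X := E.res le_top Z) (fun i => hZ U _)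
      ((hγc t (hJ ht)).mono hJ) (hv t ht) (hJU' t ht)
    refine (h1.sub h2).congr_deriv ?_
    rw [map_sub]
    abel
  have hiff : ∀ t ∈ Icc a' b', X t = E.eval (γ t) (Opens.mem_top _) Z ↔
      (fun A => c A t) - d t = 0 := fun t ht => by
    rw [(h t (hJ ht) (hUW (hJU' t ht))).1, ← eval_res le_top (hJU' t ht), sub_eq_zero]
    have h1 : ∑ A, c A t • E.eval (γ t) (hUW (hJU' t ht)) (e A) =
        (heU.fibreEquiv (γ t) (hJU' t ht)).symm fun A => c A t := by
      rw [heU.fibreEquiv_symm_apply]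
      simp only [eval_res]
    rw [h1, LinearEquiv.symm_apply_eq]
    have h2 : heU.fibreEquiv (γ t) (hJU' t ht) (E.eval (γ t) (hJU' t ht) (E.res le_top Z)) =
        d t := by
      funext B
      rw [heU.fibreEquiv_eval (hJU' t ht) le_rfl, hd]
      exact (𝒮.body_of_mem _ _).symm
    rw [h2]
  have hzero : ∀ t ∈ Icc a' b', (fun A => c A t) - d t = 0 →
      ∀ s ∈ Icc a' b', (fun A => c A s) - d s = 0 := fun t ht h0 =>
    eq_zero_of_norm_deriv_le hcd ht h0 (K := K) fun s hs => by
      rw [norm_neg]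
      exact ((Γ s).le_opNorm _).trans (mul_le_mul_of_nonneg_right (hK s hs) (norm_nonneg _))
  filter_upwards [hJn] with t ht
  rw [hiff t ht, hiff t₀ hmem]
  exact ⟨fun h => hzero t₀ hmem h t ht, fun h => hzero t ht h t₀ hmem⟩

/-- Parallel displacements preserve parallel sections. -/
theorem IsParallelDisplacement.apply_eval [IsManifold (𝓡 n) ∞ M] {x y : M}
    {τ : E.Fibre x ≃ₗ[ℝ] E.Fibre y} (hτ : D.IsParallelDisplacement p q x y τ) {Z : E.sec ⊤}
    (hZ : D.IsParallel Z) :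
    τ (E.eval x (Opens.mem_top x) Z) = E.eval y (Opens.mem_top y) Z := by
  induction hτ with
  | smooth γ a b hab hγ τ hτ =>
    obtain ⟨X, hX, ha, hb⟩ := hτ (E.eval (γ a) (Opens.mem_top _) Z)
    rw [← hb]
    -- "Agreement at `s` implies agreement at `t`" is transitive and holds in both directions for
    -- nearby times; connectedness of `[a, b]` carries it from `a` to `b`.
    refine isPreconnected_Icc.induction₂' (fun s t : ℝ =>
      X s = E.eval (γ s) (Opens.mem_top _) Z → X t = E.eval (γ t) (Opens.mem_top _) Z)
      (fun t ht => ?_) (fun _ _ _ _ _ _ h₁ h₂ h => h₂ (h₁ h))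
      (left_mem_Icc.2 hab.le) (right_mem_Icc.2 hab.le) ha
    filter_upwards [hX.eventually_eq_eval hab hγ hZ ht] with s hs
    exact ⟨hs.1, hs.2⟩
  | trans τ σ _ _ h₁ h₂ => rw [LinearEquiv.trans_apply, h₁, h₂]

end SuperConnection

end

noncomputable section

open SuperalgebraSheaf SupermodulePresheaf

/-! ### Parallel displacement along coordinate segments -/

namespace CoordSystem

variable {n m : ℕ} {M : Type u} [TopologicalSpace M] [ChartedSpace (EuclideanSpace ℝ (Fin n)) M]
  {𝒮 : Supermanifold.{u, v} n m M} {E : SupermodulePresheaf.{u, v, w} 𝒮.toSuperalgebraSheaf}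
  {φ : OpenPartialHomeomorph M (EuclideanSpace ℝ (Fin n))} {U : Opens M}
  (C : CoordSystem 𝒮 φ U) {p q : ℕ} {e : Fin p ⊕ Fin q → E.sec U} (he : E.IsFrame U e)
  (D : SuperConnection E ⊤)

/-- A solution of the differential equation of parallel transport along a segment gives a parallel
section along the segment. -/
theorem exists_isParallelAlong {w₁ w₂ : EuclideanSpace ℝ (Fin n)}
    (hseg : ∀ t ∈ Icc (0 : ℝ) 1, w₁ + t • (w₂ - w₁) ∈ C.image) {γ : ℝ → M}
    (hγ : ContinuousOn γ (Icc 0 1)) (hγs : ∀ t, γ t = φ.symm (w₁ + t • (w₂ - w₁)))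
    (h₀ : γ 0 ∈ U) (h₁ : γ 1 ∈ U) {f : ℝ → Fin p ⊕ Fin q → ℝ}
    (hf : IsSegmentSolution (C.connForm he D) w₁ w₂ f) :
    ∃ X : ∀ t, E.Fibre (γ t), D.IsParallelAlong p q γ 0 1 X ∧
      X 0 = (he.fibreEquiv (γ 0) h₀).symm (f 0) ∧ X 1 = (he.fibreEquiv (γ 1) h₁).symm (f 1) := by
  classical
  -- The default 0 is immaterial: for `t` in `[0, 1]` the curve stays in `U`.
  refine ⟨fun t => if h : γ t ∈ U then (he.fibreEquiv (γ t) h).symm (f t) else 0, ?_,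
    dif_pos h₀, dif_pos h₁⟩
  have hφγ : ∀ t ∈ Icc (0 : ℝ) 1, φ (γ t) = w₁ + t • (w₂ - w₁) := fun t ht => by
    rw [hγs, φ.right_inv (hseg t ht).1]
  intro t₀ ht₀
  refine ⟨U, e, fun A t => f t A, fun A t =>
    -(C.connForm he D (w₁ + t • (w₂ - w₁)) (w₂ - w₁) (f t) A), ?_, he, fun t ht hU => ?_⟩
  · rw [hγs]
    exact (hseg t₀ ht₀).2
  have hv : HasDerivWithinAt (fun s => φ (γ s)) (w₂ - w₁) (Icc 0 1) t := by
    have h1 : HasDerivWithinAt (fun s : ℝ => w₁ + s • (w₂ - w₁)) (w₂ - w₁) (Icc 0 1) t := by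
      simpa using ((hasDerivWithinAt_id t (Icc (0 : ℝ) 1)).smul_const (w₂ - w₁)).const_add w₁
    exact h1.congr hφγ (hφγ t ht)
  refine ⟨?_, hasDerivWithinAt_pi.1 (hf t ht), fun A => ∑ i, (w₂ - w₁) i •
    E.eval (γ t) hU (D.nabla U le_top (C.field (Sum.inl i)) (e A)), fun A => ?_, ?_⟩
  · exact (dif_pos hU).trans (he.fibreEquiv_symm_apply hU (f t))
  · refine ⟨U, le_rfl, hU, _, C.extendsVelocity (hγ t ht) hv, ?_⟩
    simp only [E.res_refl, map_sum, LinearMap.sum_apply, map_smul, LinearMap.smul_apply]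
  · refine (he.fibreEquiv (γ t) hU).map_eq_zero_iff.1 ?_
    have h2 := C.fibreEquiv_sum_nabla he D hU (w₂ - w₁) (f t)
    rw [hφγ t ht] at h2
    rw [Finset.sum_add_distrib, map_add]
    refine (congrArg (_ + ·) h2).trans ?_
    have h1 := (he.fibreEquiv (γ t) hU).apply_symm_apply
      (-(C.connForm he D (w₁ + t • (w₂ - w₁)) (w₂ - w₁) (f t)))
    rw [he.fibreEquiv_symm_apply] at h1
    exact (congrArg (· + _) h1).trans (neg_add_cancel _)

/-- Parallel displacement along a short coordinate segment. -/
theorem exists_isParallelDisplacement (hφ : φ ∈ IsManifold.maximalAtlas (𝓡 n) ∞ M)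
    {B : Set (EuclideanSpace ℝ (Fin n))} (hB : Convex ℝ B) (hBs : B ⊆ C.image) {K : ℝ}
    (hK : ∀ u ∈ B, ‖C.connForm he D u‖ ≤ K) {w₁ w₂ : EuclideanSpace ℝ (Fin n)} (h₁ : w₁ ∈ B)
    (h₂ : w₂ ∈ B) (hlen : 2 * (K * ‖w₂ - w₁‖) ≤ 1) {x y : M} (hx : φ.symm w₁ = x)
    (hy : φ.symm w₂ = y) (hxU : x ∈ U) (hyU : y ∈ U) :
    ∃ τ : E.Fibre x ≃ₗ[ℝ] E.Fibre y, D.IsParallelDisplacement p q x y τ ∧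
      ∀ f, IsSegmentSolution (C.connForm he D) w₁ w₂ f →
        τ ((he.fibreEquiv x hxU).symm (f 0)) = (he.fibreEquiv y hyU).symm (f 1) := by
  set γ : ℝ → M := fun t => φ.symm (w₁ + t • (w₂ - w₁)) with hγ
  have hcont : ContinuousOn (C.connForm he D) B :=
    (C.contDiffOn_connForm he D).continuousOn.mono hBs
  have hseg : ∀ t ∈ Icc (0 : ℝ) 1, w₁ + t • (w₂ - w₁) ∈ C.image := fun t ht =>
    hBs (hB.add_smul_sub_mem h₁ h₂ ht)
  -- The fibres depend on the points, so `x` and `y` are replaced by the end points of `γ`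
  -- themselves.
  obtain rfl : γ 0 = x := by rw [← hx, hγ]; simp
  obtain rfl : γ 1 = y := by rw [← hy, hγ]; simp
  have hγs : ContMDiffOn 𝓘(ℝ, ℝ) (𝓡 n) ∞ γ (Icc 0 1) := by
    refine (contMDiffOn_symm_of_mem_maximalAtlas hφ).comp (t := φ.target) ?_
      fun t ht => (hseg t ht).1
    rw [contMDiffOn_iff_contDiffOn]
    fun_prop
  obtain ⟨T, hT⟩ := exists_segment_transport hB hcont h₁ h₂ hK hlen
  refine ⟨((he.fibreEquiv _ hxU).trans T).trans (he.fibreEquiv _ hyU).symm,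
    .smooth γ 0 1 zero_lt_one hγs _ fun X₀ => ?_, fun f hf => ?_⟩
  · obtain ⟨f, hf0, hf⟩ := exists_isSegmentSolution hB hcont h₁ h₂ hK hlen
      (he.fibreEquiv _ hxU X₀)
    obtain ⟨X, hX, hX0, hX1⟩ := C.exists_isParallelAlong he D hseg hγs.continuousOn (fun _ => rfl)
      hxU hyU hf
    refine ⟨X, hX, ?_, ?_⟩
    · rw [hX0, hf0, LinearEquiv.symm_apply_apply]
    · rw [hX1, ← hT f hf, hf0]
      rfl
  · rw [← hT f hf]
    simp

end CoordSystem

end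

/-! ### Local existence of parallel sections on convex coordinate neighbourhoods. -/

noncomputable section

open SuperalgebraSheaf SupermodulePresheaf

variable {n m : ℕ} {M : Type u} [TopologicalSpace M] [ChartedSpace (EuclideanSpace ℝ (Fin n)) M]
  {𝒮 : Supermanifold.{u, v} n m M} {E : SupermodulePresheaf.{u, v, w} 𝒮.toSuperalgebraSheaf}

/-! ### Convex coordinate neighbourhoods -/

namespace CoordSystem

variable {φ : OpenPartialHomeomorph M (EuclideanSpace ℝ (Fin n))} {U : Opens M}
  (C : CoordSystem 𝒮 φ U) {p q : ℕ} {e : Fin p ⊕ Fin q → E.sec U} (he : E.IsFrame U e)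
  (D : SuperConnection E ⊤)

theorem connForm_restrict {V : Opens M} (h : V ≤ U) {u : EuclideanSpace ℝ (Fin n)}
    (hu : φ.symm u ∈ V) :
    (C.restrict h).connForm (he.restrict h) D u = C.connForm he D u := by
  have hΓ : ∀ i A B, (C.restrict h).christoffel (he.restrict h) D i A B =
      𝒮.res h (C.christoffel he D i A B) := fun i A B => by
    rw [christoffel, christoffel, ← he.coef_res le_rfl h, D.nabla_res]
    refine congrFun ((he.restrict h).coef_unique le_rfl ?_) B
    simp only [E.res_refl]
    exact (he.sum_coef h _).symm
  simp only [connForm, hΓ]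
  refine Finset.sum_congr rfl fun i _ => Finset.sum_congr rfl fun A _ =>
    Finset.sum_congr rfl fun B _ => ?_
  rw [𝒮.body_of_mem _ hu, 𝒮.body_of_mem _ (h hu), 𝒮.value_res]

/-- Coordinates and a frame on a convex neighbourhood, small in comparison with the connection
form. -/
structure IsConvex (K : ℝ) : Prop where
  convex : Convex ℝ C.image
  norm_le : ∀ u ∈ C.image, ‖C.connForm he D u‖ ≤ K
  length_le : ∀ w₁ ∈ C.image, ∀ w₂ ∈ C.image, 2 * (K * ‖w₂ - w₁‖) ≤ 1

theorem exists_isConvex [IsManifold (𝓡 n) ∞ M] (hfree : E.IsLocallyFree p q) (x : M) :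
    ∃ (U : Opens M) (C : CoordSystem 𝒮 (chartAt (EuclideanSpace ℝ (Fin n)) x) U)
      (e : Fin p ⊕ Fin q → E.sec U) (he : E.IsFrame U e) (K : ℝ),
      x ∈ U ∧ C.IsConvex he D K := by
  obtain ⟨W, hxW, e₀, he₀⟩ := hfree x
  obtain ⟨U₀, hxU₀, ⟨C₀⟩⟩ := exists_coordSystem 𝒮 x
  set φ := chartAt (EuclideanSpace ℝ (Fin n)) x
  let U₁ : Opens M := U₀ ⊓ W
  have hx₁ : x ∈ U₁ := Opens.mem_inf.2 ⟨hxU₀, hxW⟩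
  let C₁ := C₀.restrict (inf_le_left : U₁ ≤ U₀)
  have he₁ := he₀.restrict (inf_le_right : U₁ ≤ W)
  obtain ⟨K, R, hR0, hball, hK, hlen⟩ := exists_ball_norm_le C₁.isOpen_image
    (C₁.contDiffOn_connForm he₁ D).continuousOn (C₁.apply_mem_image hx₁)
  -- Cut out so that its image in the chart is exactly the ball found above.
  let V : Opens M := U₁ ⊓ ⟨φ.source ∩ φ ⁻¹' Metric.ball (φ x) R,
    φ.isOpen_inter_preimage Metric.isOpen_ball⟩
  have hVU : V ≤ U₁ := inf_le_left
  let C := C₁.restrict hVU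
  have himage : C.image = Metric.ball (φ x) R := by
    ext u
    constructor
    · rintro ⟨h1, h2⟩
      have h3 : φ (φ.symm u) ∈ Metric.ball (φ x) R := h2.2.2
      rwa [φ.right_inv h1] at h3
    · intro hu
      have h1 := hball hu
      refine ⟨h1.1, h1.2, φ.map_target h1.1, ?_⟩
      change φ (φ.symm u) ∈ Metric.ball (φ x) R
      rwa [φ.right_inv h1.1]
  refine ⟨V, C, _, he₁.restrict hVU, K, ⟨hx₁, mem_chart_source _ x, Metric.mem_ball_self hR0⟩,
    ?_, fun u hu => ?_, fun w₁ h₁ w₂ h₂ => ?_⟩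
  · rw [himage]
    exact convex_ball _ _
  · rw [C₁.connForm_restrict he₁ D hVU hu.2]
    rw [himage] at hu
    exact hK u hu
  · rw [himage] at h₁ h₂
    exact hlen w₁ h₁ w₂ h₂

variable {C he D} {K : ℝ}

theorem IsConvex.exists_isParallelDisplacement (hC : C.IsConvex he D K)
    (hφ : φ ∈ IsManifold.maximalAtlas (𝓡 n) ∞ M) {x y : M} (hx : x ∈ U) (hy : y ∈ U) :
    ∃ τ : E.Fibre x ≃ₗ[ℝ] E.Fibre y, D.IsParallelDisplacement p q x y τ ∧
      ∀ f, IsSegmentSolution (C.connForm he D) (φ x) (φ y) f →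
        τ ((he.fibreEquiv x hx).symm (f 0)) = (he.fibreEquiv y hy).symm (f 1) :=
  C.exists_isParallelDisplacement he D hφ hC.convex subset_rfl hC.norm_le
    (C.apply_mem_image hx) (C.apply_mem_image hy)
    (hC.length_le _ (C.apply_mem_image hx) _ (C.apply_mem_image hy))
    (φ.left_inv (C.subset_source hx)) (φ.left_inv (C.subset_source hy)) hx hy

/-- A field of vectors that is invariant under parallel displacements and annihilated by the
covariant derivatives of the curvature is locally the field of values of a parallel section. -/
theorem IsConvex.exists_parallel (hC : C.IsConvex he D K)
    (hφ : φ ∈ IsManifold.maximalAtlas (𝓡 n) ∞ M) {s : ∀ x, E.Fibre x}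
    (hs : ∀ x y (τ : E.Fibre x ≃ₗ[ℝ] E.Fibre y), D.IsParallelDisplacement p q x y τ → τ (s x) = s y)
    (hR : ∀ x (B : Module.End ℝ (E.Fibre x)), D.IsCurvatureOperator x B → B (s x) = 0) :
    ∃ X : E.sec U, (∀ (V : Opens M) (h : V ≤ U) (Y : 𝒮.tangent.sec V),
      D.nabla V le_top Y (E.res h X) = 0) ∧ ∀ x (hx : x ∈ U), E.eval x hx X = s x := by
  classical
  -- The frame coordinates of `s` as a function on the chart; the default 0 is never met on
  -- `C.image`.
  set c : EuclideanSpace ℝ (Fin n) → Fin p ⊕ Fin q → ℝ := fun u =>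
    if h : φ.symm u ∈ U then he.fibreEquiv _ h (s (φ.symm u)) else 0 with hcdef
  have hc : ∀ x (hx : x ∈ U), c (φ x) = he.fibreEquiv x hx (s x) := fun x hx => by
    -- `φ.symm (φ x) = x` is only a proved equality and the fibre depends on the point, so the point
    -- is generalized first.
    have key : ∀ y (hy : y = x), (if h : y ∈ U then he.fibreEquiv _ h (s y) else 0) =
        he.fibreEquiv x hx (s x) := by
      rintro y rfl
      exact dif_pos hx
    exact key _ (φ.left_inv (C.subset_source hx))
  -- Invariance of `s` under displacement along coordinate segments; through
  -- `hasDerivAt_of_transport` it becomes a differential equation for `c`.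
  have htr : ∀ w₁ ∈ C.image, ∀ w₂ ∈ C.image, ∀ f,
      IsSegmentSolution (C.connForm he D) w₁ w₂ f → f 0 = c w₁ → f 1 = c w₂ := by
    intro w₁ h₁ w₂ h₂ f hf hf0
    have e₁ := φ.right_inv h₁.1
    have e₂ := φ.right_inv h₂.1
    have m₁ : φ.symm w₁ ∈ U := h₁.2
    have m₂ : φ.symm w₂ ∈ U := h₂.2
    obtain ⟨τ, hτ, hτf⟩ := hC.exists_isParallelDisplacement hφ m₁ m₂
    rw [e₁, e₂] at hτf
    have h3 := hτf f hf
    have c₁ : c w₁ = he.fibreEquiv _ m₁ (s (φ.symm w₁)) := dif_pos m₁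
    have c₂ : c w₂ = he.fibreEquiv _ m₂ (s (φ.symm w₂)) := dif_pos m₂
    rw [hf0, c₁, LinearEquiv.symm_apply_apply, hs _ _ τ hτ] at h3
    rw [c₂, h3, LinearEquiv.apply_symm_apply]
  have hcd : ∀ w ∈ C.image, ∀ v, HasDerivAt (fun t : ℝ => c (w + t • v))
      (-(C.connForm he D w v (c w))) 0 := fun w hw v =>
    hasDerivAt_of_transport hC.convex C.isOpen_image (C.contDiffOn_connForm he D).continuousOn
      hC.norm_le hC.length_le htr hw v
  have hsm : ContDiffOn ℝ ∞ c C.image := contDiffOn_of_linear_directional_deriv C.isOpen_image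
    hC.convex hC.norm_le (C.contDiffOn_connForm he D) hcd
  have hfd := hasFDerivAt_of_linear_directional_deriv C.isOpen_image
    hC.convex hC.norm_le (C.contDiffOn_connForm he D).continuousOn hcd
  have hlift : ∀ A, ∃ f : 𝒮.sec U, ∀ x hx, 𝒮.value x hx f = c (φ x) A := fun A =>
    C.exists_value_eq le_rfl (fun u => c u A) fun x hx =>
      contDiffAt_pi.1 (hsm.contDiffAt (C.isOpen_image.mem_nhds (C.apply_mem_image hx))) A
  choose f hf using hlift
  -- The lift ∑ f_A e_A already has the values of `s`; the correction lies in step 1, keeps these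
  -- values and achieves N X = 0.
  obtain ⟨X, hXmem, hXe⟩ := C.exists_euler_eq_zero D (∑ A, f A • e A)
  have heval : ∀ x (hx : x ∈ U), E.eval x hx X = s x := fun x hx => by
    have h1 := C.eval_eq_zero_of_mem hXmem hx
    rw [map_sub, sub_eq_zero] at h1
    rw [h1, map_sum, ← (he.fibreEquiv x hx).symm_apply_apply (s x), ← hc x hx,
      he.fibreEquiv_symm_apply]
    exact Finset.sum_congr rfl fun A _ => by rw [eval_smul, hf]
  have hcoef : ∀ x (hx : x ∈ U) A, 𝒮.value x hx (he.coef le_rfl X A) = c (φ x) A :=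
    fun x hx A => by rw [← he.fibreEquiv_eval hx le_rfl, heval, hc x hx]
  have hnabla := C.nabla_eq_zero D hXe
    (fun r T b a => C.mem_of_eval_eq_zero he fun x hx => by
      obtain ⟨B, hB, hBX⟩ := D.exists_curvatureOperator he hx C.flat
        (fun k => C.homField (Sum.inr (T k))) (C.homField b) (C.homField a)
      rw [curvDeriv, ← hBX, heval]
      exact hR x B hB)
    -- In the frame, ∇_i X has the values ∂_i c + Γ_i c. These vanish by comparing two derivatives
    -- of `c`: `h1` from the differential equation, `h2` from the coordinate fields.
    (fun i => C.mem_of_eval_eq_zero he fun x hx => by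
      refine (he.fibreEquiv x hx).map_eq_zero_iff.1 (funext fun B => ?_)
      rw [he.fibreEquiv_eval hx le_rfl, C.value_coef_nabla he D hx]
      have h1 : HasFDerivAt (fun u => c u B) ((ContinuousLinearMap.proj B).comp
          (-(C.connForm he D (φ x)).flip (c (φ x)))) (φ x) :=
        (ContinuousLinearMap.proj (R := ℝ) (φ := fun _ : Fin p ⊕ Fin q => ℝ) B).hasFDerivAt.comp
          (φ x) (hfd _ (C.apply_mem_image hx))
      have h2 := (C.hasFDerivAt le_rfl (he.coef le_rfl X B) x hx).congr_of_eventuallyEq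
        (f₁ := fun u => c u B) (by
          filter_upwards [C.isOpen_image.mem_nhds (C.apply_mem_image hx)] with u hu
          rw [𝒮.body_of_mem _ hu.2, hcoef, φ.right_inv hu.1])
      have h3 := congrArg (fun L => L (EuclideanSpace.single i (1 : ℝ))) (h2.unique h1)
      have h4 : (∑ j, 𝒮.value x hx (applyField (C.field (Sum.inl j)) le_rfl
          (he.coef le_rfl X B)) • EuclideanSpace.proj (𝕜 := ℝ) j :
            EuclideanSpace ℝ (Fin n) →L[ℝ] ℝ) (EuclideanSpace.single i (1 : ℝ)) =
          𝒮.value x hx (applyField (C.field (Sum.inl i)) le_rfl (he.coef le_rfl X B)) := by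
        rw [sum_apply, Finset.sum_eq_single i] <;> simp +contextual
      have h5 : C.connForm he D (φ x) (EuclideanSpace.single i (1 : ℝ)) (c (φ x)) B =
          ∑ A, c (φ x) A * 𝒮.value x hx (C.christoffel he D i A B) := by
        rw [C.connForm_apply he D]
        refine Finset.sum_congr rfl fun A _ => ?_
        rw [Finset.sum_eq_single i] <;>
          simp +contextual [φ.left_inv (C.subset_source hx), 𝒮.body_of_mem _ hx]
      rw [← h4]
      refine (congrArg (· + _) h3).trans ?_
      simp only [hcoef, ← h5]
      exact neg_add_cancel _)
  exact ⟨X, fun V h Y => C.nabla_res_eq_zero D hnabla h Y, heval⟩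

end CoordSystem

end

/-! ### Gluing, and the correspondence between parallel sections and holonomy invariants. -/

noncomputable section

open SuperalgebraSheaf SupermodulePresheaf

/-! ### Parallel sections and holonomy -/

/-- Uniqueness of gluing over all open sets on which `s` and `t` agree. Their union is `W` only up
to a proved equality, so sections are restricted along both inclusions. -/
theorem SupermodulePresheaf.IsSheaf.ext {M : Type u} [TopologicalSpace M]
    {𝒪 : SuperalgebraSheaf.{u, v} M} {E : SupermodulePresheaf.{u, v, w} 𝒪} (hE : E.IsSheaf)
    {W : Opens M} {s t : E.sec W}
    (h : ∀ x ∈ W, ∃ (V : Opens M) (hV : V ≤ W), x ∈ V ∧ E.res hV s = E.res hV t) : s = t := by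
  let 𝒰 : Set (Opens M) := {V | ∃ hV : V ≤ W, E.res hV s = E.res hV t}
  have hle : sSup 𝒰 ≤ W := sSup_le fun V hV => hV.1
  have hge : W ≤ sSup 𝒰 := fun x hx => by
    obtain ⟨V, hV, hxV, hst⟩ := h x hx
    exact (le_sSup (show V ∈ 𝒰 from ⟨hV, hst⟩)) hxV
  obtain ⟨r, -, hr⟩ := hE 𝒰 (fun V => E.res V.2.1 s) fun U V => by rw [E.res_res, E.res_res]
  have h1 : E.res hle s = E.res hle t :=
    (hr _ fun V => by rw [E.res_res]).trans (hr _ fun V => by rw [E.res_res]; exact V.2.2.symm).symm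
  rw [← E.res_refl s, ← E.res_refl t, ← E.res_res hle hge s, ← E.res_res hle hge t, h1]

namespace SuperConnection

variable {n m p q : ℕ} {M : Type u} [TopologicalSpace M]
  [ChartedSpace (EuclideanSpace ℝ (Fin n)) M] [IsManifold (𝓡 n) ∞ M]
  {𝒮 : Supermanifold.{u, v} n m M} {E : SupermodulePresheaf.{u, v, w} 𝒮.toSuperalgebraSheaf}
  (D : SuperConnection E ⊤)

/-- A parallel section over an open set is determined by its values. -/
theorem eq_of_eval_eq (hE : E.IsSheaf) (hfree : E.IsLocallyFree p q) {W : Opens M}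
    {X X' : E.sec W}
    (hX : ∀ (V : Opens M) (h : V ≤ W) (Y : 𝒮.tangent.sec V), D.nabla V le_top Y (E.res h X) = 0)
    (hX' : ∀ (V : Opens M) (h : V ≤ W) (Y : 𝒮.tangent.sec V), D.nabla V le_top Y (E.res h X') = 0)
    (h : ∀ x (hx : x ∈ W), E.eval x hx X = E.eval x hx X') : X = X' := by
  refine hE.ext fun x hx => ?_
  obtain ⟨W₀, hxW₀, e, he⟩ := hfree x
  obtain ⟨U₀, hxU₀, ⟨C₀⟩⟩ := CoordSystem.exists_coordSystem 𝒮 x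
  let U : Opens M := U₀ ⊓ W₀ ⊓ W
  have hUW : U ≤ W := inf_le_right
  let C := C₀.restrict (inf_le_left.trans inf_le_left : U ≤ U₀)
  have heU := he.restrict (inf_le_left.trans inf_le_right : U ≤ W₀)
  refine ⟨U, hUW, ⟨⟨hxU₀, hxW₀⟩, hx⟩, ?_⟩
  rw [← sub_eq_zero]
  refine C.eq_zero_of_parallel D (fun Y => by rw [map_sub, hX, hX', sub_zero])
    (C.mem_of_eval_eq_zero heU fun y hy => ?_)
  rw [map_sub, eval_res, eval_res, h, sub_self]

/-- Any two points of a connected manifold are joined by a parallel displacement. -/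
theorem exists_isParallelDisplacement [ConnectedSpace M] (hfree : E.IsLocallyFree p q)
    (x y : M) : ∃ τ : E.Fibre x ≃ₗ[ℝ] E.Fibre y, D.IsParallelDisplacement p q x y τ := by
  -- The relation is transitive, and convex coordinate neighbourhoods give it in both directions
  -- near each point.
  refine PreconnectedSpace.induction₂'
    (fun x y => ∃ τ : E.Fibre x ≃ₗ[ℝ] E.Fibre y, D.IsParallelDisplacement p q x y τ)
    (fun x => ?_) ⟨fun x y z => ?_⟩ x y
  · obtain ⟨U, C, e, he, K, hx, hC⟩ := CoordSystem.exists_isConvex D hfree x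
    have hφ := IsManifold.chart_mem_maximalAtlas (I := 𝓡 n) (n := ∞) x
    filter_upwards [U.isOpen.mem_nhds hx] with y hy
    obtain ⟨τ, hτ, -⟩ := hC.exists_isParallelDisplacement hφ hx hy
    obtain ⟨σ, hσ, -⟩ := hC.exists_isParallelDisplacement hφ hy hx
    exact ⟨⟨τ, hτ⟩, σ, hσ⟩
  · rintro ⟨τ, hτ⟩ ⟨σ, hσ⟩
    exact ⟨τ.trans σ, .trans τ σ hτ hσ⟩

/-- The values of parallel sections are holonomy invariants. -/
theorem IsParallel.eval_mem_holonomyInvariants {D : SuperConnection E ⊤}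
    (hfree : E.IsLocallyFree p q) {X : E.sec ⊤} (hX : D.IsParallel X) (x : M) :
    E.eval x (Opens.mem_top x) X ∈ D.holonomyInvariants p q x := by
  refine ⟨fun A hA => ?_, fun g hg => ?_⟩
  -- The generators have to kill both homogeneous components, since the annihilator of the sum alone
  -- need not be graded.
  · obtain ⟨X₀, h₀, X₁, h₁, rfl⟩ := E.exists_add X
    obtain ⟨hX₀, hX₁⟩ := hX.of_add h₀ h₁
    obtain ⟨W, hxW, e, he⟩ := hfree x
    rw [map_add]
    refine apply_eq_zero_of_mem_lieSuperClosure (he.isCompl_fibrePar hxW)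
      (eval_mem_fibrePar _ h₀) (eval_mem_fibrePar _ h₁) ?_ hA
    rintro _ ⟨y, τ, B, hτ, hB, rfl⟩
    have key : ∀ Z : E.sec ⊤, D.IsParallel Z →
        τ.symm (B (τ (E.eval x (Opens.mem_top x) Z))) = 0 := fun Z hZ => by
      rw [hτ.apply_eval hZ, hB.apply_eval hZ, map_zero]
    exact ⟨key X₀ hX₀, key X₁ hX₁⟩
  · induction hg using Subgroup.closure_induction with
    | mem g hg => exact IsParallelDisplacement.apply_eval hg hX
    | one => rfl
    | mul g g' _ _ h h' => rw [LinearEquiv.mul_apply, h', h]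
    | inv g _ h => exact (LinearEquiv.symm_apply_eq g).2 h.symm

/-- Parallel displacement extends a holonomy invariant to a field of vectors that is invariant
under parallel displacements. -/
theorem exists_invariant_field [ConnectedSpace M] (hfree : E.IsLocallyFree p q) {x : M}
    {a : E.Fibre x} (ha : a ∈ D.holonomyInvariants p q x) :
    ∃ s : ∀ y, E.Fibre y, s x = a ∧
      (∀ y z (τ : E.Fibre y ≃ₗ[ℝ] E.Fibre z), D.IsParallelDisplacement p q y z τ →
        τ (s y) = s z) ∧
      ∀ y (B : Module.End ℝ (E.Fibre y)), D.IsCurvatureOperator y B → B (s y) = 0 := by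
  choose τ hτ using fun y => D.exists_isParallelDisplacement hfree x y
  have hloop : ∀ g, D.IsParallelDisplacement p q x x g → g a = a := fun g hg =>
    ha.2 g (Subgroup.subset_closure hg)
  -- The choice of `τ y` is immaterial: closing up curves by a return to `x` gives loops, which fix
  -- `a`. A curvature operator at `y` kills `τ y a` because its conjugate by `τ y` is a generator of
  -- the holonomy algebra.
  refine ⟨fun y => τ y a, hloop _ (hτ x), fun y z σ hσ => ?_, fun y B hB => ?_⟩
  · obtain ⟨ρ, hρ⟩ := D.exists_isParallelDisplacement hfree z x
    refine ρ.injective ?_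
    exact (hloop _ (.trans _ _ (.trans _ _ (hτ y) hσ) hρ)).trans
      (hloop _ (.trans _ _ (hτ z) hρ)).symm
  · refine (τ y).symm.map_eq_zero_iff.1 ?_
    exact ha.1 _ (subset_lieSuperClosure x _ ⟨y, τ y, B, hτ y, hB, rfl⟩)

/-- Every holonomy invariant is the value of a parallel section. -/
theorem exists_isParallel_eval_eq [ConnectedSpace M] (hE : E.IsSheaf)
    (hfree : E.IsLocallyFree p q) {x : M} {a : E.Fibre x} (ha : a ∈ D.holonomyInvariants p q x) :
    ∃ X : E.sec ⊤, D.IsParallel X ∧ E.eval x (Opens.mem_top x) X = a := by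
  obtain ⟨s, hsx, hs, hR⟩ := D.exists_invariant_field hfree ha
  -- All open sets that carry a parallel section with values `s`. Parallel sections are determined
  -- by their values, so these agree on overlaps and glue.
  let 𝒰 : Set (Opens M) := {V | ∃ X : E.sec V,
    (∀ (V' : Opens M) (h : V' ≤ V) (Y : 𝒮.tangent.sec V'),
      D.nabla V' le_top Y (E.res h X) = 0) ∧ ∀ y (hy : y ∈ V), E.eval y hy X = s y}
  have hcover : ∀ y, ∃ V : 𝒰, y ∈ V.1 := fun y => by
    obtain ⟨U, C, e, he, K, hy, hC⟩ := CoordSystem.exists_isConvex D hfree y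
    exact ⟨⟨U, hC.exists_parallel
      (IsManifold.chart_mem_maximalAtlas (I := 𝓡 n) (n := ∞) y) hs hR⟩, hy⟩
  have htop : (⊤ : Opens M) ≤ sSup 𝒰 := fun y _ => by
    obtain ⟨V, hy⟩ := hcover y
    exact le_sSup V.2 hy
  choose X hX hXs using fun V : 𝒰 => V.2
  obtain ⟨t, ht, -⟩ := hE 𝒰 X fun U V =>
    D.eq_of_eval_eq hE hfree (fun W h Y => by rw [E.res_res, hX])
      (fun W h Y => by rw [E.res_res, hX])
      fun y hy => by rw [eval_res, eval_res, hXs, hXs]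
  have hres : ∀ V : 𝒰, E.res le_top (E.res htop t) = X V := fun V => by
    rw [E.res_res]
    exact ht V
  refine ⟨E.res htop t, fun U Y => hE.ext fun y hy => ?_, ?_⟩
  · obtain ⟨V, hyV⟩ := hcover y
    refine ⟨U ⊓ V.1, inf_le_left, ⟨hy, hyV⟩, ?_⟩
    rw [D.nabla_res, E.res_res, ← E.res_res le_top (inf_le_right : U ⊓ V.1 ≤ V.1), hres V, hX,
      map_zero]
  · obtain ⟨V, hxV⟩ := hcover x
    rw [← eval_res le_top hxV, hres V, hXs, hsx]

/-- Injectivity: displacement from `x` to `y` takes the value at `x` to the value at `y`, so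
parallel sections that agree at `x` have the same values everywhere and coincide. -/
theorem bijOn_eval [ConnectedSpace M] (hE : E.IsSheaf) (hfree : E.IsLocallyFree p q) (x : M) :
    Set.BijOn (E.eval x (Opens.mem_top x)) {X | D.IsParallel X} (D.holonomyInvariants p q x) := by
  refine ⟨fun X hX => hX.eval_mem_holonomyInvariants hfree x, fun X hX X' hX' h => ?_,
    fun a ha => D.exists_isParallel_eval_eq hE hfree ha⟩
  refine D.eq_of_eval_eq hE hfree (fun V _ Y => hX V Y) (fun V _ Y => hX' V Y) fun y _ => ?_
  obtain ⟨τ, hτ⟩ := D.exists_isParallelDisplacement hfree x y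
  rw [← hτ.apply_eval hX, ← hτ.apply_eval hX', h]

end SuperConnection

end

theorem mainTheorem1 {n m p q : ℕ} {M : Type u} [TopologicalSpace M]
    [ChartedSpace (EuclideanSpace ℝ (Fin n)) M] [IsManifold (𝓡 n) ∞ M]
    [T2Space M] [SecondCountableTopology M] [ConnectedSpace M]
    (𝒮 : Supermanifold.{u, v} n m M)
    (E : SupermodulePresheaf.{u, v, w} 𝒮.toSuperalgebraSheaf)
    (hE : E.IsSheaf) (hfree : E.IsLocallyFree p q) (D : SuperConnection E ⊤) :
    ((∃ X : E.sec ⊤, X ≠ 0 ∧ D.IsParallel X) ↔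
      ∀ x : M, ∃ a : E.Fibre x, a ≠ 0 ∧ a ∈ D.holonomyInvariants p q x) ∧
    ((∃ X : E.sec ⊤, X ≠ 0 ∧ D.IsParallel X) ↔
      ∃ x : M, ∃ a : E.Fibre x, a ≠ 0 ∧ a ∈ D.holonomyInvariants p q x) ∧
    ∀ x : M, Set.BijOn (E.eval x (Opens.mem_top x)) {X | D.IsParallel X}
      (D.holonomyInvariants p q x) := by
  have hbij := D.bijOn_eval hE hfree
  have hto : (∃ X : E.sec ⊤, X ≠ 0 ∧ D.IsParallel X) →
      ∀ x : M, ∃ a : E.Fibre x, a ≠ 0 ∧ a ∈ D.holonomyInvariants p q x := by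
    rintro ⟨X, hX0, hX⟩ x
    -- The zero section is parallel, so injectivity of evaluation forces a non-zero parallel section
    -- to have a non-zero value at every point.
    refine ⟨_, fun h => hX0 ((hbij x).injOn hX (fun U Y => ?_) (h.trans (map_zero _).symm)),
      (hbij x).mapsTo hX⟩
    rw [map_zero, map_zero]
  have hfrom : (∃ x : M, ∃ a : E.Fibre x, a ≠ 0 ∧ a ∈ D.holonomyInvariants p q x) →
      ∃ X : E.sec ⊤, X ≠ 0 ∧ D.IsParallel X := by
    rintro ⟨x, a, ha0, ha⟩
    obtain ⟨X, hX, rfl⟩ := (hbij x).surjOn ha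
    exact ⟨X, fun h => ha0 (by rw [h, map_zero]), hX⟩
  have hsome : (∀ x : M, ∃ a : E.Fibre x, a ≠ 0 ∧ a ∈ D.holonomyInvariants p q x) →
      ∃ x : M, ∃ a : E.Fibre x, a ≠ 0 ∧ a ∈ D.holonomyInvariants p q x := fun h =>
    ⟨Classical.arbitrary M, h _⟩
  exact ⟨⟨hto, fun h => hfrom (hsome h)⟩, ⟨fun h => hsome (hto h), hfrom⟩, hbij⟩
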